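/- **Setting.** All simplicial complexes are finite. A *Riemannian polyhedron* is a finite simplicial complex $L$ with a piecewise smooth Riemannian metric: on each closed simplex a continuous Riemannian metric, smooth in its interior, the metric of a simplex restricting to those of its faces. It carries the length distance $\mathrm{dist}_L$. For a Lipschitz singular simplex $\sigma:\Delta^q\to L$, $\mathrm{vol}(\sigma)$ is the infimum of $\mathrm{vol}(\Delta^q,G)$ over the Riemannian metrics $G$ on $\Delta^q$ for which $\sigma:(\Delta^q,\mathrm{dist}_G)\to(L,\mathrm{dist}_L)$ is $1$-Lipschitz; for an integral Lipschitz chain, $\mathrm{vol}(\sum k_i\sigma_i)=\sum|k_i|\,\mathrm{vol}(\sigma_i)$. For a Lipschitz $q$-cycle $z$, $\mathrm{FillVol}(z\subset L)$ is the infimum of $\mathrm{vol}(c)$ over the Lipschitz $(q+1)$-chains $c$ of $L$ with $\partial c=z$. Let $n\ge 2$. A *geometric cycle* $(V,f,g)$ of dimension $n$ consists of an oriented $n$-dimensional pseudomanifold $V$, a continuous map $f:V\to X$ ($X=K(\pi,1)$, or more generally any topological space) and a piecewise smooth Riemannian metric $g$ on $V$. Its relative systole $\mathrm{sys}(V,f,g)\in[0,\infty]$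 is the infimum of the lengths of the loops $\gamma$ of $V$ for which $f\circ\gamma$ is not contractible in $X$. It is *included in* $L$ if $V$ is embedded in $L$, each simplex of $V$ being mapped in a $C^1$ way into a simplex of $L$, and $g$ is the metric induced by that of $L$. For $v\in V$, $B_V(v,R)$ is the ball of radius $R$ for the length distance of $(V,g)$. For a measurable region $B\subset V$, $\mathrm{FillVol}(\partial B\subset L)$ is the infimum of $\mathrm{vol}(c)+\mathrm{vol}(B-p)$, over the integral chains $p$ of affine $n$-simplices contained in simplices of $V$ and the Lipschitz $n$-chains $c$ of $L$ with $\partial c=\partial p$; here $\mathrm{vol}(B-p)=\int_V|1_B-m_p|\,d\mathrm{vol}_g$, where $m_p$ is the multiplicity function of $p$ with respect to the orientation of $V$. (So $\partial B$ is filled by the generalized chains $c+(B-p)$.) The cycle $(V,f,g)$ is *filling-$\varepsilon$-regular* in $L$ if $0<\varepsilon<\tfrac12\mathrm{sys}(V,f,g)$ and, for every $v\in V$ and every $R\in[\varepsilon,\tfrac12\mathrm{sys}(V,f,g)[$, $$\mathrm{vol}(B_V(v,R))\le(1+\varepsilon)\,\mathrm{FillVol}(\partial B_V(v,R)\subset L).$$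 **Theorem.** Let $n\ge2$ and $c>0$. There is a constant $C>0$, depending only on $n$ and $c$, with the following property. Let $L$ be a Riemannian polyhedron such that $\mathrm{FillVol}(z\subset L)\le c\,[\mathrm{vol}(z)]^{\frac{n}{n-1}}$ for every Lipschitz cycle $z$ of dimension $n-1$ in $L$, and let $(V,f,g)$ be a geometric cycle of dimension $n$ included in $L$ that is filling-$\varepsilon$-regular in $L$. Then for every $v\in V$ and every $R\in[\varepsilon,\tfrac12\mathrm{sys}(V,f,g)[$, $$\mathrm{vol}(B_V(v,R))\ \ge\ \frac{C}{(1+\varepsilon)^{n-1}}\,(R-\varepsilon)^n ,$$ and, if $\varepsilon\le1$, $$\mathrm{vol}(B_V(v,R))\ \ge\ C\,(R-\varepsilon)^n .$$ -/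

import Mathlib

open scoped ENNReal NNReal ContDiff
open MeasureTheory Set

noncomputable section

namespace FillingRegular

/-! ### Finite simplicial complexes and their realizations

A finite simplicial complex `K` on a finite vertex type `U` is realized inside the standard simplex
of `U → ℝ`: a point is given by its barycentric coordinates. -/

/-- The closed simplex spanned by the vertices in `s`. -/
def closedSimplex {U : Type*} [Fintype U] (s : Finset U) : Set (U → ℝ) :=
  {x | (∀ u, 0 ≤ x u) ∧ ∑ u, x u = 1 ∧ ∀ u, u ∉ s → x u = 0}

/-- The relative interior of the simplex spanned by `s`. -/
def openSimplex {U : Type*} [Fintype U] (s : Finset U) : Set (U → ℝ) :=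
  {x | x ∈ closedSimplex s ∧ ∀ u ∈ s, 0 < x u}

/-- The direction space of the simplex spanned by `s`, i.e. its tangent space at every point. -/
def tangent {U : Type*} [Fintype U] (s : Finset U) : Set (U → ℝ) :=
  {w | ∑ u, w u = 0 ∧ ∀ u, u ∉ s → w u = 0}

/-- The polyhedron `|K|`. -/
def space {U : Type*} [Fintype U] (K : PreAbstractSimplicialComplex U) : Set (U → ℝ) :=
  {x | ∃ s ∈ K.faces, x ∈ closedSimplex s}

open Classical in
/-- The `q`-dimensional simplices of `K`, as increasing lists of vertices `v 0 < ⋯ < v q`. -/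
def simplices {U : Type*} [Fintype U] [LinearOrder U] (K : PreAbstractSimplicialComplex U)
    (q : ℕ) : Finset (Fin (q + 1) → U) :=
  Finset.univ.filter fun v => StrictMono v ∧ Finset.univ.image v ∈ K.faces

/-! ### Piecewise smooth Riemannian metrics -/

/-- A piecewise smooth Riemannian metric on the polyhedron `|K|`: on each closed simplex `s` a
continuous field `form s` of inner products on the tangent space of `s`, smooth in the interior
of `s`, such that the metric of a simplex restricts to the metrics of its faces. The values of
`form s x` outside the tangent space of `s` are irrelevant. -/
structure RiemannianMetric {U : Type*} [Fintype U] (K : PreAbstractSimplicialComplex U) where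
  form : Finset U → (U → ℝ) → LinearMap.BilinForm ℝ (U → ℝ)
  symm : ∀ s ∈ K.faces, ∀ x ∈ closedSimplex s, ∀ u ∈ tangent s, ∀ v ∈ tangent s,
    form s x u v = form s x v u
  pos : ∀ s ∈ K.faces, ∀ x ∈ closedSimplex s, ∀ u ∈ tangent s, u ≠ 0 → 0 < form s x u u
  continuousOn : ∀ s ∈ K.faces, ∀ u ∈ tangent s, ∀ v ∈ tangent s,
    ContinuousOn (fun x => form s x u v) (closedSimplex s)
  smooth : ∀ s ∈ K.faces, ∀ u ∈ tangent s, ∀ v ∈ tangent s,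
    ContDiffOn ℝ ∞ (fun x => form s x u v) (openSimplex s)
  compatible : ∀ s ∈ K.faces, ∀ t ∈ K.faces, s ⊆ t → ∀ x ∈ closedSimplex s,
    ∀ u ∈ tangent s, ∀ v ∈ tangent s, form t x u v = form s x u v

/-- Infimum of the lengths of the `C¹` curves from `x` to `y` that stay in one closed simplex. -/
def RiemannianMetric.simplexDist {U : Type*} [Fintype U] {K : PreAbstractSimplicialComplex U}
    (g : RiemannianMetric K) (x y : U → ℝ) : ℝ≥0∞ :=
  ⨅ (s : Finset U) (γ : ℝ → U → ℝ)
    (_ : s ∈ K.faces ∧ ContDiffOn ℝ 1 γ (Icc 0 1) ∧ (∀ t ∈ Icc (0 : ℝ) 1, γ t ∈ closedSimplex s) ∧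
      γ 0 = x ∧ γ 1 = y),
    ∫⁻ t in Icc (0 : ℝ) 1, ENNReal.ofReal
      (√(g.form s (γ t) (derivWithin γ (Icc 0 1) t) (derivWithin γ (Icc 0 1) t)))

/-- The length distance of a Riemannian polyhedron: infimum of the lengths of the piecewise `C¹`
curves from `x` to `y` (`∞` if there is none). -/
def RiemannianMetric.dist {U : Type*} [Fintype U] {K : PreAbstractSimplicialComplex U}
    (g : RiemannianMetric K) (x y : U → ℝ) : ℝ≥0∞ :=
  ⨅ (m : ℕ) (z : Fin (m + 1) → U → ℝ) (_ : z 0 = x ∧ z (Fin.last m) = y),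
    ∑ i : Fin m, g.simplexDist (z i.castSucc) (z i.succ)

/-- Parametrization of the simplex with vertices `v 0, …, v q` by `(y₁, …, y_q)`, the barycentric
coordinates with respect to `v 1, …, v q`. -/
def chart {U : Type*} [DecidableEq U] {q : ℕ} (v : Fin (q + 1) → U) (y : Fin q → ℝ) : U → ℝ :=
  (1 - ∑ i, y i) • Pi.single (v 0) (1 : ℝ) + ∑ i, y i • Pi.single (v i.succ) (1 : ℝ)

/-- The domain of the charts. -/
def corner (q : ℕ) : Set (Fin q → ℝ) := {y | (∀ i, 0 ≤ y i) ∧ ∑ i, y i ≤ 1}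

/-- The coordinate vector fields of `chart v`. -/
def edge {U : Type*} [DecidableEq U] {q : ℕ} (v : Fin (q + 1) → U) (i : Fin q) : U → ℝ :=
  Pi.single (v i.succ) (1 : ℝ) - Pi.single (v 0) (1 : ℝ)

/-- The Riemannian density `√det g` in the chart of the simplex `v`. -/
def RiemannianMetric.density {U : Type*} [Fintype U] [LinearOrder U]
    {K : PreAbstractSimplicialComplex U} (g : RiemannianMetric K) {q : ℕ} (v : Fin (q + 1) → U)
    (y : Fin q → ℝ) : ℝ≥0∞ :=
  ENNReal.ofReal (√(Matrix.det (Matrix.of fun i j : Fin q =>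
    g.form (Finset.univ.image v) (chart v y) (edge v i) (edge v j))))

/-- The `q`-dimensional Riemannian volume measure carried by the `q`-simplices of `K`. -/
def RiemannianMetric.vol {U : Type*} [Fintype U] [LinearOrder U]
    {K : PreAbstractSimplicialComplex U} (g : RiemannianMetric K) (q : ℕ) : Measure (U → ℝ) :=
  ∑ v ∈ simplices K q,
    Measure.map (chart v) ((volume.restrict (corner q)).withDensity (g.density v))

/-! ### Lipschitz singular chains in a Riemannian polyhedron, volume and filling volume -/

/-- Integral singular `q`-chains in `W → ℝ`. -/
abbrev Chain (W : Type*) (q : ℕ) : Type _ := (stdSimplex ℝ (Fin (q + 1)) → (W → ℝ)) →₀ ℤ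

/-- The singular boundary `∂σ = ∑ (-1)^i σ ∘ δ_i`, extended additively (it is `0` on `0`-chains). -/
def boundary {W : Type*} : (q : ℕ) → Chain W q → Chain W (q - 1)
  | 0, _ => 0
  | q + 1, c => c.sum fun σ k =>
      ∑ i : Fin (q + 2), Finsupp.single (fun x => σ (stdSimplex.map i.succAbove x)) ((-1) ^ (i : ℕ) * k)

/-- `σ` is a Lipschitz singular simplex in the metric space `(|K|, dist)`. -/
def RiemannianMetric.IsLipschitzSimplex {W : Type*} [Fintype W]
    {K : PreAbstractSimplicialComplex W} (g : RiemannianMetric K) {q : ℕ}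
    (σ : stdSimplex ℝ (Fin (q + 1)) → (W → ℝ)) : Prop :=
  (∀ x, σ x ∈ space K) ∧ ∃ A : ℝ≥0, ∀ x y, g.dist (σ x) (σ y) ≤ A * edist x y

/-- `c` is a Lipschitz chain in `(|K|, dist)`. -/
def RiemannianMetric.IsLipschitzChain {W : Type*} [Fintype W]
    {K : PreAbstractSimplicialComplex W} (g : RiemannianMetric K) {q : ℕ} (c : Chain W q) : Prop :=
  ∀ σ ∈ c.support, g.IsLipschitzSimplex σ

/-- The volume of a singular simplex `σ` of `(|K|, dist)`: the infimum of the volumes of the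
Riemannian metrics `G` on the standard simplex for which `σ` is a contraction from
`(Δ^q, dist_G)` to `(|K|, dist)`. -/
def RiemannianMetric.simplexVol {W : Type*} [Fintype W]
    {K : PreAbstractSimplicialComplex W} (g : RiemannianMetric K) {q : ℕ}
    (σ : stdSimplex ℝ (Fin (q + 1)) → (W → ℝ)) : ℝ≥0∞ :=
  ⨅ (G : RiemannianMetric (⊤ : PreAbstractSimplicialComplex (Fin (q + 1))))
    (_ : ∀ x y : stdSimplex ℝ (Fin (q + 1)), g.dist (σ x) (σ y) ≤ G.dist x.1 y.1),
    G.vol q univ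

/-- The volume `∑ |kᵢ| vol(σᵢ)` of a chain `∑ kᵢ σᵢ`. -/
def RiemannianMetric.chainVol {W : Type*} [Fintype W]
    {K : PreAbstractSimplicialComplex W} (g : RiemannianMetric K) {q : ℕ} (c : Chain W q) : ℝ≥0∞ :=
  ∑ σ ∈ c.support, ((c σ).natAbs : ℝ≥0∞) * g.simplexVol σ

/-- The filling volume in `|K|` of a `q`-cycle `z`: the infimum of the volumes of the Lipschitz
`(q+1)`-chains in `|K|` with boundary `z` (`∞` if there is none). -/
def RiemannianMetric.fillVol {W : Type*} [Fintype W]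
    {K : PreAbstractSimplicialComplex W} (g : RiemannianMetric K) {q : ℕ} (z : Chain W q) : ℝ≥0∞ :=
  ⨅ (c : Chain W (q + 1)) (_ : g.IsLipschitzChain c ∧ boundary (q + 1) c = z), g.chainVol c

/-- The isoperimetric inequality for cycles of dimension `q`, with constant `c`. -/
def RiemannianMetric.IsoperimetricInequality {W : Type*} [Fintype W]
    {K : PreAbstractSimplicialComplex W} (g : RiemannianMetric K) (q : ℕ) (c : ℝ) : Prop :=
  ∀ z : Chain W q, g.IsLipschitzChain z → boundary q z = 0 →
    g.fillVol z ≤ ENNReal.ofReal c * g.chainVol z ^ (((q : ℝ) + 1) / q)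

/-! ### Pseudomanifolds and geometric cycles -/

/-- `K` is a pseudomanifold of dimension `n`. -/
structure IsPseudomanifold {U : Type*} [DecidableEq U] (n : ℕ)
    (K : PreAbstractSimplicialComplex U) : Prop where
  nonempty : ∃ s ∈ K.faces, s.card = n + 1
  pure : ∀ s ∈ K.faces, ∃ t ∈ K.faces, s ⊆ t ∧ t.card = n + 1
  two_cofaces : ∀ r ∈ K.faces, r.card = n → {s | s ∈ K.faces ∧ s.card = n + 1 ∧ r ⊆ s}.ncard = 2
  stronglyConnected : ∀ s ∈ K.faces, s.card = n + 1 → ∀ t ∈ K.faces, t.card = n + 1 →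
    Relation.ReflTransGen
      (fun a b => b ∈ K.faces ∧ b.card = n + 1 ∧ (a ∩ b).card = n) s t

/-- `o` is an orientation of the `n`-dimensional pseudomanifold `K`: signs on the `n`-simplices for
which `∑ o(v) [v]` is a simplicial cycle (the fundamental cycle). -/
structure IsOrientation {U : Type*} [Fintype U] [LinearOrder U] (n : ℕ)
    (K : PreAbstractSimplicialComplex U) (o : (Fin (n + 1) → U) → ℤ) : Prop where
  sign : ∀ v ∈ simplices K n, o v = 1 ∨ o v = -1
  cycle : ∀ r : Fin n → U,
    ∑ v ∈ simplices K n, ∑ i : Fin (n + 1),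
      (if v ∘ i.succAbove = r then (-1) ^ (i : ℕ) * o v else 0) = 0

/-- A geometric cycle `(V, f, g)` of dimension `n`: an oriented pseudomanifold `V`, a continuous map
`f` from `V` to a space `X` and a piecewise smooth Riemannian metric `g` on `V`.
(The space `X` is arbitrary here; the case of interest is `X = K(π, 1)`, where the cycle represents
the class `f_*[V]`.) -/
structure GeometricCycle (n : ℕ) (U : Type*) [Fintype U] [LinearOrder U]
    (X : Type*) [TopologicalSpace X] where
  V : PreAbstractSimplicialComplex U
  pseudomanifold : IsPseudomanifold n V
  o : (Fin (n + 1) → U) → ℤ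
  orientation : IsOrientation n V o
  f : C(space V, X)
  g : RiemannianMetric V

/-- The length of a path in the metric space `(|K|, dist)`. -/
def RiemannianMetric.length {U : Type*} [Fintype U] {K : PreAbstractSimplicialComplex U}
    (g : RiemannianMetric K) {x y : space K} (p : Path x y) : ℝ≥0∞ :=
  ⨆ (m : ℕ) (t : Fin (m + 1) → unitInterval) (_ : Monotone t),
    ∑ i : Fin m, g.dist (p (t i.castSucc)).1 (p (t i.succ)).1

/-- The relative systole `sys(V, f, g)`: the infimum of the lengths of the loops of `V` whose image
under `f` is not contractible. -/
def GeometricCycle.sys {n : ℕ} {U : Type*} [Fintype U] [LinearOrder U] {X : Type*}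
    [TopologicalSpace X] (Z : GeometricCycle n U X) : ℝ≥0∞ :=
  ⨅ (v : space Z.V) (p : Path v v)
    (_ : ¬ Path.Homotopic (p.map Z.f.continuous) (Path.refl (Z.f v))), Z.g.length p

/-- The ball `B_V(v, R)` of `V`, for the length distance of `(V, g)`. -/
def GeometricCycle.ball {n : ℕ} {U : Type*} [Fintype U] [LinearOrder U] {X : Type*}
    [TopologicalSpace X] (Z : GeometricCycle n U X) (v : U → ℝ) (R : ℝ) : Set (U → ℝ) :=
  {x | x ∈ space Z.V ∧ Z.g.dist v x ≤ ENNReal.ofReal R}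

/-- The geometric cycle `(V, f, g)` is included in the polyhedron `|K|` with metric `h`: an
injective continuous map `V → |K|` that sends each simplex of `V` into a simplex of `K`, is `C¹` on
each simplex of `V`, and for which `g` is the metric induced by `h`. -/
structure GeometricCycle.Inclusion {n : ℕ} {U : Type*} [Fintype U] [LinearOrder U] {X : Type*}
    [TopologicalSpace X] (Z : GeometricCycle n U X) {W : Type*} [Fintype W]
    {K : PreAbstractSimplicialComplex W} (h : RiemannianMetric K) where
  toFun : (U → ℝ) → (W → ℝ)
  continuousOn : ContinuousOn toFun (space Z.V)
  injOn : InjOn toFun (space Z.V)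
  isometric : ∀ s ∈ Z.V.faces, ∃ t ∈ K.faces, MapsTo toFun (closedSimplex s) (closedSimplex t) ∧
    ∃ D : (U → ℝ) → (U → ℝ) →L[ℝ] (W → ℝ), ContinuousOn D (closedSimplex s) ∧
      ∀ x ∈ closedSimplex s, HasFDerivWithinAt toFun (D x) (closedSimplex s) x ∧
        ∀ u ∈ tangent s, ∀ w ∈ tangent s,
          Z.g.form s x u w = h.form t (toFun x) (D x u) (D x w)

/-! ### Filling volume of the boundary of a region of `V`

For a measurable region `B` of `V`, e.g. a ball, `∂B` is in general not a finite Lipschitz singular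
chain. It is filled by generalized chains `c + (B - p)`, where `p` is a chain of affine simplices of
`V`, `c` is a Lipschitz chain of the ambient polyhedron with `∂c = ∂p`, and `B - p` is a piece of
`V` with integer multiplicities. -/

/-- Integral chains of affine `n`-simplices; a simplex is given by its list of vertices. -/
abbrev AffineChain (U : Type*) (n : ℕ) : Type _ := (Fin (n + 1) → (U → ℝ)) →₀ ℤ

/-- All the affine simplices of `p` are contained in `n`-simplices of `V`. -/
def IsAffineChainIn {U : Type*} [Fintype U] [LinearOrder U] (V : PreAbstractSimplicialComplex U)
    {n : ℕ} (p : AffineChain U n) : Prop :=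
  ∀ a ∈ p.support, ∃ v ∈ simplices V n, ∀ i, a i ∈ closedSimplex (Finset.univ.image v)

open Classical in
/-- The multiplicity at `x` of a chain `p` of affine simplices of `V`: each simplex containing `x`
counts with its coefficient and with sign `1` or `-1`, according to whether its orientation agrees
with that of `V` (`0` for degenerate simplices). -/
def GeometricCycle.multiplicity {n : ℕ} {U : Type*} [Fintype U] [LinearOrder U] {X : Type*}
    [TopologicalSpace X] (Z : GeometricCycle n U X) (p : AffineChain U n) (x : U → ℝ) : ℤ :=
  p.sum fun a k => if x ∈ convexHull ℝ (range a) then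
      k * ∑ v ∈ simplices Z.V n, (if ∀ i, a i ∈ closedSimplex (Finset.univ.image v) then
        Z.o v * SignType.sign (Matrix.det (Matrix.of fun i j => a i (v j))) else 0)
    else 0

/-- The singular chain of the ambient polyhedron given by a chain of affine simplices of `V`. -/
def GeometricCycle.Inclusion.push {n : ℕ} {U : Type*} [Fintype U] [LinearOrder U] {X : Type*}
    [TopologicalSpace X] {Z : GeometricCycle n U X} {W : Type*} [Fintype W]
    {K : PreAbstractSimplicialComplex W} {h : RiemannianMetric K} (j : Z.Inclusion h)
    (p : AffineChain U n) : Chain W n :=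
  p.mapDomain fun a x => j.toFun (∑ i, x i • a i)

/-- The filling volume in `|K|` of the boundary of the region `B` of `V`: the infimum of
`vol(c) + vol(B - p)` over the chains `c + (B - p)` with boundary `∂B`, i.e. with `∂c = ∂p`. -/
def GeometricCycle.Inclusion.fillVolBoundary {n : ℕ} {U : Type*} [Fintype U] [LinearOrder U]
    {X : Type*} [TopologicalSpace X] {Z : GeometricCycle n U X} {W : Type*} [Fintype W]
    {K : PreAbstractSimplicialComplex W} {h : RiemannianMetric K} (j : Z.Inclusion h)
    (B : Set (U → ℝ)) : ℝ≥0∞ :=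
  ⨅ (p : AffineChain U n) (c : Chain W n)
    (_ : IsAffineChainIn Z.V p ∧ h.IsLipschitzChain c ∧ boundary n c = boundary n (j.push p)),
    h.chainVol c +
      ∫⁻ x, ENNReal.ofReal |B.indicator (1 : (U → ℝ) → ℝ) x - (Z.multiplicity p x : ℝ)| ∂(Z.g.vol n)

/-- The cycle `(V, f, g)` is filling-`ε`-regular in the polyhedron `|K|` that contains it:
`0 < ε < sys / 2`, and every ball of `V` of radius `R ∈ [ε, sys / 2)` satisfies
`vol B_V(R) ≤ (1 + ε) FillVol(∂B_V(R))`. -/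
structure GeometricCycle.Inclusion.IsFillingRegular {n : ℕ} {U : Type*} [Fintype U] [LinearOrder U]
    {X : Type*} [TopologicalSpace X] {Z : GeometricCycle n U X} {W : Type*} [Fintype W]
    {K : PreAbstractSimplicialComplex W} {h : RiemannianMetric K} (j : Z.Inclusion h)
    (ε : ℝ) : Prop where
  pos : 0 < ε
  lt_sys : ENNReal.ofReal ε < Z.sys / 2
  vol_ball_le : ∀ v ∈ space Z.V, ∀ R : ℝ, ε ≤ R → ENNReal.ofReal R < Z.sys / 2 →
    Z.g.vol n (Z.ball v R) ≤ ENNReal.ofReal (1 + ε) * j.fillVolBoundary (Z.ball v R)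

end FillingRegular

end

/-!
The theorem rests on the comparison of the volume `F t` of the ball of radius `t` with the area of
its boundary sphere. By filling-regularity and the isoperimetric inequality,
`F t ≤ (1 + ε) c (area t) ^ (n / (n - 1))`; by the coarea inequality, `∫ area ≤ C₁ F`. Such an
integrated differential inequality forces `F` to grow at least like the `n`-th power
(`pow_le_of_integral_inequality`). No regularity of the distance spheres is available, so the sphere
is replaced by piecewise linear approximations, and only a coarea inequality with some constant
depending on the dimension is proved, which suffices.

*Approximation.* The simplices of `V` are subdivided edgewise `k` times. This subdivision is a chain
map (`bd_subdivide`), and the edges of the small simplices are copies, scaled by `2⁻ᵏ`, of those of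
the original simplex (`stepsScaled_iterSimplex`), so that the shapes do not degenerate. On each small
simplex the distance function is replaced by the affine interpolation of its vertex values. The
sublevel `{≤ t}` of the interpolation is a chain `p` of affine simplices (`cut`), and since the
subdivided fundamental chain is a cycle, the boundary of `p` is the level `{= t}` (`slice`,
`bd_cutMap`). The isoperimetric inequality fills this cycle; its filling, together with the
difference between the ball and `p`, is a competitor in the filling volume of the boundary of the
ball (`fillVolBoundary_le`). The multiplicity of `p` equals the indicator of the ball except within
distance `O(2⁻ᵏ)` of the sphere (`lintegral_sub_multiplicity_le`), so the difference tends to zero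
unless the sphere has positive volume, which happens for only countably many radii.

*Area of the slices.* The volume of an affine simplex is at most the one of a constant metric
(`simplexVol_singularSimplex_le`). Since volume is base times height, the slice of a small simplex
`σ` is bounded by `vol σ` times the slope of the interpolation, divided by its oscillation on `σ`
(`gram_det_mul_sq_le`, `simplexVol_level_le`); integration over the levels gives a coarea inequality
(`lintegral_sliceBound_le`).

*Slopes.* The interpolations are uniformly Lipschitz (`exists_forall_slopeLE`), with a bound that
depends on the metric. To get a bound that does not, Rademacher's theorem is used: near a point where
the distance function is differentiable, its slope is controlled, and so is the slope of the
interpolations on sufficiently small simplices of the subdivision (`ae_eventually_slopeLE`). The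
volume of the remaining simplices tends to zero (`tendsto_chartVol_steepSet`).

The lower limit, as `k` tends to infinity, of the areas of the slices is the function required by the
growth lemma (`exists_area_profile`), by Fatou's lemma.
-/

set_option linter.unusedSectionVars false

noncomputable section

namespace FillingRegular

/-! ### Chains of affine simplices -/

/-- Integral chains of ordered affine simplices with `q` vertices in `P`. The index counts the
vertices, so that the chain groups are augmented: `VertexChain P 0` is generated by the empty
simplex. -/
abbrev VertexChain (P : Type*) (q : ℕ) : Type _ := (Fin q → P) →₀ ℤ

section Algebra

variable {P : Type*}

/-- The augmented simplicial boundary. -/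
def bd (q : ℕ) : VertexChain P (q + 1) →ₗ[ℤ] VertexChain P q :=
  Finsupp.linearCombination ℤ fun σ =>
    ∑ i : Fin (q + 1), (-1 : ℤ) ^ (i : ℕ) • Finsupp.single (fun j => σ (i.succAbove j)) (1 : ℤ)

/-- The cone with apex `b`. -/
def cone (b : P) (q : ℕ) : VertexChain P q →ₗ[ℤ] VertexChain P (q + 1) :=
  Finsupp.linearCombination ℤ fun σ =>
    Finsupp.single (Fin.cons b σ : Fin (q + 1) → P) (1 : ℤ)

lemma bd_single {q : ℕ} (σ : Fin (q + 1) → P) :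
    bd q (Finsupp.single σ 1) =
      ∑ i : Fin (q + 1), (-1 : ℤ) ^ (i : ℕ) • Finsupp.single (fun j => σ (i.succAbove j)) (1 : ℤ) := by
  simp [bd]

lemma cone_single (b : P) {q : ℕ} (σ : Fin q → P) :
    cone b q (Finsupp.single σ 1) = Finsupp.single (Fin.cons b σ : Fin (q + 1) → P) 1 := by
  simp [cone]

lemma bd_single_zero (σ : Fin (0 + 1) → P) :
    bd 0 (Finsupp.single σ 1) = Finsupp.single (Fin.elim0 : Fin 0 → P) 1 := by
  rw [bd_single]
  refine (Fin.sum_univ_one _).trans ?_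
  rw [Fin.val_zero, pow_zero, one_smul]
  congr 1
  exact Subsingleton.elim _ _

lemma bd_cone_zero (b : P) (x : VertexChain P 0) : bd 0 (cone b 0 x) = x := by
  have : (bd 0).comp (cone b 0) = LinearMap.id := by
    refine Finsupp.lhom_ext' fun σ => LinearMap.ext_ring ?_
    simp only [LinearMap.comp_apply, Finsupp.lsingle_apply, cone_single, bd_single_zero,
      LinearMap.id_apply]
    congr 1
    exact Subsingleton.elim _ _
  exact LinearMap.congr_fun this x

lemma bd_cone_succ (b : P) {q : ℕ} (x : VertexChain P (q + 1)) :
    bd (q + 1) (cone b (q + 1) x) = x - cone b q (bd q x) := by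
  have : (bd (q + 1)).comp (cone b (q + 1)) = LinearMap.id - (cone b q).comp (bd q) := by
    refine Finsupp.lhom_ext' fun σ => LinearMap.ext_ring ?_
    simp only [LinearMap.comp_apply, Finsupp.lsingle_apply, cone_single, bd_single,
      LinearMap.id_apply, LinearMap.sub_apply]
    rw [Fin.sum_univ_succ, map_sum, sub_eq_add_neg, ← Finset.sum_neg_distrib]
    congr 1
    · simp
    · refine Finset.sum_congr rfl fun i _ => ?_
      rw [map_smul, cone_single, Fin.val_succ, pow_succ, mul_neg_one, neg_smul]
      congr 3
      funext j
      refine Fin.cases ?_ (fun j => ?_) j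
      · simp
      · simp [Fin.succ_succAbove_succ]
  exact LinearMap.congr_fun this x

lemma bd_bd {q : ℕ} (x : VertexChain P (q + 2)) : bd q (bd (q + 1) x) = 0 := by
  have key : ∀ q : ℕ, (bd (P := P) q).comp (bd (q + 1)) = 0 := by
    intro q
    induction q with
    | zero =>
      refine Finsupp.lhom_ext' fun σ => LinearMap.ext_ring ?_
      simp only [LinearMap.comp_apply, Finsupp.lsingle_apply, LinearMap.zero_apply]
      rw [← Fin.cons_self_tail σ, ← cone_single, bd_cone_succ, map_sub, bd_cone_zero, sub_self]
    | succ q ih =>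
      refine Finsupp.lhom_ext' fun σ => LinearMap.ext_ring ?_
      simp only [LinearMap.comp_apply, Finsupp.lsingle_apply, LinearMap.zero_apply]
      rw [← Fin.cons_self_tail σ, ← cone_single, bd_cone_succ, map_sub, bd_cone_succ]
      have := LinearMap.congr_fun ih (Finsupp.single (Fin.tail σ) 1)
      simp only [LinearMap.comp_apply, LinearMap.zero_apply] at this
      rw [this, map_zero, sub_zero, sub_self]
  exact LinearMap.congr_fun (key q) x

end Algebra

/-! ### Weighted masses of chains -/

section Weight

variable {α β : Type*}

/-- The mass `∑ |kᵢ| w(σᵢ)` of a chain `∑ kᵢ σᵢ` with respect to the weight `w`. -/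
def weight (w : α → ℝ≥0∞) (x : α →₀ ℤ) : ℝ≥0∞ :=
  ∑ τ ∈ x.support, ((x τ).natAbs : ℝ≥0∞) * w τ

lemma weight_eq_sum (w : α → ℝ≥0∞) (x : α →₀ ℤ) {s : Finset α} (h : x.support ⊆ s) :
    weight w x = ∑ τ ∈ s, ((x τ).natAbs : ℝ≥0∞) * w τ := by
  refine Finset.sum_subset h fun τ _ hτ => ?_
  simp [Finsupp.notMem_support_iff.1 hτ]

@[simp] lemma weight_zero (w : α → ℝ≥0∞) : weight w 0 = 0 := by simp [weight]

lemma weight_single (w : α → ℝ≥0∞) (a : α) (k : ℤ) :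
    weight w (Finsupp.single a k) = (k.natAbs : ℝ≥0∞) * w a := by
  classical
  rw [weight_eq_sum w _ (Finsupp.support_single_subset)]
  simp

lemma weight_add_le (w : α → ℝ≥0∞) (x y : α →₀ ℤ) :
    weight w (x + y) ≤ weight w x + weight w y := by
  classical
  rw [weight_eq_sum w (x + y) Finsupp.support_add,
    weight_eq_sum w x (Finset.subset_union_left (s₂ := y.support)),
    weight_eq_sum w y (Finset.subset_union_right (s₁ := x.support)), ← Finset.sum_add_distrib]
  refine Finset.sum_le_sum fun τ _ => ?_
  rw [← add_mul]
  gcongr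
  rw [Finsupp.add_apply]
  exact_mod_cast Int.natAbs_add_le _ _

lemma weight_smul (w : α → ℝ≥0∞) (k : ℤ) (x : α →₀ ℤ) :
    weight w (k • x) = (k.natAbs : ℝ≥0∞) * weight w x := by
  rw [weight_eq_sum w (k • x) Finsupp.support_smul, weight, Finset.mul_sum]
  refine Finset.sum_congr rfl fun τ _ => ?_
  rw [Finsupp.smul_apply, smul_eq_mul, Int.natAbs_mul, Nat.cast_mul, mul_assoc]

lemma weight_neg (w : α → ℝ≥0∞) (x : α →₀ ℤ) : weight w (-x) = weight w x := by
  have := weight_smul w (-1) x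
  simpa using this

lemma weight_sum_le {ι : Type*} (w : α → ℝ≥0∞) (s : Finset ι) (f : ι → α →₀ ℤ) :
    weight w (∑ i ∈ s, f i) ≤ ∑ i ∈ s, weight w (f i) := by
  classical
  induction s using Finset.induction_on with
  | empty => simp
  | insert i s hi ih =>
    rw [Finset.sum_insert hi, Finset.sum_insert hi]
    exact (weight_add_le w _ _).trans (by gcongr)

/-- A linear map on chains that is given on generators does not increase masses by more than it
does on generators. -/
lemma weight_linearCombination_le (w : β → ℝ≥0∞) (f : α → β →₀ ℤ) (x : α →₀ ℤ) :
    weight w (Finsupp.linearCombination ℤ f x) ≤ weight (fun a => weight w (f a)) x := by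
  rw [Finsupp.linearCombination_apply, Finsupp.sum]
  refine (weight_sum_le w _ _).trans (le_of_eq ?_)
  exact Finset.sum_congr rfl fun a _ => weight_smul w _ _

lemma weight_mono {w w' : α → ℝ≥0∞} {x : α →₀ ℤ} (h : ∀ a ∈ x.support, w a ≤ w' a) :
    weight w x ≤ weight w' x :=
  Finset.sum_le_sum fun a ha => by gcongr; exact h a ha

lemma weight_eq_zero {w : α → ℝ≥0∞} {x : α →₀ ℤ} (h : weight w x = 0) :
    ∀ a ∈ x.support, w a = 0 := by
  intro a ha
  have := (Finset.sum_eq_zero_iff.1 h) a ha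
  rcases mul_eq_zero.1 this with h' | h'
  · simp at h'; simp [h'] at ha
  · exact h'

lemma weight_bd_le {P : Type*} {q : ℕ} (w : (Fin q → P) → ℝ≥0∞) (σ : Fin (q + 1) → P) :
    weight w (bd q (Finsupp.single σ 1)) ≤ ∑ i : Fin (q + 1), w (fun j => σ (i.succAbove j)) := by
  rw [bd_single]
  refine (weight_sum_le w _ _).trans (Finset.sum_le_sum fun i _ => ?_)
  rw [weight_smul, weight_single]
  simp [Int.natAbs_pow]

lemma weight_cone_le {P : Type*} {q : ℕ} (w : (Fin (q + 1) → P) → ℝ≥0∞) (b : P)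
    (x : VertexChain P q) :
    weight w (cone b q x) ≤ weight (fun σ => w (Fin.cons b σ : Fin (q + 1) → P)) x := by
  refine (weight_linearCombination_le w _ x).trans (weight_mono fun a _ => ?_)
  rw [weight_single]
  simp

end Weight

/-! ### Cutting chains along a level of a vertex function -/

section Crosses

variable {P : Type*}

/-- The simplex `σ` has vertices on both sides of the level `t`. -/
def Crosses (r : P → ℝ) (t : ℝ) {q : ℕ} (σ : Fin q → P) : Prop :=
  (∃ i, r (σ i) ≤ t) ∧ ∃ i, t < r (σ i)

lemma Crosses.of_face {r : P → ℝ} {t : ℝ} {q : ℕ} {σ : Fin (q + 1) → P} {i : Fin (q + 1)}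
    (h : Crosses r t fun j => σ (i.succAbove j)) : Crosses r t σ :=
  ⟨h.1.imp' _ fun _ h => h, h.2.imp' _ fun _ h => h⟩

lemma not_crosses_iff {r : P → ℝ} {t : ℝ} {q : ℕ} {σ : Fin q → P} :
    ¬ Crosses r t σ ↔ (∀ i, r (σ i) ≤ t) ∨ ∀ i, t < r (σ i) := by
  rw [Crosses, not_and_or]
  push Not
  tauto

end Crosses

section Cut

variable {P : Type*} [AddCommGroup P] [Module ℝ P]

/-- The points of the simplex `σ` where the affine interpolation of the vertex values of `r`
equals `t`. -/
def levelSet (r : P → ℝ) (t : ℝ) {q : ℕ} (σ : Fin q → P) : Set P :=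
  {x | ∃ w ∈ stdSimplex ℝ (Fin q), ∑ i, w i * r (σ i) = t ∧ ∑ i, w i • σ i = x}

/-- A chosen point of the level set of `σ` (an arbitrary point if the level set is empty). -/
def levelPt (r : P → ℝ) (t : ℝ) {q : ℕ} (σ : Fin q → P) : P :=
  Classical.epsilon fun x => x ∈ levelSet r t σ

lemma levelSet_nonempty {r : P → ℝ} {t : ℝ} {q : ℕ} {σ : Fin q → P} (h : Crosses r t σ) :
    (levelSet r t σ).Nonempty := by
  obtain ⟨⟨i, hi⟩, j, hj⟩ := h
  have hpos : 0 < r (σ j) - r (σ i) := by linarith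
  have hij : i ≠ j := by rintro rfl; linarith
  set a := (t - r (σ i)) / (r (σ j) - r (σ i)) with ha
  have ha0 : 0 ≤ a := div_nonneg (by linarith) hpos.le
  have ha1 : a ≤ 1 := (div_le_one hpos).2 (by linarith)
  refine ⟨_, (1 - a) • Pi.single i 1 + a • Pi.single j 1, ?_, ?_, rfl⟩
  · exact convex_stdSimplex ℝ (Fin q) (single_mem_stdSimplex ℝ i) (single_mem_stdSimplex ℝ j)
      (by linarith) ha0 (by ring)
  · have : ∑ x, ((1 - a) • (Pi.single i 1 : Fin q → ℝ) + a • (Pi.single j 1 : Fin q → ℝ)) x * r (σ x)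
        = (1 - a) * r (σ i) + a * r (σ j) := by
      simp [add_mul, Finset.sum_add_distrib, Pi.single_apply]
    rw [this]
    have : a * (r (σ j) - r (σ i)) = t - r (σ i) := div_mul_cancel₀ _ hpos.ne'
    linarith

lemma levelPt_mem {r : P → ℝ} {t : ℝ} {q : ℕ} {σ : Fin q → P} (h : Crosses r t σ) :
    levelPt r t σ ∈ levelSet r t σ :=
  Classical.epsilon_spec (levelSet_nonempty h)

lemma levelSet_face_subset (r : P → ℝ) (t : ℝ) {q : ℕ} (σ : Fin (q + 1) → P) (i : Fin (q + 1)) :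
    levelSet r t (fun j => σ (i.succAbove j)) ⊆ levelSet r t σ := by
  rintro x ⟨w, hw, h1, h2⟩
  refine ⟨Fin.insertNth i 0 w, ⟨?_, ?_⟩, ?_, ?_⟩
  · intro j
    refine Fin.succAboveCases i ?_ (fun j => ?_) j
    · simp
    · simpa using hw.1 j
  · rw [Fin.sum_univ_succAbove _ i]; simpa using hw.2
  · rw [Fin.sum_univ_succAbove _ i]; simpa using h1
  · rw [Fin.sum_univ_succAbove _ i]; simpa using h2

lemma levelSet_subset_convexHull (r : P → ℝ) (t : ℝ) {q : ℕ} (σ : Fin q → P) :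
    levelSet r t σ ⊆ convexHull ℝ (range σ) := by
  rintro x ⟨w, hw, -, rfl⟩
  exact (convex_convexHull ℝ _).sum_mem (fun i _ => hw.1 i) hw.2
    fun i _ => subset_convexHull ℝ _ (mem_range_self i)

/-- The oriented level set `{r = t}` of the simplex `σ`, for the affine interpolation of the vertex
values of `r`. It is the cone, from a point of the level set of `σ`, over the level sets of the
faces. A vertex above the level contributes the empty simplex. -/
def slice (r : P → ℝ) (t : ℝ) : (q : ℕ) → (Fin (q + 1) → P) → VertexChain P q
  | 0, σ => if t < r (σ 0) then -Finsupp.single Fin.elim0 1 else 0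
  | q + 1, σ => -cone (levelPt r t σ) q
      (Finsupp.linearCombination ℤ (slice r t q) (bd (q + 1) (Finsupp.single σ 1)))

/-- `slice`, extended linearly. -/
def sliceMap (r : P → ℝ) (t : ℝ) (q : ℕ) : VertexChain P (q + 1) →ₗ[ℤ] VertexChain P q :=
  Finsupp.linearCombination ℤ (slice r t q)

@[simp] lemma sliceMap_single (r : P → ℝ) (t : ℝ) {q : ℕ} (σ : Fin (q + 1) → P) :
    sliceMap r t q (Finsupp.single σ 1) = slice r t q σ := by simp [sliceMap]

lemma slice_succ (r : P → ℝ) (t : ℝ) {q : ℕ} (σ : Fin (q + 2) → P) :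
    slice r t (q + 1) σ = -cone (levelPt r t σ) q (sliceMap r t q (bd (q + 1) (Finsupp.single σ 1))) :=
  rfl

lemma bd_sliceMap (r : P → ℝ) (t : ℝ) {q : ℕ} (x : VertexChain P (q + 2)) :
    bd q (sliceMap r t (q + 1) x) = -sliceMap r t q (bd (q + 1) x) := by
  have key : ∀ q : ℕ, (bd q).comp (sliceMap r t (q + 1)) = -(sliceMap r t q).comp (bd (q + 1)) := by
    intro q
    induction q with
    | zero =>
      refine Finsupp.lhom_ext' fun σ => LinearMap.ext_ring ?_
      simp only [LinearMap.comp_apply, Finsupp.lsingle_apply, LinearMap.neg_apply,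
        sliceMap_single, slice_succ]
      rw [map_neg, bd_cone_zero]
    | succ q ih =>
      refine Finsupp.lhom_ext' fun σ => LinearMap.ext_ring ?_
      simp only [LinearMap.comp_apply, Finsupp.lsingle_apply, LinearMap.neg_apply,
        sliceMap_single, slice_succ]
      rw [map_neg, bd_cone_succ]
      have := LinearMap.congr_fun ih (bd (q + 1 + 1) (Finsupp.single σ 1))
      simp only [LinearMap.comp_apply, LinearMap.neg_apply] at this
      rw [this, bd_bd, map_zero, neg_zero, map_zero, sub_zero]
  exact LinearMap.congr_fun (key q) x

/-- The slice of a simplex that does not cross the level vanishes. -/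
lemma slice_eq_zero_of_not_crosses {r : P → ℝ} {t : ℝ} {q : ℕ} {σ : Fin (q + 2) → P}
    (h : ¬ Crosses r t σ) : slice r t (q + 1) σ = 0 := by
  induction q with
  | zero =>
    rw [slice_succ, bd_single]
    rw [Fin.sum_univ_succ, Fin.sum_univ_succ]
    simp only [map_add, map_smul, sliceMap_single, slice]
    have : (t < r (σ 0)) ↔ (t < r (σ 1)) := by
      by_contra hne
      apply h
      by_cases h0 : t < r (σ 0)
      · exact ⟨⟨1, not_lt.1 fun h1 => hne (by tauto)⟩, 0, h0⟩
      · exact ⟨⟨0, not_lt.1 h0⟩, 1, by tauto⟩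
    simp [Fin.succAbove, this]
  | succ q ih =>
    rw [slice_succ, bd_single, map_sum, Finset.sum_eq_zero, map_zero, neg_zero]
    intro i _
    rw [map_smul, sliceMap_single, ih fun hc => h hc.of_face, smul_zero]

/-- The slice of a simplex consists of a bounded number of simplices with vertices in the level
set. -/
lemma weight_slice_le (r : P → ℝ) (t : ℝ) {q : ℕ} (σ : Fin (q + 1) → P)
    (w : (Fin q → P) → ℝ≥0∞) (B : ℝ≥0∞)
    (hB : ∀ τ : Fin q → P, (∀ i, τ i ∈ levelSet r t σ) → w τ ≤ B) :
    weight w (slice r t q σ) ≤ (q + 1).factorial * B := by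
  induction q with
  | zero =>
    simp only [slice]
    split_ifs
    · rw [weight_neg, weight_single]
      simpa using hB _ (fun i => i.elim0)
    · simp
  | succ q ih =>
    by_cases hc : Crosses r t σ
    · rw [slice_succ, weight_neg]
      refine (weight_cone_le w _ _).trans ?_
      refine (weight_linearCombination_le _ _ _).trans ?_
      refine (weight_bd_le _ σ).trans ?_
      calc _ ≤ ∑ i : Fin (q + 2), ((q + 1).factorial * B : ℝ≥0∞) := by
            refine Finset.sum_le_sum fun i _ => ih _ _ fun τ hτ => hB _ fun j => ?_
            refine Fin.cases ?_ (fun j => ?_) j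
            · simpa using levelPt_mem hc
            · simpa using levelSet_face_subset r t σ i (hτ j)
        _ = ((q + 1 + 1).factorial * B : ℝ≥0∞) := by
            rw [Finset.sum_const, Finset.card_univ, Fintype.card_fin, nsmul_eq_mul,
              Nat.factorial_succ (q + 1)]
            push_cast
            ring
    · rw [slice_eq_zero_of_not_crosses hc]; simp

open Classical in
/-- The part `{r ≤ t}` of the simplex `σ`, for the affine interpolation of the vertex values of
`r`, as a chain; the index counts the vertices. -/
def cut (r : P → ℝ) (t : ℝ) : (q : ℕ) → (Fin q → P) → VertexChain P q
  | 0, σ => Finsupp.single σ 1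
  | q + 1, σ =>
    if ∀ i, r (σ i) ≤ t then Finsupp.single σ 1
    else if ∀ i, t < r (σ i) then 0
    else cone (levelPt r t σ) q
      (Finsupp.linearCombination ℤ (cut r t q) (bd q (Finsupp.single σ 1)) + slice r t q σ)

/-- `cut`, extended linearly. -/
def cutMap (r : P → ℝ) (t : ℝ) (q : ℕ) : VertexChain P q →ₗ[ℤ] VertexChain P q :=
  Finsupp.linearCombination ℤ (cut r t q)

@[simp] lemma cutMap_single (r : P → ℝ) (t : ℝ) {q : ℕ} (σ : Fin q → P) :
    cutMap r t q (Finsupp.single σ 1) = cut r t q σ := by simp [cutMap]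

lemma cut_of_le {r : P → ℝ} {t : ℝ} {q : ℕ} {σ : Fin q → P} (h : ∀ i, r (σ i) ≤ t) :
    cut r t q σ = Finsupp.single σ 1 := by
  cases q with
  | zero => rfl
  | succ q => simp [cut, h]

lemma cut_of_lt {r : P → ℝ} {t : ℝ} {q : ℕ} {σ : Fin (q + 1) → P} (h : ∀ i, t < r (σ i)) :
    cut r t (q + 1) σ = 0 := by
  have : ¬ ∀ i, r (σ i) ≤ t := fun h' => absurd (h 0) (h' 0).not_gt
  rw [cut, if_neg this, if_pos h]

lemma cut_of_crosses {r : P → ℝ} {t : ℝ} {q : ℕ} {σ : Fin (q + 1) → P} (h : Crosses r t σ) :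
    cut r t (q + 1) σ = cone (levelPt r t σ) q
      (cutMap r t q (bd q (Finsupp.single σ 1)) + slice r t q σ) := by
  have h1 : ¬ ∀ i, r (σ i) ≤ t := fun h' => by
    obtain ⟨i, hi⟩ := h.2; exact absurd hi (h' i).not_gt
  have h2 : ¬ ∀ i, t < r (σ i) := fun h' => by
    obtain ⟨i, hi⟩ := h.1; exact absurd (h' i) hi.not_gt
  rw [cut, if_neg h1, if_neg h2]
  rfl

/-- The boundary of `{r ≤ t}` consists of the part `{r ≤ t}` of the boundary and of the slice
`{r = t}`. -/
lemma bd_cutMap (r : P → ℝ) (t : ℝ) {q : ℕ} (x : VertexChain P (q + 1)) :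
    bd q (cutMap r t (q + 1) x) = cutMap r t q (bd q x) + sliceMap r t q x := by
  have key : ∀ q : ℕ, (bd q).comp (cutMap r t (q + 1)) =
      (cutMap r t q).comp (bd q) + sliceMap r t q := by
    intro q
    induction q with
    | zero =>
      refine Finsupp.lhom_ext' fun σ => LinearMap.ext_ring ?_
      simp only [LinearMap.comp_apply, Finsupp.lsingle_apply, LinearMap.add_apply,
        sliceMap_single, cutMap_single]
      rw [bd_single_zero, cutMap_single]
      by_cases h : t < r (σ 0)
      · rw [cut_of_lt (fun i => by rwa [Fin.fin_one_eq_zero i])]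
        simp [slice, h, cut]
      · rw [cut_of_le (fun i => by rw [Fin.fin_one_eq_zero i]; exact not_lt.1 h), bd_single_zero]
        simp [slice, h, cut]
    | succ q ih =>
      refine Finsupp.lhom_ext' fun σ => LinearMap.ext_ring ?_
      simp only [LinearMap.comp_apply, Finsupp.lsingle_apply, LinearMap.add_apply,
        sliceMap_single, cutMap_single]
      by_cases hc : Crosses r t σ
      · rw [cut_of_crosses hc, bd_cone_succ]
        have := LinearMap.congr_fun ih (bd (q + 1) (Finsupp.single σ 1))
        simp only [LinearMap.comp_apply, LinearMap.add_apply] at this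
        have h2 := bd_sliceMap r t (Finsupp.single σ 1)
        rw [sliceMap_single] at h2
        rw [map_add, this, h2, bd_bd, map_zero, zero_add, add_neg_cancel, map_zero, sub_zero]
      · rw [slice_eq_zero_of_not_crosses hc, add_zero]
        rcases not_crosses_iff.1 hc with h | h
        · rw [cut_of_le h, bd_single, map_sum]
          refine Finset.sum_congr rfl fun i _ => ?_
          rw [map_smul, cutMap_single, cut_of_le fun j => h _]
        · rw [cut_of_lt h, bd_single, map_sum, map_zero, Finset.sum_eq_zero]
          intro i _
          rw [map_smul, cutMap_single, cut_of_lt fun j => h _, smul_zero]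
  exact LinearMap.congr_fun (key q) x

/-- The number of simplices needed for `cut`, up to a bound. -/
def cutCount : ℕ → ℕ
  | 0 => 1
  | q + 1 => (q + 1) * cutCount q + (q + 1).factorial + 1

lemma weight_cut_le (r : P → ℝ) (t : ℝ) {q : ℕ} (σ : Fin q → P)
    (w : (Fin q → P) → ℝ≥0∞) (B : ℝ≥0∞)
    (hB : ∀ τ : Fin q → P, (∀ i, τ i ∈ convexHull ℝ (range σ)) → w τ ≤ B) :
    weight w (cut r t q σ) ≤ cutCount q * B := by
  induction q with
  | zero =>
    rw [cut, weight_single]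
    simpa [cutCount] using hB σ (fun i => i.elim0)
  | succ q ih =>
    by_cases hc : Crosses r t σ
    · have hb := levelSet_subset_convexHull r t σ (levelPt_mem hc)
      rw [cut_of_crosses hc]
      refine (weight_cone_le w _ _).trans ((weight_add_le _ _ _).trans ?_)
      have h1 : weight (fun τ => w (Fin.cons (levelPt r t σ) τ : Fin (q + 1) → P))
          (cutMap r t q (bd q (Finsupp.single σ 1))) ≤ (q + 1 : ℕ) * (cutCount q * B) := by
        refine (weight_linearCombination_le _ _ _).trans ((weight_bd_le _ σ).trans ?_)
        refine (Finset.sum_le_sum fun i _ => ih _ _ fun τ hτ => hB _ fun j => ?_).trans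
          (le_of_eq ?_)
        · refine Fin.cases ?_ (fun j => ?_) j
          · simpa using hb
          · refine convexHull_mono ?_ (by simpa using hτ j)
            rintro _ ⟨k, rfl⟩
            exact mem_range_self _
        · rw [Finset.sum_const, Finset.card_univ, Fintype.card_fin, nsmul_eq_mul]
      have h2 : weight (fun τ => w (Fin.cons (levelPt r t σ) τ : Fin (q + 1) → P))
          (slice r t q σ) ≤ (q + 1).factorial * B := by
        refine weight_slice_le r t σ _ _ fun τ hτ => hB _ fun j => ?_
        refine Fin.cases ?_ (fun j => ?_) j
        · simpa using hb
        · simpa using levelSet_subset_convexHull r t σ (hτ j)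
      refine (add_le_add h1 h2).trans ?_
      rw [cutCount, ← mul_assoc, ← add_mul]
      gcongr
      norm_cast
      exact Nat.le_succ _
    · have hw : weight w (cut r t (q + 1) σ) ≤ B := by
        rcases not_crosses_iff.1 hc with h | h
        · rw [cut_of_le h, weight_single]
          simpa using hB σ fun i => subset_convexHull ℝ _ (mem_range_self i)
        · rw [cut_of_lt h]; simp
      refine hw.trans ?_
      rw [cutCount]
      push_cast
      exact le_mul_of_one_le_left' le_add_self

end Cut

/-! ### Edgewise subdivision -/

section Hull

variable {P : Type*} [AddCommGroup P] [Module ℝ P]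

lemma mem_convexHull_range_iff {q : ℕ} {σ : Fin q → P} {x : P} :
    x ∈ convexHull ℝ (range σ) ↔ ∃ w ∈ stdSimplex ℝ (Fin q), ∑ i, w i • σ i = x := by
  constructor
  · intro hx
    have hconv : Convex ℝ ((Fintype.linearCombination ℝ σ) '' stdSimplex ℝ (Fin q)) :=
      (convex_stdSimplex ℝ (Fin q)).linear_image _
    have hsub : range σ ⊆ (Fintype.linearCombination ℝ σ) '' stdSimplex ℝ (Fin q) := by
      rintro _ ⟨i, rfl⟩
      exact ⟨Pi.single i 1, single_mem_stdSimplex ℝ i, by simp⟩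
    obtain ⟨w, hw, rfl⟩ := convexHull_min hsub hconv hx
    exact ⟨w, hw, by simp [Fintype.linearCombination_apply]⟩
  · rintro ⟨w, hw, rfl⟩
    exact (convex_convexHull ℝ _).sum_mem (fun i _ => hw.1 i) hw.2
      fun i _ => subset_convexHull ℝ _ (mem_range_self i)

/-- Normalization of a nonnegative combination, including the case where all the coefficients
vanish. -/
lemma exists_smul_eq_sum {q : ℕ} (σ : Fin (q + 1) → P) (u : Fin (q + 1) → ℝ) (hu : ∀ i, 0 ≤ u i) :
    ∃ y ∈ convexHull ℝ (range σ), (∑ i, u i) • y = ∑ i, u i • σ i := by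
  rcases (Finset.sum_nonneg fun i (_ : i ∈ Finset.univ) => hu i).eq_or_lt with h | h
  · refine ⟨σ 0, subset_convexHull ℝ _ (mem_range_self 0), ?_⟩
    have := (Finset.sum_eq_zero_iff_of_nonneg fun i _ => hu i).1 h.symm
    rw [← h, zero_smul, Finset.sum_eq_zero]
    intro i hi
    rw [this i hi, zero_smul]
  · refine ⟨(∑ i, u i)⁻¹ • ∑ i, u i • σ i, mem_convexHull_range_iff.2
      ⟨fun i => (∑ i, u i)⁻¹ * u i, ⟨fun i => by have := hu i; positivity, ?_⟩, ?_⟩, ?_⟩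
    · rw [← Finset.mul_sum, inv_mul_cancel₀ h.ne']
    · simp [Finset.smul_sum, mul_smul]
    · rw [smul_smul, mul_inv_cancel₀ h.ne', one_smul]

end Hull

section Subdivision

variable {P : Type*} [AddCommGroup P] [Module ℝ P]

/-- The midpoint of the edge between the first and the last vertex. -/
def endMid {q : ℕ} (σ : Fin (q + 1) → P) : P := (2⁻¹ : ℝ) • (σ 0 + σ (Fin.last q))

/-- The simplices of the edgewise subdivision of `σ`: cones, from the midpoint of the edge between
the first and the last vertex, over the simplices of the subdivisions of the first face and of the
last face. -/
def subSimplex : (q : ℕ) → (Fin (q + 1) → P) → (Fin q → Bool) → (Fin (q + 1) → P)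
  | 0, σ, _ => σ
  | q + 1, σ, β => Fin.cons (endMid σ)
      (subSimplex q (if β 0 then Fin.init σ else Fin.tail σ) (Fin.tail β))

/-- The coefficients of the simplices of the edgewise subdivision. -/
def subSign : (q : ℕ) → (Fin q → Bool) → ℤ
  | 0, _ => 1
  | q + 1, β => (if β 0 then (-1) ^ (q + 1) else 1) * subSign q (Fin.tail β)

/-- Edgewise subdivision of chains. -/
def subdivide (q : ℕ) : VertexChain P (q + 1) →ₗ[ℤ] VertexChain P (q + 1) :=
  Finsupp.linearCombination ℤ fun σ =>
    ∑ β : Fin q → Bool, subSign q β • Finsupp.single (subSimplex q σ β) (1 : ℤ)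

lemma subdivide_single {q : ℕ} (σ : Fin (q + 1) → P) : subdivide q (Finsupp.single σ 1) =
    ∑ β : Fin q → Bool, subSign q β • Finsupp.single (subSimplex q σ β) (1 : ℤ) := by
  simp [subdivide]

lemma subdivide_zero (x : VertexChain P (0 + 1)) : subdivide 0 x = x := by
  have : subdivide 0 = (LinearMap.id : VertexChain P (0 + 1) →ₗ[ℤ] _) := by
    refine Finsupp.lhom_ext' fun σ => LinearMap.ext_ring ?_
    simp [subdivide_single, subSign, subSimplex]
  rw [this, LinearMap.id_apply]

lemma subdivide_succ {q : ℕ} (σ : Fin (q + 2) → P) :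
    subdivide (q + 1) (Finsupp.single σ 1) = cone (endMid σ) (q + 1)
      (subdivide q (Finsupp.single (Fin.tail σ) 1) +
        (-1 : ℤ) ^ (q + 1) • subdivide q (Finsupp.single (Fin.init σ) 1)) := by
  rw [subdivide_single, ← (Fin.consEquiv fun _ : Fin (q + 1) => Bool).sum_comp,
    Fintype.sum_prod_type, Fintype.sum_bool]
  refine (add_comm _ _).trans ?_
  simp only [subdivide_single, map_add, map_sum, map_smul, cone_single, Finset.smul_sum]
  congr 1
  · refine Finset.sum_congr rfl fun β _ => ?_
    simp [subSign, subSimplex, Fin.consEquiv]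
  · refine Finset.sum_congr rfl fun β _ => ?_
    simp [subSign, subSimplex, Fin.consEquiv, mul_smul]

/-- Edgewise subdivision is a chain map: the contributions of the cones over the inner faces
cancel. -/
lemma bd_subdivide {q : ℕ} (x : VertexChain P (q + 2)) :
    bd (q + 1) (subdivide (q + 1) x) = subdivide q (bd (q + 1) x) := by
  have key : ∀ q : ℕ, (bd (P := P) (q + 1)).comp (subdivide (q + 1)) =
      (subdivide q).comp (bd (q + 1)) := by
    intro q
    induction q with
    | zero =>
      refine Finsupp.lhom_ext' fun σ => LinearMap.ext_ring ?_
      simp only [LinearMap.comp_apply, Finsupp.lsingle_apply]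
      rw [subdivide_succ, bd_cone_succ, subdivide_zero, subdivide_zero, subdivide_zero, map_add,
        map_smul, bd_single_zero, bd_single_zero, bd_single]
      rw [Fin.sum_univ_succ, Fin.sum_univ_succ]
      have e1 : (fun j => σ ((0 : Fin 2).succAbove j)) = Fin.tail σ := by
        funext j; simp [Fin.tail]
      have e2 : (fun j => σ ((Fin.succ (0 : Fin 1)).succAbove j)) = Fin.init σ := by
        funext j
        rw [show (Fin.succ (0 : Fin 1)) = Fin.last 1 from rfl, Fin.succAbove_last]; rfl
      rw [e1, e2]
      simp
    | succ q ih =>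
      refine Finsupp.lhom_ext' fun σ => LinearMap.ext_ring ?_
      simp only [LinearMap.comp_apply, Finsupp.lsingle_apply]
      have ih' : ∀ x : VertexChain P (q + 2),
          bd (q + 1) (subdivide (q + 1) x) = subdivide q (bd (q + 1) x) :=
        fun x => LinearMap.congr_fun ih x
      set T := fun j : Fin (q + 1) =>
        subdivide q (Finsupp.single (fun i => Fin.tail σ (j.castSucc.succAbove i)) 1) with hT
      set I := fun j : Fin (q + 1) =>
        subdivide q (Finsupp.single (fun i => Fin.init σ (j.succ.succAbove i)) 1) with hI
      set c := subdivide q (Finsupp.single (fun i => Fin.init σ (Fin.succ i)) 1) with hc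
      set A := ∑ j : Fin (q + 1), (-1 : ℤ) ^ (j : ℕ) • T j with hA
      set B := ∑ j : Fin (q + 1), (-1 : ℤ) ^ (j : ℕ) • I j with hB
      have htail : subdivide q (bd (q + 1) (Finsupp.single (Fin.tail σ) 1)) =
          A + (-1 : ℤ) ^ (q + 1) • c := by
        rw [bd_single, Fin.sum_univ_castSucc, map_add, map_sum, map_smul]
        congr 1
        · refine Finset.sum_congr rfl fun j _ => ?_
          rw [map_smul]; rfl
        · rw [Fin.val_last, hc]
          congr 4
          funext i
          rw [Fin.succAbove_last]; rfl
      have hinit : subdivide q (bd (q + 1) (Finsupp.single (Fin.init σ) 1)) = c - B := by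
        rw [bd_single, Fin.sum_univ_succ, map_add, map_sum, map_smul, sub_eq_add_neg, hB,
          ← Finset.sum_neg_distrib]
        congr 1
        · simp [hc]
        · refine Finset.sum_congr rfl fun j _ => ?_
          rw [map_smul, Fin.val_succ, pow_succ, mul_neg_one, neg_smul]
      have hmid : ∀ j : Fin (q + 1), subdivide (q + 1)
          (Finsupp.single (fun i => σ (j.castSucc.succ.succAbove i)) 1) =
          cone (endMid σ) (q + 1) (T j + (-1 : ℤ) ^ (q + 1) • I j) := by
        intro j
        rw [subdivide_succ]
        congr 1
        · simp only [endMid]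
          rw [Fin.succ_succAbove_zero, Fin.succAbove_of_le_castSucc _ _
            (Fin.le_def.2 (by simp; omega)), Fin.succ_last]
        · congr 3
          · congr 1
            funext i
            simp only [Fin.tail]
            rw [Fin.succ_succAbove_succ]
          · congr 1
            funext i
            simp only [Fin.init]
            rw [Fin.succ_castSucc, Fin.castSucc_succAbove_castSucc]
      have hsum : ∑ j : Fin (q + 1), subdivide (q + 1) ((-1 : ℤ) ^ (j.castSucc.succ : ℕ) •
          Finsupp.single (fun i => σ (j.castSucc.succ.succAbove i)) (1 : ℤ)) =
          -cone (endMid σ) (q + 1) (A + (-1 : ℤ) ^ (q + 1) • B) := by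
        rw [hA, hB, Finset.smul_sum, ← Finset.sum_add_distrib, map_sum, ← Finset.sum_neg_distrib]
        refine Finset.sum_congr rfl fun j _ => ?_
        rw [map_smul, hmid, Fin.val_succ, Fin.val_castSucc, pow_succ, mul_neg_one, neg_smul,
          ← map_smul]
        congr 2
        rw [smul_add, smul_comm]
      clear_value A B c
      rw [subdivide_succ, bd_cone_succ, map_add, map_smul, ih', ih', htail, hinit, bd_single,
        Fin.sum_univ_succ, Fin.sum_univ_castSucc]
      simp only [map_add, map_sum]
      rw [hsum]
      have e1 : (fun j => σ ((0 : Fin (q + 3)).succAbove j)) = Fin.tail σ := by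
        funext j; simp [Fin.tail]
      have e2 : (fun j => σ ((Fin.succ (Fin.last (q + 1))).succAbove j)) = Fin.init σ := by
        funext j
        rw [Fin.succ_last, Fin.succAbove_last]; rfl
      rw [e1, e2]
      simp only [Fin.val_zero, pow_zero, one_smul, Fin.val_succ, Fin.val_last, map_add, map_smul,
        map_sub, map_neg, pow_succ (-1 : ℤ) (q + 1), mul_neg_one, neg_smul, smul_sub]
      abel
  exact LinearMap.congr_fun (key q) x

@[simp] lemma subSimplex_zero {q : ℕ} (σ : Fin (q + 1) → P) (β : Fin q → Bool) :
    subSimplex q σ β 0 = endMid σ := by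
  cases q with
  | zero =>
    rw [subSimplex, endMid, show (Fin.last 0) = 0 from rfl, ← two_smul ℝ (σ 0), smul_smul]
    simp
  | succ q => simp [subSimplex]

lemma endMid_mem {q : ℕ} (σ : Fin (q + 1) → P) : endMid σ ∈ convexHull ℝ (range σ) := by
  rw [endMid, smul_add]
  exact convex_convexHull ℝ _ (subset_convexHull ℝ _ (mem_range_self _))
    (subset_convexHull ℝ _ (mem_range_self _)) (by norm_num) (by norm_num) (by norm_num)

lemma subSimplex_mem {q : ℕ} (σ : Fin (q + 1) → P) (β : Fin q → Bool) (i : Fin (q + 1)) :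
    subSimplex q σ β i ∈ convexHull ℝ (range σ) := by
  induction q with
  | zero => exact subset_convexHull ℝ _ (mem_range_self i)
  | succ q ih =>
    rw [subSimplex]
    refine Fin.cases ?_ (fun i => ?_) i
    · simpa using endMid_mem σ
    · rw [Fin.cons_succ]
      refine convexHull_mono ?_ (ih _ _ _)
      rintro _ ⟨k, rfl⟩
      split_ifs
      · exact mem_range_self _
      · exact mem_range_self _

lemma exists_mem_subSimplex {q : ℕ} (σ : Fin (q + 1) → P) {x : P}
    (hx : x ∈ convexHull ℝ (range σ)) :
    ∃ β : Fin q → Bool, x ∈ convexHull ℝ (range (subSimplex q σ β)) := by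
  induction q generalizing x with
  | zero => exact ⟨Fin.elim0, hx⟩
  | succ q ih =>
    obtain ⟨w, hw, rfl⟩ := mem_convexHull_range_iff.1 hx
    -- the barycentric coordinates of the two end vertices decide which cone contains the point
    have main : ∀ (b : Bool) (y : P) (s : ℝ), 0 ≤ s → s ≤ 1 →
        y ∈ convexHull ℝ (range (if b then Fin.init σ else Fin.tail σ)) →
        s • endMid σ + (1 - s) • y = ∑ i, w i • σ i →
        ∃ β : Fin (q + 1) → Bool,
          ∑ i, w i • σ i ∈ convexHull ℝ (range (subSimplex (q + 1) σ β)) := by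
      intro b y s hs hs1 hy hsum
      obtain ⟨β, hβ⟩ := ih _ hy
      refine ⟨Fin.cons b β, ?_⟩
      rw [← hsum, subSimplex, Fin.cons_zero, Fin.tail_cons]
      refine convex_convexHull ℝ _ ?_ ?_ hs (by linarith) (by ring)
      · exact subset_convexHull ℝ _ ⟨0, by simp⟩
      · refine convexHull_mono ?_ hβ
        rintro _ ⟨k, rfl⟩
        exact ⟨k.succ, by simp⟩
    have hw1 : w 0 + ∑ i : Fin q, w i.castSucc.succ + w (Fin.last (q + 1)) = 1 := by
      have := hw.2
      rw [Fin.sum_univ_succ, Fin.sum_univ_castSucc] at this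
      rw [← Fin.succ_last, ← this]; ring
    have hwx : ∑ i, w i • σ i = w 0 • σ 0 + ∑ i : Fin q, w i.castSucc.succ • σ i.castSucc.succ +
        w (Fin.last (q + 1)) • σ (Fin.last (q + 1)) := by
      rw [Fin.sum_univ_succ, Fin.sum_univ_castSucc, ← Fin.succ_last]; abel
    have hmidpos : 0 ≤ ∑ i : Fin q, w i.castSucc.succ := Finset.sum_nonneg fun i _ => hw.1 _
    rcases le_total (w 0) (w (Fin.last (q + 1))) with h | h
    · let u : Fin (q + 1) → ℝ :=
        Fin.snoc (fun i : Fin q => w i.castSucc.succ) (w (Fin.last (q + 1)) - w 0)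
      have hu : ∀ i, 0 ≤ u i := by
        intro i
        refine Fin.lastCases ?_ (fun i => ?_) i
        · simp only [u, Fin.snoc_last]; linarith
        · simp only [u, Fin.snoc_castSucc]; exact hw.1 _
      obtain ⟨y, hy, hyu⟩ := exists_smul_eq_sum (Fin.tail σ) u hu
      simp only [Fin.sum_univ_castSucc, u, Fin.snoc_last, Fin.snoc_castSucc] at hyu
      refine main false y (2 * w 0) (by have := hw.1 0; linarith) (by linarith) (by simpa using hy) ?_
      have : 1 - 2 * w 0 = ∑ i : Fin q, w i.castSucc.succ + (w (Fin.last (q + 1)) - w 0) := by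
        linarith
      rw [this, hyu, hwx, endMid]
      simp only [Fin.tail, Fin.succ_last]
      module
    · let u : Fin (q + 1) → ℝ :=
        Fin.cons (w 0 - w (Fin.last (q + 1))) (fun i : Fin q => w i.castSucc.succ)
      have hu : ∀ i, 0 ≤ u i := by
        intro i
        refine Fin.cases ?_ (fun i => ?_) i
        · simp only [u, Fin.cons_zero]; linarith
        · simp only [u, Fin.cons_succ]; exact hw.1 _
      obtain ⟨y, hy, hyu⟩ := exists_smul_eq_sum (Fin.init σ) u hu
      simp only [Fin.sum_univ_succ, u, Fin.cons_zero, Fin.cons_succ] at hyu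
      refine main true y (2 * w (Fin.last (q + 1))) (by have := hw.1 (Fin.last (q + 1)); linarith)
        (by linarith) (by simpa using hy) ?_
      have : 1 - 2 * w (Fin.last (q + 1)) =
          w 0 - w (Fin.last (q + 1)) + ∑ i : Fin q, w i.castSucc.succ := by
        linarith
      rw [this, hyu, hwx, endMid]
      simp only [Fin.init, ← Fin.succ_castSucc, Fin.castSucc_zero]
      module

/-- The consecutive edge vectors of `τ` are, up to order and signs, `l` times those of `σ`. -/
def StepsScaled (l : ℝ) {q : ℕ} (τ σ : Fin (q + 1) → P) : Prop :=
  (∀ i : Fin q, ∃ j : Fin q, τ j.succ - τ j.castSucc = l • (σ i.succ - σ i.castSucc) ∨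
    τ j.succ - τ j.castSucc = -(l • (σ i.succ - σ i.castSucc))) ∧
  ∀ j : Fin q, ∃ i : Fin q, τ j.succ - τ j.castSucc = l • (σ i.succ - σ i.castSucc) ∨
    τ j.succ - τ j.castSucc = -(l • (σ i.succ - σ i.castSucc))

lemma StepsScaled.trans {l l' : ℝ} {q : ℕ} {ρ τ σ : Fin (q + 1) → P} (h : StepsScaled l ρ τ)
    (h' : StepsScaled l' τ σ) : StepsScaled (l * l') ρ σ := by
  constructor
  · intro i
    obtain ⟨j, hj⟩ := h'.1 i
    obtain ⟨k, hk⟩ := h.1 j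
    refine ⟨k, ?_⟩
    rcases hj with hj | hj <;> rcases hk with hk | hk <;> rw [hk, hj] <;> simp [smul_smul]
  · intro k
    obtain ⟨j, hk⟩ := h.2 k
    obtain ⟨i, hj⟩ := h'.2 j
    refine ⟨i, ?_⟩
    rcases hj with hj | hj <;> rcases hk with hk | hk <;> rw [hk, hj] <;> simp [smul_smul]

/-- Edgewise subdivision halves the consecutive edge vectors, up to order and signs; hence its
iterates do not distort the shape of the simplices. -/
lemma stepsScaled_subSimplex {q : ℕ} (σ : Fin (q + 1) → P) (β : Fin q → Bool) :
    StepsScaled (2⁻¹ : ℝ) (subSimplex q σ β) σ := by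
  induction q with
  | zero => exact ⟨fun i => i.elim0, fun i => i.elim0⟩
  | succ q ih =>
    obtain ⟨ih1, ih2⟩ := ih (if β 0 then Fin.init σ else Fin.tail σ) (Fin.tail β)
    have hs : ∀ j : Fin q, subSimplex (q + 1) σ β j.succ.succ - subSimplex (q + 1) σ β j.succ.castSucc
        = subSimplex q (if β 0 then Fin.init σ else Fin.tail σ) (Fin.tail β) j.succ -
          subSimplex q (if β 0 then Fin.init σ else Fin.tail σ) (Fin.tail β) j.castSucc := by
      intro j
      rw [subSimplex, ← Fin.succ_castSucc, Fin.cons_succ, Fin.cons_succ]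
    have h0 : subSimplex (q + 1) σ β (Fin.succ 0) - subSimplex (q + 1) σ β (Fin.castSucc 0) =
        endMid (if β 0 then Fin.init σ else Fin.tail σ) - endMid σ := by
      rw [subSimplex, Fin.castSucc_zero, Fin.cons_succ, Fin.cons_zero, subSimplex_zero]
    by_cases hb : β 0
    · simp only [hb, if_true] at ih1 ih2 hs h0
      have h0' : subSimplex (q + 1) σ β (Fin.succ 0) - subSimplex (q + 1) σ β (Fin.castSucc 0) =
          -((2⁻¹ : ℝ) • (σ (Fin.last q).succ - σ (Fin.last q).castSucc)) := by
        rw [h0]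
        simp only [endMid, Fin.init, Fin.castSucc_zero, Fin.succ_last]
        module
      constructor
      · intro i
        refine Fin.lastCases ⟨0, Or.inr h0'⟩ (fun i => ?_) i
        obtain ⟨j, hj⟩ := ih1 i
        refine ⟨j.succ, ?_⟩
        rw [hs]
        exact hj
      · intro j
        refine Fin.cases ⟨Fin.last q, Or.inr h0'⟩ (fun j => ?_) j
        obtain ⟨i, hi⟩ := ih2 j
        refine ⟨i.castSucc, ?_⟩
        rw [hs]
        exact hi
    · simp only [hb] at ih1 ih2 hs h0
      have h0' : subSimplex (q + 1) σ β (Fin.succ 0) - subSimplex (q + 1) σ β (Fin.castSucc 0) =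
          (2⁻¹ : ℝ) • (σ (Fin.succ 0) - σ (Fin.castSucc 0)) := by
        rw [h0]
        simp only [endMid, Fin.tail, Fin.castSucc_zero, Fin.succ_last, Bool.false_eq_true, if_false]
        module
      constructor
      · intro i
        refine Fin.cases ⟨0, Or.inl h0'⟩ (fun i => ?_) i
        obtain ⟨j, hj⟩ := ih1 i
        refine ⟨j.succ, ?_⟩
        rw [hs, ← Fin.succ_castSucc]
        exact hj
      · intro j
        refine Fin.cases ⟨0, Or.inl h0'⟩ (fun j => ?_) j
        obtain ⟨i, hi⟩ := ih2 j
        refine ⟨i.succ, ?_⟩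
        rw [hs, ← Fin.succ_castSucc]
        exact hi

lemma alternating_cons_last_init {q : ℕ} (D : P [⋀^Fin (q + 1)]→ₗ[ℝ] ℝ) (σ : Fin (q + 1) → P) :
    D (Fin.cons (σ (Fin.last q)) (Fin.init σ)) = (-1) ^ q * D σ := by
  have h : D ((Fin.cons (σ (Fin.last q)) (Fin.init σ) : Fin (q + 1) → P) ∘ finRotate (q + 1)) = D σ := by
    congr 1
    funext i
    refine Fin.lastCases ?_ (fun i => ?_) i
    · simp
    · simp [Fin.init]
  rw [AlternatingMap.map_perm, sign_finRotate] at h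
  rw [← h]
  simp only [Nat.add_sub_cancel, Units.smul_def]
  rw [zsmul_eq_mul, ← mul_assoc]
  push_cast
  rw [← mul_pow]
  simp

/-- All simplices of the subdivision of `σ` have, with their signs, the same determinant, namely
`2⁻q` times the one of `σ`. -/
lemma subSign_mul_alternating {q : ℕ} (D : P [⋀^Fin (q + 1)]→ₗ[ℝ] ℝ) (σ : Fin (q + 1) → P)
    (β : Fin q → Bool) :
    (subSign q β : ℝ) * D (subSimplex q σ β) = (2⁻¹ : ℝ) ^ q * D σ := by
  induction q with
  | zero => simp [subSign, subSimplex]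
  | succ q ih =>
    have ih' := ih (D.curryLeft (endMid σ)) (if β 0 then Fin.init σ else Fin.tail σ) (Fin.tail β)
    simp only [AlternatingMap.curryLeft_apply_apply] at ih'
    have hsub : D (subSimplex (q + 1) σ β) = D (Matrix.vecCons (endMid σ)
        (subSimplex q (if β 0 then Fin.init σ else Fin.tail σ) (Fin.tail β))) := rfl
    have hcons : ∀ (x y : P) (a : ℝ) (τ : Fin (q + 1) → P),
        D (Fin.cons (a • (x + y)) τ) = a * (D (Fin.cons x τ) + D (Fin.cons y τ)) := by
      intro x y a τ
      have := (D.curryLeft.map_smul a (x + y))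
      have h2 := D.curryLeft.map_add x y
      have h3 := congrArg (fun f => f τ) this
      simp only [h2, AlternatingMap.smul_apply, AlternatingMap.add_apply,
        AlternatingMap.curryLeft_apply_apply, smul_eq_mul] at h3
      exact h3
    rw [hsub, subSign, pow_succ]
    push_cast
    rw [mul_assoc, ih']
    by_cases hb : β 0
    · simp only [hb, if_true]
      have e : D (Matrix.vecCons (endMid σ) (Fin.init σ)) = 2⁻¹ * ((-1) ^ (q + 1) * D σ) := by
        have h0 : D (Fin.cons (σ 0) (Fin.init σ)) = 0 := by
          refine D.map_eq_zero_of_eq _ (i := 0) (j := 1) ?_ (by simp)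
          rw [← Fin.succ_zero_eq_one, Fin.cons_succ]; rfl
        rw [← alternating_cons_last_init D σ]
        exact (hcons _ _ _ _).trans (by rw [h0, zero_add])
      rw [e]
      have : ((-1 : ℝ) ^ (q + 1)) * (-1) ^ (q + 1) = 1 := by rw [← mul_pow]; simp
      linear_combination (2⁻¹ ^ q * 2⁻¹ * D σ) * this
    · simp only [hb, Bool.false_eq_true, if_false]
      have e : D (Matrix.vecCons (endMid σ) (Fin.tail σ)) = 2⁻¹ * D σ := by
        have h0 : D (Fin.cons (σ (Fin.last _)) (Fin.tail σ)) = 0 := by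
          refine D.map_eq_zero_of_eq _ (i := 0) (j := Fin.last _) ?_ (by simp [Fin.ext_iff])
          rw [← Fin.succ_last, Fin.cons_succ]; rfl
        refine (hcons _ _ _ _).trans ?_
        rw [h0, add_zero, Fin.cons_self_tail]
      rw [e]
      ring

lemma subSign_eq {q : ℕ} (β : Fin q → Bool) : subSign q β = 1 ∨ subSign q β = -1 := by
  induction q with
  | zero => exact Or.inl rfl
  | succ q ih =>
    rw [subSign]
    rcases ih (Fin.tail β) with h | h <;> rw [h] <;> split_ifs <;>
      rcases neg_one_pow_eq_or ℤ (q + 1) with h' | h' <;> simp [h']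

/-! ### Iterated subdivision -/

/-- The simplices of the `k`-fold edgewise subdivision. -/
def iterSimplex {q : ℕ} : (k : ℕ) → (Fin (q + 1) → P) → (Fin k → Fin q → Bool) → (Fin (q + 1) → P)
  | 0, σ, _ => σ
  | k + 1, σ, β => subSimplex q (iterSimplex k σ (Fin.tail β)) (β 0)

/-- The coefficients of the simplices of the `k`-fold edgewise subdivision. -/
def iterSign {q : ℕ} : (k : ℕ) → (Fin k → Fin q → Bool) → ℤ
  | 0, _ => 1
  | k + 1, β => iterSign k (Fin.tail β) * subSign q (β 0)

lemma iterate_subdivide_single {q : ℕ} (k : ℕ) (σ : Fin (q + 1) → P) :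
    (subdivide q)^[k] (Finsupp.single σ 1) =
      ∑ β : Fin k → Fin q → Bool, iterSign k β • Finsupp.single (iterSimplex k σ β) (1 : ℤ) := by
  induction k with
  | zero => simp [iterSign, iterSimplex]
  | succ k ih =>
    rw [Function.iterate_succ_apply', ih, map_sum,
      ← (Fin.consEquiv fun _ : Fin (k + 1) => Fin q → Bool).sum_comp, Fintype.sum_prod_type_right]
    refine Finset.sum_congr rfl fun β _ => ?_
    rw [map_smul, subdivide_single, Finset.smul_sum]
    refine Finset.sum_congr rfl fun b _ => ?_
    simp [iterSign, iterSimplex, Fin.consEquiv, mul_smul]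

lemma bd_iterate_subdivide {q : ℕ} (k : ℕ) (x : VertexChain P (q + 2)) :
    bd (q + 1) ((subdivide (q + 1))^[k] x) = (subdivide q)^[k] (bd (q + 1) x) := by
  induction k with
  | zero => rfl
  | succ k ih => rw [Function.iterate_succ_apply', bd_subdivide, ih, Function.iterate_succ_apply']

lemma iterSimplex_mem {q k : ℕ} (σ : Fin (q + 1) → P) (β : Fin k → Fin q → Bool) (i : Fin (q + 1)) :
    iterSimplex k σ β i ∈ convexHull ℝ (range σ) := by
  induction k generalizing i with
  | zero => exact subset_convexHull ℝ _ (mem_range_self i)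
  | succ k ih =>
    refine convexHull_min ?_ (convex_convexHull ℝ _) (subSimplex_mem _ _ i)
    rintro _ ⟨j, rfl⟩
    exact ih _ _

lemma exists_mem_iterSimplex {q : ℕ} (k : ℕ) (σ : Fin (q + 1) → P) {x : P}
    (hx : x ∈ convexHull ℝ (range σ)) :
    ∃ β : Fin k → Fin q → Bool, x ∈ convexHull ℝ (range (iterSimplex k σ β)) := by
  induction k with
  | zero => exact ⟨Fin.elim0, hx⟩
  | succ k ih =>
    obtain ⟨β, hβ⟩ := ih
    obtain ⟨b, hb⟩ := exists_mem_subSimplex _ hβ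
    exact ⟨Fin.cons b β, by simpa [iterSimplex] using hb⟩

lemma stepsScaled_iterSimplex {q k : ℕ} (σ : Fin (q + 1) → P) (β : Fin k → Fin q → Bool) :
    StepsScaled ((2⁻¹ : ℝ) ^ k) (iterSimplex k σ β) σ := by
  induction k with
  | zero => exact ⟨fun i => ⟨i, Or.inl (by simp [iterSimplex])⟩, fun i => ⟨i, Or.inl (by simp [iterSimplex])⟩⟩
  | succ k ih =>
    rw [pow_succ, mul_comm]
    exact (stepsScaled_subSimplex _ _).trans (ih _)

lemma iterSign_mul_alternating {q k : ℕ} (D : P [⋀^Fin (q + 1)]→ₗ[ℝ] ℝ) (σ : Fin (q + 1) → P)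
    (β : Fin k → Fin q → Bool) :
    (iterSign k β : ℝ) * D (iterSimplex k σ β) = ((2⁻¹ : ℝ) ^ q) ^ k * D σ := by
  induction k with
  | zero => simp [iterSign, iterSimplex]
  | succ k ih =>
    rw [iterSign, iterSimplex]
    push_cast
    rw [mul_assoc, subSign_mul_alternating, mul_left_comm, ih, pow_succ]
    ring

lemma iterSign_eq {q k : ℕ} (β : Fin k → Fin q → Bool) : iterSign k β = 1 ∨ iterSign k β = -1 := by
  induction k with
  | zero => exact Or.inl rfl
  | succ k ih =>
    rw [iterSign]
    rcases ih (Fin.tail β) with h | h <;> rcases subSign_eq (β 0) with h' | h' <;> simp [h, h']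

end Subdivision

/-! ### Affine chains as singular chains -/

section Push

variable {P : Type*} [AddCommGroup P] [Module ℝ P] {W : Type*}

/-- The singular simplex obtained from an affine simplex `a` and a map `φ` of the ambient space. -/
def singularSimplex (φ : P → W → ℝ) {q : ℕ} (a : Fin (q + 1) → P) :
    stdSimplex ℝ (Fin (q + 1)) → (W → ℝ) :=
  fun x => φ (∑ i, x i • a i)

/-- `singularSimplex`, extended linearly to chains. -/
def pushChain (φ : P → W → ℝ) (q : ℕ) : VertexChain P (q + 1) →ₗ[ℤ] Chain W q :=
  Finsupp.lmapDomain ℤ ℤ (singularSimplex φ)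

lemma pushChain_single (φ : P → W → ℝ) {q : ℕ} (a : Fin (q + 1) → P) :
    pushChain φ q (Finsupp.single a 1) = Finsupp.single (singularSimplex φ a) 1 := by
  simp [pushChain]

lemma boundary_succ_eq {q : ℕ} (c : Chain W (q + 1)) :
    boundary (q + 1) c = Finsupp.linearCombination ℤ
      (fun σ : stdSimplex ℝ (Fin (q + 2)) → (W → ℝ) =>
        ∑ i : Fin (q + 2), (-1 : ℤ) ^ (i : ℕ) •
          (Finsupp.single (fun x => σ (stdSimplex.map i.succAbove x)) (1 : ℤ) : Chain W q)) c := by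
  rw [Finsupp.linearCombination_apply, boundary]
  refine Finsupp.sum_congr fun σ _ => ?_
  rw [Finset.smul_sum]
  refine Finset.sum_congr rfl fun i _ => ?_
  rw [smul_smul, Finsupp.smul_single, smul_eq_mul, mul_one, mul_comm]
  rfl

lemma sum_stdSimplex_map {q r : ℕ} (s : Fin q → Fin r) (x : stdSimplex ℝ (Fin q)) (a : Fin r → P) :
    ∑ i, stdSimplex.map s x i • a i = ∑ j, x j • a (s j) := by
  classical
  simp only [stdSimplex.map_coe, FunOnFinite.linearMap_apply_apply, Finset.sum_smul]
  rw [← Finset.sum_fiberwise Finset.univ s (fun j => x j • a (s j))]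
  refine Finset.sum_congr rfl fun i _ => Finset.sum_congr rfl fun j hj => ?_
  rw [(Finset.mem_filter.1 hj).2]

lemma boundary_pushChain (φ : P → W → ℝ) {q : ℕ} (x : VertexChain P (q + 2)) :
    boundary (q + 1) (pushChain φ (q + 1) x) = pushChain φ q (bd (q + 1) x) := by
  rw [boundary_succ_eq]
  have : (Finsupp.linearCombination ℤ
      (fun σ : stdSimplex ℝ (Fin (q + 2)) → (W → ℝ) =>
        ∑ i : Fin (q + 2), (-1 : ℤ) ^ (i : ℕ) •
          (Finsupp.single (fun x => σ (stdSimplex.map i.succAbove x)) (1 : ℤ) : Chain W q))).comp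
      (pushChain φ (q + 1)) = (pushChain φ q).comp (bd (q + 1)) := by
    refine Finsupp.lhom_ext' fun σ => LinearMap.ext_ring ?_
    simp only [LinearMap.comp_apply, Finsupp.lsingle_apply]
    rw [pushChain_single, Finsupp.linearCombination_single, one_smul, bd_single, map_sum]
    refine Finset.sum_congr rfl fun i _ => ?_
    rw [map_smul, pushChain_single]
    congr 2
    funext x
    simp only [singularSimplex, sum_stdSimplex_map]
  exact LinearMap.congr_fun this x

end Push

/-! ### Constant metrics on the standard simplex -/

section ConstMetric

/-- The metric on the standard simplex given by a constant inner product. -/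
def constMetric {q : ℕ} (A : LinearMap.BilinForm ℝ (Fin q → ℝ)) (hs : ∀ u w, A u w = A w u)
    (hp : ∀ u, u ≠ 0 → 0 < A u u) :
    RiemannianMetric (⊤ : PreAbstractSimplicialComplex (Fin q)) where
  form _ _ := A
  symm _ _ _ _ u _ v _ := hs u v
  pos _ _ _ _ u _ h := hp u h
  continuousOn _ _ _ _ _ _ := continuousOn_const
  smooth _ _ _ _ _ _ := contDiffOn_const
  compatible _ _ _ _ _ _ _ _ _ _ _ := rfl

variable {q : ℕ} {A : LinearMap.BilinForm ℝ (Fin q → ℝ)} (hs : ∀ u w, A u w = A w u)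
    (hp : ∀ u, u ≠ 0 → 0 < A u u)

include hs hp in
lemma bilin_cauchy_schwarz (u w : Fin q → ℝ) : |A u w| ≤ √(A u u) * √(A w w) := by
  have h0 : ∀ u, 0 ≤ A u u := fun u => by
    rcases eq_or_ne u 0 with rfl | h
    · simp
    · exact (hp u h).le
  have := LinearMap.BilinForm.apply_mul_apply_le_of_forall_zero_le A h0 u w
  rw [← Real.sqrt_mul (h0 u)]
  refine Real.abs_le_sqrt ?_
  rw [hs w u] at this
  rw [sq]; exact this

/-- For a constant metric, no curve is shorter than the segment: pair its velocity with `y - x`. -/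
lemma constMetric_simplexDist_ge (x y : Fin q → ℝ) :
    ENNReal.ofReal (√(A (y - x) (y - x))) ≤ (constMetric A hs hp).simplexDist x y := by
  refine le_iInf fun s => le_iInf fun γ => le_iInf fun ⟨_, hγ, _, h0, h1⟩ => ?_
  set w := y - x with hw
  have hA0 : 0 ≤ A w w := by
    rcases eq_or_ne w 0 with h | h
    · simp [h]
    · exact (hp w h).le
  rcases hA0.eq_or_lt with hz | hpos
  · simp [← hz]
  let L : (Fin q → ℝ) →L[ℝ] ℝ := LinearMap.toContinuousLinearMap (A.flip w)
  have hL : ∀ u, L u = A u w := fun u => rfl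
  have hφ : ContDiffOn ℝ 1 (fun t => L (γ t)) (Icc 0 1) := L.contDiff.comp_contDiffOn hγ
  have key := enorm_sub_le_lintegral_derivWithin_Icc_of_contDiffOn_Icc hφ zero_le_one
  have hd : ∀ t ∈ Icc (0 : ℝ) 1, derivWithin (fun t => L (γ t)) (Icc 0 1) t =
      L (derivWithin γ (Icc 0 1) t) := by
    intro t ht
    have hdiff := (hγ.differentiableOn one_ne_zero t ht).hasDerivWithinAt
    exact (L.hasFDerivAt.comp_hasDerivWithinAt t hdiff).derivWithin
      (uniqueDiffOn_Icc zero_lt_one t ht)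
  have hpos' : 0 < √(A w w) := Real.sqrt_pos.2 hpos
  have e1 : ‖L (γ 1) - L (γ 0)‖ₑ = ENNReal.ofReal (√(A w w)) * ENNReal.ofReal (√(A w w)) := by
    rw [← map_sub, h0, h1, ← hw, hL, Real.enorm_eq_ofReal hpos.le, ← ENNReal.ofReal_mul hpos'.le,
      Real.mul_self_sqrt hpos.le]
  have e2 : ∫⁻ t in Icc (0 : ℝ) 1, ‖derivWithin (fun t => L (γ t)) (Icc 0 1) t‖ₑ ≤
      ENNReal.ofReal (√(A w w)) * ∫⁻ t in Icc (0 : ℝ) 1, ENNReal.ofReal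
        (√(A (derivWithin γ (Icc 0 1) t) (derivWithin γ (Icc 0 1) t))) := by
    rw [← lintegral_const_mul' _ _ ENNReal.ofReal_ne_top]
    refine setLIntegral_mono' measurableSet_Icc fun t ht => ?_
    rw [hd t ht, hL, Real.enorm_eq_ofReal_abs, ← ENNReal.ofReal_mul hpos'.le]
    refine ENNReal.ofReal_le_ofReal ?_
    rw [mul_comm]
    exact bilin_cauchy_schwarz hs hp _ _
  rw [e1] at key
  have := key.trans e2
  exact (ENNReal.mul_le_mul_iff_right (by simpa using hpos') ENNReal.ofReal_ne_top).1 this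

include hs hp in
lemma sqrt_bilin_add_le (u w : Fin q → ℝ) :
    √(A (u + w) (u + w)) ≤ √(A u u) + √(A w w) := by
  have h0 : ∀ u, 0 ≤ A u u := fun u => by
    rcases eq_or_ne u 0 with rfl | h
    · simp
    · exact (hp u h).le
  refine Real.sqrt_le_iff.2 ⟨by positivity, ?_⟩
  have := (le_abs_self _).trans (bilin_cauchy_schwarz hs hp u w)
  have e1 := Real.mul_self_sqrt (h0 u)
  have e2 := Real.mul_self_sqrt (h0 w)
  simp only [map_add, LinearMap.add_apply, hs w u]
  nlinarith

lemma constMetric_dist_ge (x y : Fin q → ℝ) :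
    ENNReal.ofReal (√(A (y - x) (y - x))) ≤ (constMetric A hs hp).dist x y := by
  refine le_iInf fun m => le_iInf fun z => le_iInf fun ⟨h0, h1⟩ => ?_
  have key : ∀ (m : ℕ) (z : Fin (m + 1) → Fin q → ℝ),
      ENNReal.ofReal (√(A (z (Fin.last m) - z 0) (z (Fin.last m) - z 0))) ≤
        ∑ i : Fin m, (constMetric A hs hp).simplexDist (z i.castSucc) (z i.succ) := by
    intro m
    induction m with
    | zero => intro z; simp
    | succ m ih =>
      intro z
      rw [Fin.sum_univ_castSucc]
      have hm := ih (fun i => z i.castSucc)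
      have hl := constMetric_simplexDist_ge hs hp (z (Fin.last m).castSucc) (z (Fin.last m).succ)
      simp only [Fin.succ_castSucc]
      refine le_trans ?_ (add_le_add hm hl)
      rw [← ENNReal.ofReal_add (by positivity) (by positivity), Fin.succ_last]
      refine ENNReal.ofReal_le_ofReal ?_
      have := sqrt_bilin_add_le hs hp (z (Fin.last m).castSucc - z 0)
        (z (Fin.last (m + 1)) - z (Fin.last m).castSucc)
      rw [sub_add_sub_cancel'] at this
      exact this
  rw [← h0, ← h1]
  exact key m z

end ConstMetric

section Corner

lemma measurableSet_corner (q : ℕ) : MeasurableSet (corner q) := by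
  have : corner q = (⋂ i, {y : Fin q → ℝ | 0 ≤ y i}) ∩ {y | ∑ i, y i ≤ 1} := by
    ext y; simp [corner]
  rw [this]
  refine MeasurableSet.inter (MeasurableSet.iInter fun i => ?_) ?_
  · exact (isClosed_le continuous_const (continuous_apply i)).measurableSet
  · exact (isClosed_le (by fun_prop) continuous_const).measurableSet

lemma volume_corner_le_one (q : ℕ) : volume (corner q) ≤ 1 := by
  have : corner q ⊆ Icc 0 1 := fun y hy =>
    ⟨hy.1, fun i => (Finset.single_le_sum (fun j _ => hy.1 j) (Finset.mem_univ i)).trans hy.2⟩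
  refine (measure_mono this).trans ?_
  rw [Real.volume_Icc_pi]
  simp

lemma simplices_top (q : ℕ) :
    simplices (⊤ : PreAbstractSimplicialComplex (Fin (q + 1))) q = {id} := by
  classical
  ext v
  simp only [simplices, Finset.mem_filter, Finset.mem_univ, true_and, Finset.mem_singleton]
  constructor
  · rintro ⟨h, -⟩
    refine (h.range_inj strictMono_id).1 ?_
    rw [range_id, (Finite.injective_iff_surjective.1 h.injective).range_eq]
  · rintro rfl
    exact ⟨strictMono_id, Finset.univ_nonempty.image _⟩

lemma continuous_chart {U : Type*} [DecidableEq U] {q : ℕ} (v : Fin (q + 1) → U) :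
    Continuous (chart v) := by
  unfold chart; fun_prop

lemma constMetric_vol_le {q : ℕ} {A : LinearMap.BilinForm ℝ (Fin (q + 1) → ℝ)}
    (hs : ∀ u w, A u w = A w u) (hp : ∀ u, u ≠ 0 → 0 < A u u) :
    (constMetric A hs hp).vol q univ ≤ ENNReal.ofReal (√(Matrix.det (Matrix.of fun i j : Fin q =>
      A (Pi.single i.succ 1 - Pi.single 0 1) (Pi.single j.succ 1 - Pi.single 0 1)))) := by
  rw [RiemannianMetric.vol, simplices_top, Finset.sum_singleton,
    Measure.map_apply (continuous_chart _).measurable MeasurableSet.univ, preimage_univ,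
    withDensity_apply _ MeasurableSet.univ, Measure.restrict_univ]
  have : (constMetric A hs hp).density (id : Fin (q + 1) → Fin (q + 1)) = fun _ =>
      ENNReal.ofReal (√(Matrix.det (Matrix.of fun i j : Fin q =>
      A (Pi.single i.succ 1 - Pi.single 0 1) (Pi.single j.succ 1 - Pi.single 0 1)))) := rfl
  rw [this, lintegral_const, Measure.restrict_apply MeasurableSet.univ, univ_inter]
  exact mul_le_of_le_one_right' (volume_corner_le_one q)

end Corner

/-! ### Distances along segments -/

section Dist

variable {U : Type*} [Fintype U]

lemma convex_closedSimplex (s : Finset U) : Convex ℝ (closedSimplex s) := by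
  intro x hx y hy a b ha hb hab
  refine ⟨fun u => ?_, ?_, fun u hu => ?_⟩
  · have := hx.1 u; have := hy.1 u
    simp only [Pi.add_apply, Pi.smul_apply, smul_eq_mul]; positivity
  · simp only [Pi.add_apply, Pi.smul_apply, smul_eq_mul, Finset.sum_add_distrib, ← Finset.mul_sum,
      hx.2.1, hy.2.1]
    linarith
  · simp [hx.2.2 u hu, hy.2.2 u hu]

lemma sum_mem_closedSimplex {s : Finset U} {q : ℕ} {F : Fin (q + 1) → U → ℝ}
    (hF : ∀ i, F i ∈ closedSimplex s) (x : stdSimplex ℝ (Fin (q + 1))) :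
    ∑ i, x i • F i ∈ closedSimplex s :=
  (convex_closedSimplex s).sum_mem (fun i _ => x.2.1 i) x.2.2 fun i _ => hF i

lemma sub_mem_tangent {s : Finset U} {x y : U → ℝ} (hx : x ∈ closedSimplex s)
    (hy : y ∈ closedSimplex s) : y - x ∈ tangent s :=
  ⟨by simp [hx.2.1, hy.2.1], fun u hu => by simp [hx.2.2 u hu, hy.2.2 u hu]⟩

lemma add_mem_tangent {s : Finset U} {x y : U → ℝ} (hx : x ∈ tangent s) (hy : y ∈ tangent s) :
    x + y ∈ tangent s :=
  ⟨by simp [Finset.sum_add_distrib, hx.1, hy.1], fun u hu => by simp [hx.2 u hu, hy.2 u hu]⟩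

lemma smul_mem_tangent {s : Finset U} {x : U → ℝ} (a : ℝ) (hx : x ∈ tangent s) :
    a • x ∈ tangent s :=
  ⟨by simp [← Finset.mul_sum, hx.1], fun u hu => by simp [hx.2 u hu]⟩

lemma sum_mem_tangent {ι : Type*} (t : Finset ι) {s : Finset U} {x : ι → U → ℝ}
    (hx : ∀ i ∈ t, x i ∈ tangent s) : ∑ i ∈ t, x i ∈ tangent s := by
  classical
  induction t using Finset.induction_on with
  | empty => exact ⟨by simp, by simp⟩
  | insert i t hi ih =>
    rw [Finset.sum_insert hi]
    exact add_mem_tangent (hx i (Finset.mem_insert_self _ _))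
      (ih fun j hj => hx j (Finset.mem_insert_of_mem hj))

variable {K : PreAbstractSimplicialComplex U} (g : RiemannianMetric K)

lemma RiemannianMetric.dist_self (x : U → ℝ) : g.dist x x = 0 := by
  refine le_antisymm ?_ bot_le
  exact iInf_le_of_le 0 (iInf_le_of_le (fun _ => x) (iInf_le_of_le ⟨rfl, rfl⟩ (by simp)))

lemma RiemannianMetric.dist_le_dist_add (x y z : U → ℝ) :
    g.dist x z ≤ g.dist x y + g.simplexDist y z := by
  rw [RiemannianMetric.dist, RiemannianMetric.dist, ENNReal.iInf_add]
  refine le_iInf fun m => ?_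
  rw [ENNReal.iInf_add]
  refine le_iInf fun p => ?_
  rw [ENNReal.iInf_add]
  refine le_iInf fun ⟨h0, h1⟩ => ?_
  refine iInf_le_of_le (m + 1) (iInf_le_of_le (Fin.snoc p z : Fin (m + 2) → U → ℝ)
    (iInf_le_of_le ⟨?_, by simp⟩ ?_))
  · rw [← Fin.castSucc_zero, Fin.snoc_castSucc, h0]
  · rw [Fin.sum_univ_castSucc]
    simp only [Fin.snoc_castSucc, Fin.succ_castSucc, Fin.succ_last, Fin.snoc_last]
    rw [h1]

lemma RiemannianMetric.dist_le_simplexDist (x y : U → ℝ) : g.dist x y ≤ g.simplexDist x y := by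
  simpa [g.dist_self] using g.dist_le_dist_add x x y

/-- A curve that is the image of a segment under a map that is `C¹` with derivative `D`. -/
lemma RiemannianMetric.simplexDist_image_le {E : Type*} [NormedAddCommGroup E] [NormedSpace ℝ E]
    {S : Set E} (hS : Convex ℝ S) {f : E → U → ℝ} {D : E → E →L[ℝ] (U → ℝ)}
    (hD : ContinuousOn D S) (hf : ∀ x ∈ S, HasFDerivWithinAt f (D x) S x)
    {t : Finset U} (ht : t ∈ K.faces) (hmaps : MapsTo f S (closedSimplex t))
    {x y : E} (hx : x ∈ S) (hy : y ∈ S) {b : ℝ} (hb : 0 ≤ b)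
    (hle : ∀ z ∈ segment ℝ x y, g.form t (f z) (D z (y - x)) (D z (y - x)) ≤ b ^ 2) :
    g.simplexDist (f x) (f y) ≤ ENNReal.ofReal b := by
  set p : ℝ → E := fun τ => x + τ • (y - x) with hp
  have hseg : ∀ τ ∈ Icc (0 : ℝ) 1, p τ ∈ segment ℝ x y := fun τ hτ => by
    rw [segment_eq_image']; exact ⟨τ, hτ, rfl⟩
  have hpS : MapsTo p (Icc 0 1) S := fun τ hτ => hS.segment_subset hx hy (hseg τ hτ)
  have hpd : ∀ τ, HasDerivAt p (y - x) τ := fun τ => by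
    have := ((hasDerivAt_id τ).smul_const (y - x)).const_add x
    rw [one_smul] at this
    exact this
  have hγ : ∀ τ ∈ Icc (0 : ℝ) 1, HasDerivWithinAt (fun τ => f (p τ)) (D (p τ) (y - x)) (Icc 0 1) τ :=
    fun τ hτ => (hf _ (hpS hτ)).comp_hasDerivWithinAt τ (hpd τ).hasDerivWithinAt hpS
  have hder : ∀ τ ∈ Icc (0 : ℝ) 1,
      derivWithin (fun τ => f (p τ)) (Icc 0 1) τ = D (p τ) (y - x) :=
    fun τ hτ => (hγ τ hτ).derivWithin (uniqueDiffOn_Icc zero_lt_one τ hτ)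
  have hC : ContDiffOn ℝ 1 (fun τ => f (p τ)) (Icc 0 1) := by
    rw [contDiffOn_one_iff_derivWithin (uniqueDiffOn_Icc zero_lt_one)]
    refine ⟨fun τ hτ => (hγ τ hτ).differentiableWithinAt, ?_⟩
    have hc : ContinuousOn (fun τ => D (p τ) (y - x)) (Icc 0 1) := by
      refine ContinuousOn.clm_apply (hD.comp ?_ hpS) continuousOn_const
      exact fun τ _ => (hpd τ).continuousAt.continuousWithinAt
    exact hc.congr hder
  refine iInf_le_of_le t (iInf_le_of_le (fun τ => f (p τ)) (iInf_le_of_le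
    ⟨ht, hC, fun τ hτ => hmaps (hpS hτ), by simp [hp], by simp [hp]⟩ ?_))
  calc _ ≤ ∫⁻ τ in Icc (0 : ℝ) 1, ENNReal.ofReal b := by
        refine setLIntegral_mono' measurableSet_Icc fun τ hτ => ENNReal.ofReal_le_ofReal ?_
        rw [hder τ hτ]
        exact Real.sqrt_le_iff.2 ⟨hb, hle _ (hseg τ hτ)⟩
    _ = ENNReal.ofReal b := by simp

lemma RiemannianMetric.simplexDist_le {s : Finset U} (hs : s ∈ K.faces) {x y : U → ℝ}
    (hx : x ∈ closedSimplex s) (hy : y ∈ closedSimplex s) {b : ℝ} (hb : 0 ≤ b)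
    (hle : ∀ z ∈ segment ℝ x y, g.form s z (y - x) (y - x) ≤ b ^ 2) :
    g.simplexDist x y ≤ ENNReal.ofReal b :=
  g.simplexDist_image_le (f := id) (D := fun _ => ContinuousLinearMap.id ℝ (U → ℝ))
    (convex_closedSimplex s) continuousOn_const (fun x _ => hasFDerivWithinAt_id x _) hs
    (mapsTo_id _) hx hy hb hle

lemma GeometricCycle.Inclusion.dist_le {n : ℕ} {U : Type*} [Fintype U] [LinearOrder U] {X : Type*}
    [TopologicalSpace X] {Z : GeometricCycle n U X} {W : Type*} [Fintype W]
    {K : PreAbstractSimplicialComplex W} {h : RiemannianMetric K} (j : Z.Inclusion h)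
    {s : Finset U} (hs : s ∈ Z.V.faces) {x y : U → ℝ}
    (hx : x ∈ closedSimplex s) (hy : y ∈ closedSimplex s) {b : ℝ} (hb : 0 ≤ b)
    (hle : ∀ z ∈ segment ℝ x y, Z.g.form s z (y - x) (y - x) ≤ b ^ 2) :
    h.dist (j.toFun x) (j.toFun y) ≤ ENNReal.ofReal b := by
  obtain ⟨t, ht, hmaps, D, hD, hf⟩ := j.isometric s hs
  refine (h.dist_le_simplexDist _ _).trans
    (h.simplexDist_image_le (convex_closedSimplex s) hD (fun x hx => (hf x hx).1) ht hmaps hx hy hb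
      fun z hz => ?_)
  have hz' := (convex_closedSimplex s).segment_subset hx hy hz
  rw [← (hf z hz').2 _ (sub_mem_tangent hx hy) _ (sub_mem_tangent hx hy)]
  exact hle z hz

end Dist

/-! ### Volume of affine simplices -/

section SimplexVol

lemma bilin_sum_sum {E ι κ : Type*} [AddCommGroup E] [Module ℝ E] [Fintype ι] [Fintype κ]
    (B : LinearMap.BilinForm ℝ E) (u : ι → ℝ) (w : κ → ℝ) (e : ι → E) (f : κ → E) :
    B (∑ i, u i • e i) (∑ j, w j • f j) = ∑ i, ∑ j, u i * w j * B (e i) (f j) := by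
  simp only [map_sum, map_smul, LinearMap.sum_apply, LinearMap.smul_apply, smul_eq_mul,
    Finset.mul_sum, mul_assoc]
  rw [Finset.sum_comm]
  refine Finset.sum_congr rfl fun i _ => Finset.sum_congr rfl fun j _ => by ring

/-- `u ↦ 2 B(Tu, Tu) + θ |u|²`, where `T` is the linear part of the affine simplex `F`. The term
with `θ` makes the form definite even if `F` is degenerate. -/
def pullForm {E : Type*} [AddCommGroup E] [Module ℝ E] (B : LinearMap.BilinForm ℝ E) {q : ℕ}
    (F : Fin (q + 1) → E) (θ : ℝ) : LinearMap.BilinForm ℝ (Fin (q + 1) → ℝ) :=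
  (2 : ℝ) • B.compl₁₂ (Fintype.linearCombination ℝ fun i => F i - F 0)
    (Fintype.linearCombination ℝ fun i => F i - F 0) + θ • dotProductBilin ℝ ℝ

variable {E : Type*} [AddCommGroup E] [Module ℝ E]

lemma pullForm_apply (B : LinearMap.BilinForm ℝ E) {q : ℕ} (F : Fin (q + 1) → E) (θ : ℝ)
    (u w : Fin (q + 1) → ℝ) :
    pullForm B F θ u w = 2 * B (∑ i, u i • (F i - F 0)) (∑ i, w i • (F i - F 0)) +
      θ * ∑ i, u i * w i := by
  simp [pullForm, Fintype.linearCombination_apply, dotProduct]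

lemma pullForm_edge (B : LinearMap.BilinForm ℝ E) {q : ℕ} (F : Fin (q + 1) → E) (θ : ℝ)
    (i j : Fin q) :
    pullForm B F θ (Pi.single i.succ 1 - Pi.single 0 1) (Pi.single j.succ 1 - Pi.single 0 1) =
      2 * B (F i.succ - F 0) (F j.succ - F 0) + θ * (if i = j then 2 else 1) := by
  have h : ∀ i : Fin q, ∑ k, (Pi.single i.succ 1 - Pi.single 0 1 : Fin (q + 1) → ℝ) k • (F k - F 0)
      = F i.succ - F 0 := by
    intro i
    simp [sub_smul, Finset.sum_sub_distrib, Pi.single_apply, ite_smul]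
  have h2 : ∑ k, (Pi.single i.succ 1 - Pi.single 0 1 : Fin (q + 1) → ℝ) k *
      (Pi.single j.succ 1 - Pi.single 0 1 : Fin (q + 1) → ℝ) k = if i = j then 2 else 1 := by
    rw [Fin.sum_univ_succ]
    simp only [Pi.sub_apply, Pi.single_apply, Fin.succ_inj, Fin.succ_ne_zero, if_false]
    simp only [(Fin.succ_ne_zero _).symm, if_false, if_true]
    by_cases hij : i = j
    · subst hij; simp; norm_num
    · simp [hij]
      exact fun h => hij h.symm
  rw [pullForm_apply, h, h, h2]

variable {n : ℕ} {U : Type*} [Fintype U] [LinearOrder U] {X : Type*}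
    [TopologicalSpace X] {Z : GeometricCycle n U X} {W : Type*} [Fintype W]
    {K : PreAbstractSimplicialComplex W} {h : RiemannianMetric K} (j : Z.Inclusion h)

lemma dist_singularSimplex_le {s : Finset U} (hs : s ∈ Z.V.faces) {q : ℕ} {F : Fin (q + 1) → U → ℝ}
    (hF : ∀ i, F i ∈ closedSimplex s) {B : LinearMap.BilinForm ℝ (U → ℝ)}
    (hcmp : ∀ x ∈ convexHull ℝ (range F), ∀ u ∈ tangent s, Z.g.form s x u u ≤ 2 * B u u)
    {θ : ℝ} (hθ : 0 ≤ θ) (x y : stdSimplex ℝ (Fin (q + 1))) :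
    h.dist (singularSimplex j.toFun F x) (singularSimplex j.toFun F y) ≤
      ENNReal.ofReal (√(pullForm B F θ (y.1 - x.1) (y.1 - x.1))) := by
  have hT : ∑ i, y i • F i - ∑ i, x i • F i = ∑ i, (y.1 - x.1) i • (F i - F 0) := by
    have : ∑ i, (y.1 - x.1) i • F 0 = 0 := by
      rw [← Finset.sum_smul]
      simp [x.2.2, y.2.2]
    rw [Finset.sum_congr rfl fun i _ => smul_sub _ _ _, Finset.sum_sub_distrib, this, sub_zero,
      ← Finset.sum_sub_distrib]
    exact Finset.sum_congr rfl fun i _ => (sub_smul _ _ _).symm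
  refine j.dist_le hs (sum_mem_closedSimplex hF x) (sum_mem_closedSimplex hF y)
    (Real.sqrt_nonneg _) fun z hz => ?_
  have hzc : z ∈ convexHull ℝ (range F) := by
    refine (convex_convexHull ℝ _).segment_subset ?_ ?_ hz
    · exact mem_convexHull_range_iff.2 ⟨x, x.2, rfl⟩
    · exact mem_convexHull_range_iff.2 ⟨y, y.2, rfl⟩
  have htan := sub_mem_tangent (sum_mem_closedSimplex hF x) (sum_mem_closedSimplex hF y)
  have h1 := hcmp z hzc _ htan
  have h2 : Z.g.form s z (∑ i, y i • F i - ∑ i, x i • F i) (∑ i, y i • F i - ∑ i, x i • F i) ≤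
      pullForm B F θ (y.1 - x.1) (y.1 - x.1) := by
    refine h1.trans ?_
    rw [pullForm_apply, ← hT]
    have : 0 ≤ ∑ i, (y.1 - x.1) i * (y.1 - x.1) i := Finset.sum_nonneg fun i _ => mul_self_nonneg _
    have := mul_nonneg hθ this
    linarith
  refine h2.trans ?_
  rcases le_total 0 (pullForm B F θ (y.1 - x.1) (y.1 - x.1)) with h0 | h0
  · rw [Real.sq_sqrt h0]
  · exact h0.trans (sq_nonneg _)

lemma isLipschitzSimplex_singularSimplex {s : Finset U} (hs : s ∈ Z.V.faces) {q : ℕ}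
    {F : Fin (q + 1) → U → ℝ}
    (hF : ∀ i, F i ∈ closedSimplex s) {B : LinearMap.BilinForm ℝ (U → ℝ)}
    (hcmp : ∀ x ∈ convexHull ℝ (range F), ∀ u ∈ tangent s, Z.g.form s x u u ≤ 2 * B u u) :
    h.IsLipschitzSimplex (singularSimplex j.toFun F) := by
  constructor
  · intro x
    obtain ⟨t, ht, hmaps, -⟩ := j.isometric s hs
    exact ⟨t, ht, hmaps (sum_mem_closedSimplex hF x)⟩
  · set C := ∑ i, ∑ k, |pullForm B F 0 (Pi.single i 1) (Pi.single k 1)| with hC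
    have hC0 : 0 ≤ C := Finset.sum_nonneg fun i _ => Finset.sum_nonneg fun k _ => abs_nonneg _
    refine ⟨Real.toNNReal (√C), fun x y => ?_⟩
    refine (dist_singularSimplex_le j hs hF hcmp le_rfl x y).trans ?_
    have hd : edist x y = ENNReal.ofReal ‖y.1 - x.1‖ := by
      rw [Subtype.edist_eq, edist_comm, edist_eq_enorm_sub, ofReal_norm]
    have hb : pullForm B F 0 (y.1 - x.1) (y.1 - x.1) ≤ C * ‖y.1 - x.1‖ ^ 2 := by
      set u := y.1 - x.1 with hu
      have hsum : u = ∑ i, u i • (Pi.single i 1 : Fin (q + 1) → ℝ) := by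
        ext k; simp [Pi.single_apply]
      have h1 := bilin_sum_sum (pullForm B F 0) u u (fun i => (Pi.single i 1 : Fin (q + 1) → ℝ))
        (fun i => (Pi.single i 1 : Fin (q + 1) → ℝ))
      rw [← hsum] at h1
      rw [h1, hC, Finset.sum_mul]
      refine Finset.sum_le_sum fun i _ => ?_
      rw [Finset.sum_mul]
      refine Finset.sum_le_sum fun k _ => ?_
      refine (le_abs_self _).trans ?_
      rw [abs_mul, abs_mul, mul_comm, sq]
      have a1 := norm_le_pi_norm u i
      have a2 := norm_le_pi_norm u k
      rw [Real.norm_eq_abs] at a1 a2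
      gcongr
    change _ ≤ ENNReal.ofReal (√C) * edist x y
    rw [hd, ← ENNReal.ofReal_mul (Real.sqrt_nonneg C)]
    refine ENNReal.ofReal_le_ofReal (Real.sqrt_le_iff.2 ⟨by positivity, ?_⟩)
    rwa [mul_pow, Real.sq_sqrt hC0]

/-- Volume of an affine simplex in a face on which the metric is at most twice the constant form
`B`: the constant metrics `2B + θ` on the standard simplex compete in the definition of the volume,
and `θ` tends to zero. -/
lemma simplexVol_singularSimplex_le {s : Finset U} (hs : s ∈ Z.V.faces) {q : ℕ}
    {F : Fin (q + 1) → U → ℝ}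
    (hF : ∀ i, F i ∈ closedSimplex s) {B : LinearMap.BilinForm ℝ (U → ℝ)}
    (hsymm : ∀ u ∈ tangent s, ∀ w ∈ tangent s, B u w = B w u) (hpos : ∀ u ∈ tangent s, 0 ≤ B u u)
    (hcmp : ∀ x ∈ convexHull ℝ (range F), ∀ u ∈ tangent s, Z.g.form s x u u ≤ 2 * B u u) :
    h.simplexVol (singularSimplex j.toFun F) ≤ ENNReal.ofReal (√(2 ^ q *
      Matrix.det (Matrix.of fun i j : Fin q => B (F i.succ - F 0) (F j.succ - F 0)))) := by
  have htan : ∀ u : Fin (q + 1) → ℝ, ∑ i, u i • (F i - F 0) ∈ tangent s := fun u =>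
    sum_mem_tangent _ fun i _ => smul_mem_tangent _ (sub_mem_tangent (hF 0) (hF i))
  set M : ℝ → Matrix (Fin q) (Fin q) ℝ := fun θ => Matrix.of fun i j : Fin q =>
      2 * B (F i.succ - F 0) (F j.succ - F 0) + θ * (if i = j then 2 else 1) with hM
  have hθ : ∀ θ : ℝ, 0 < θ → h.simplexVol (singularSimplex j.toFun F) ≤
      ENNReal.ofReal (√(M θ).det) := by
    intro θ hθ
    have hs' : ∀ u w, pullForm B F θ u w = pullForm B F θ w u := by
      intro u w
      rw [pullForm_apply, pullForm_apply, hsymm _ (htan u) _ (htan w)]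
      simp only [mul_comm (u _)]
    have hp' : ∀ u, u ≠ 0 → 0 < pullForm B F θ u u := by
      intro u hu
      rw [pullForm_apply]
      have h1 := hpos _ (htan u)
      have h2 : 0 < ∑ i, u i * u i := by
        obtain ⟨i, hi⟩ := Function.ne_iff.1 hu
        exact Finset.sum_pos' (fun i _ => mul_self_nonneg _)
          ⟨i, Finset.mem_univ _, mul_self_pos.2 hi⟩
      positivity
    refine iInf_le_of_le (constMetric _ hs' hp') (iInf_le_of_le (fun x y => ?_) ?_)
    · exact (dist_singularSimplex_le j hs hF hcmp hθ.le x y).trans (constMetric_dist_ge hs' hp' _ _)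
    · refine (constMetric_vol_le hs' hp').trans (le_of_eq ?_)
      simp only [pullForm_edge]
      rfl
  have hcont : Continuous fun θ => ENNReal.ofReal (√(M θ).det) := by
    refine ENNReal.continuous_ofReal.comp (Real.continuous_sqrt.comp (Continuous.matrix_det ?_))
    refine continuous_matrix fun i j => ?_
    simp only [hM, Matrix.of_apply]
    fun_prop
  have h0 : 2 ^ q * Matrix.det (Matrix.of fun i j : Fin q => B (F i.succ - F 0) (F j.succ - F 0))
      = (M 0).det := by
    have := Matrix.det_smul (Matrix.of fun i j : Fin q => B (F i.succ - F 0) (F j.succ - F 0)) (2 : ℝ)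
    rw [Fintype.card_fin] at this
    rw [← this]
    congr 1
    ext i j
    simp [hM]
  rw [h0]
  refine ge_of_tendsto ((hcont.tendsto 0).mono_left (nhdsWithin_le_nhds (s := Ioi 0))) ?_
  filter_upwards [self_mem_nhdsWithin] with θ hpos
  exact hθ θ hpos

end SimplexVol

/-! ### Charts -/

section Chart

variable {U : Type*} [Fintype U] [DecidableEq U] {q : ℕ} (v : Fin (q + 1) → U)

/-- The linear part of `chart v`. -/
def chartLift : (Fin q → ℝ) →ₗ[ℝ] (U → ℝ) := Fintype.linearCombination ℝ (edge v)

/-- The linear left inverse of `chart v`. -/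
def unchart : (U → ℝ) →ₗ[ℝ] (Fin q → ℝ) := LinearMap.funLeft ℝ ℝ fun i => v i.succ

@[simp] lemma unchart_apply (x : U → ℝ) (i : Fin q) : unchart v x i = x (v i.succ) := rfl

lemma chartLift_apply (u : Fin q → ℝ) : chartLift v u = ∑ i, u i • edge v i :=
  Fintype.linearCombination_apply ..

lemma chart_eq (y : Fin q → ℝ) : chart v y = Pi.single (v 0) 1 + chartLift v y := by
  simp only [chart, chartLift_apply, edge, smul_sub, Finset.sum_sub_distrib, ← Finset.sum_smul]
  module

lemma chart_sub (y y' : Fin q → ℝ) : chart v y' - chart v y = chartLift v (y' - y) := by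
  rw [chart_eq, chart_eq, map_sub]; abel

lemma chart_sum {ι : Type*} (t : Finset ι) (w : ι → ℝ) (hw : ∑ i ∈ t, w i = 1)
    (y : ι → Fin q → ℝ) : chart v (∑ i ∈ t, w i • y i) = ∑ i ∈ t, w i • chart v (y i) := by
  simp only [chart_eq, smul_add, Finset.sum_add_distrib, map_sum, map_smul, ← Finset.sum_smul, hw,
    one_smul]

variable {v} (hv : Function.Injective v)

include hv

lemma unchart_chart (y : Fin q → ℝ) : unchart v (chart v y) = y := by
  ext i
  simp [chart, Pi.single_apply, hv.eq_iff, Fin.succ_ne_zero, Finset.sum_apply]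

lemma unchart_chartLift (y : Fin q → ℝ) : unchart v (chartLift v y) = y := by
  have h : chartLift v y = chart v y - chart v 0 := by rw [chart_sub, sub_zero]
  rw [h, map_sub, unchart_chart hv, unchart_chart hv, sub_zero]

lemma sum_image_eq (x : U → ℝ) (hx : ∀ u, u ∉ Finset.univ.image v → x u = 0) :
    ∑ u, x u = x (v 0) + ∑ i : Fin q, x (v i.succ) := by
  rw [← Fin.sum_univ_succ (fun i => x (v i)),
    ← Finset.sum_image (f := x) (s := Finset.univ) (g := v) hv.injOn]
  exact (Finset.sum_subset (Finset.subset_univ _) fun u _ hu => hx u hu).symm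

lemma chartLift_unchart {w : U → ℝ} (hw : w ∈ tangent (Finset.univ.image v)) :
    chartLift v (unchart v w) = w := by
  have hsum := sum_image_eq hv w hw.2
  rw [hw.1] at hsum
  ext u
  by_cases hu : u ∈ Finset.univ.image v
  · obtain ⟨k, -, rfl⟩ := Finset.mem_image.1 hu
    rw [chartLift_apply, Finset.sum_apply]
    refine Fin.cases ?_ (fun k => ?_) k
    · simp [edge, hv.eq_iff, (Fin.succ_ne_zero _).symm]
      linarith
    · simp [edge, Pi.single_apply, hv.eq_iff, Fin.succ_ne_zero]
  · rw [hw.2 u hu, chartLift_apply, Finset.sum_apply]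
    refine Finset.sum_eq_zero fun i _ => ?_
    have h1 : u ≠ v i.succ := fun h => hu (h ▸ Finset.mem_image_of_mem _ (Finset.mem_univ _))
    have h2 : u ≠ v 0 := fun h => hu (h ▸ Finset.mem_image_of_mem _ (Finset.mem_univ _))
    simp [edge, h1, h2]

omit hv in
lemma single_mem_closedSimplex {s : Finset U} {u : U} (hu : u ∈ s) :
    (Pi.single u 1 : U → ℝ) ∈ closedSimplex s := by
  refine ⟨fun w => ?_, by simp, fun w hw => ?_⟩
  · rw [Pi.single_apply]; split_ifs <;> norm_num
  · rw [Pi.single_apply, if_neg]; rintro rfl; exact hw hu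

omit hv in
lemma edge_mem_tangent (i : Fin q) : edge v i ∈ tangent (Finset.univ.image v) :=
  sub_mem_tangent (single_mem_closedSimplex (Finset.mem_image_of_mem _ (Finset.mem_univ _)))
    (single_mem_closedSimplex (Finset.mem_image_of_mem _ (Finset.mem_univ _)))

omit hv in
lemma chartLift_mem_tangent (u : Fin q → ℝ) : chartLift v u ∈ tangent (Finset.univ.image v) := by
  rw [chartLift_apply]
  exact sum_mem_tangent _ fun i _ => smul_mem_tangent _ (edge_mem_tangent i)

omit hv in
lemma chart_mem_closedSimplex {y : Fin q → ℝ} (hy : y ∈ corner q) :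
    chart v y ∈ closedSimplex (Finset.univ.image v) := by
  have h0 : ∀ k, (Pi.single (v k) 1 : U → ℝ) ∈ closedSimplex (Finset.univ.image v) := fun k =>
    single_mem_closedSimplex (Finset.mem_image_of_mem _ (Finset.mem_univ _))
  have := (convex_closedSimplex (Finset.univ.image v)).sum_mem (t := Finset.univ)
    (w := (Fin.cons (1 - ∑ i, y i) y : Fin (q + 1) → ℝ)) (z := fun k => Pi.single (v k) 1)
    (fun i _ => by
      refine Fin.cases ?_ (fun i => ?_) i
      · simpa using hy.2
      · simpa using hy.1 i) (by simp [Fin.sum_univ_succ]) (fun i _ => h0 i)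
  rw [Fin.sum_univ_succ] at this
  simpa [chart] using this

lemma chart_unchart {x : U → ℝ} (hx : x ∈ closedSimplex (Finset.univ.image v)) :
    chart v (unchart v x) = x := by
  have h0 : (Pi.single (v 0) 1 : U → ℝ) ∈ closedSimplex (Finset.univ.image v) :=
    single_mem_closedSimplex (Finset.mem_image_of_mem _ (Finset.mem_univ _))
  have := chartLift_unchart hv (sub_mem_tangent h0 hx)
  rw [chart_eq]
  have h1 : unchart v (Pi.single (v 0) 1 : U → ℝ) = 0 := by
    ext i; simp [hv.eq_iff, Fin.succ_ne_zero]
  rw [map_sub, h1, sub_zero] at this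
  rw [this]; abel

lemma unchart_mem_corner {x : U → ℝ} (hx : x ∈ closedSimplex (Finset.univ.image v)) :
    unchart v x ∈ corner q := by
  refine ⟨fun i => hx.1 _, ?_⟩
  have := sum_image_eq hv x hx.2.2
  rw [hx.2.1] at this
  have h0 := hx.1 (v 0)
  simp only [unchart_apply]
  linarith

lemma chart_mem_closedSimplex_iff {y : Fin q → ℝ} :
    chart v y ∈ closedSimplex (Finset.univ.image v) ↔ y ∈ corner q :=
  ⟨fun h => by simpa [unchart_chart hv] using unchart_mem_corner hv h, chart_mem_closedSimplex⟩

lemma measurableEmbedding_chart : MeasurableEmbedding (chart v) := by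
  refine (Function.LeftInverse.isClosedEmbedding (f := unchart v) (unchart_chart hv) ?_
    (continuous_chart v)).measurableEmbedding
  exact continuous_pi fun i => continuous_apply _

end Chart

section CornerTopology

lemma convex_corner (q : ℕ) : Convex ℝ (corner q) := by
  intro x hx y hy a b ha hb hab
  refine ⟨fun u => ?_, ?_⟩
  · have := hx.1 u; have := hy.1 u
    simp only [Pi.add_apply, Pi.smul_apply, smul_eq_mul]; positivity
  · simp only [Pi.add_apply, Pi.smul_apply, smul_eq_mul, Finset.sum_add_distrib, ← Finset.mul_sum]
    nlinarith [hx.2, hy.2]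

lemma isCompact_corner (q : ℕ) : IsCompact (corner q) := by
  have hc : IsClosed (corner q) := by
    have : corner q = (⋂ i, {y : Fin q → ℝ | 0 ≤ y i}) ∩ {y | ∑ i, y i ≤ 1} := by
      ext y; simp [corner]
    rw [this]
    exact (isClosed_iInter fun i => isClosed_le continuous_const (continuous_apply i)).inter
      (isClosed_le (by fun_prop) continuous_const)
  exact isCompact_Icc.of_isClosed_subset hc (t := corner q) (s := Icc 0 1) fun y hy =>
    ⟨hy.1, fun i => (Finset.single_le_sum (fun j _ => hy.1 j) (Finset.mem_univ i)).trans hy.2⟩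

lemma volume_corner_pos (q : ℕ) : 0 < volume (corner q) := by
  rcases q.eq_zero_or_pos with rfl | hq
  · have : corner 0 = univ := by ext y; simp [corner]
    rw [this]
    exact Measure.measure_univ_pos.2 (NeZero.ne _)
  · have hq' : (0 : ℝ) < q := by exact_mod_cast hq
    have : Icc (0 : Fin q → ℝ) (fun _ => (q : ℝ)⁻¹) ⊆ corner q := fun y hy => by
      refine ⟨hy.1, ?_⟩
      calc ∑ i, y i ≤ ∑ _i : Fin q, (q : ℝ)⁻¹ := Finset.sum_le_sum fun i _ => hy.2 i
        _ = 1 := by simp [hq'.ne']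
    refine lt_of_lt_of_le ?_ (measure_mono this)
    rw [Real.volume_Icc_pi]
    simp only [Pi.zero_apply, sub_zero]
    refine pos_iff_ne_zero.2 (Finset.prod_ne_zero_iff.2 fun i _ => ?_)
    simp [hq]

end CornerTopology

/-! ### Local bounds for the metric -/

section Bounds

variable {U : Type*} [Fintype U] [LinearOrder U] {K : PreAbstractSimplicialComplex U}
  (g : RiemannianMetric K) {q : ℕ} (v : Fin (q + 1) → U)

/-- The quadratic form of the metric in the chart of the simplex `v`. -/
def chartForm (y u : Fin q → ℝ) : ℝ :=
  g.form (Finset.univ.image v) (chart v y) (chartLift v u) (chartLift v u)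

/-- The Gram matrix of the metric in the chart of the simplex `v`. -/
def chartGram (y : Fin q → ℝ) : Matrix (Fin q) (Fin q) ℝ :=
  Matrix.of fun i j => g.form (Finset.univ.image v) (chart v y) (edge v i) (edge v j)

lemma chartForm_eq_sum (y u : Fin q → ℝ) :
    chartForm g v y u = ∑ i, ∑ j, u i * u j * chartGram g v y i j := by
  rw [chartForm, chartLift_apply, bilin_sum_sum]; rfl

lemma chartForm_smul (y u : Fin q → ℝ) (a : ℝ) :
    chartForm g v y (a • u) = a ^ 2 * chartForm g v y u := by
  simp only [chartForm, map_smul, LinearMap.smul_apply, smul_eq_mul]; ring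

lemma density_eq (y : Fin q → ℝ) :
    g.density v y = ENNReal.ofReal (√(chartGram g v y).det) := rfl

variable {v} (hv : v ∈ simplices K q)

include hv

lemma strictMono_and_mem_faces : StrictMono v ∧ Finset.univ.image v ∈ K.faces := by
  simpa [simplices] using hv

lemma continuousOn_chartGram (i j : Fin q) :
    ContinuousOn (fun y => chartGram g v y i j) (corner q) :=
  (g.continuousOn _ (strictMono_and_mem_faces hv).2 _ (edge_mem_tangent i) _ (edge_mem_tangent j)).comp
    (continuous_chart v).continuousOn fun _ hy => chart_mem_closedSimplex hy

lemma chartForm_pos {y u : Fin q → ℝ} (hy : y ∈ corner q) (hu : u ≠ 0) : 0 < chartForm g v y u := by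
  refine g.pos _ (strictMono_and_mem_faces hv).2 _ (chart_mem_closedSimplex hy) _
    (chartLift_mem_tangent u) fun h => hu ?_
  rw [← unchart_chartLift (strictMono_and_mem_faces hv).1.injective u, h, map_zero]

lemma chartGram_det_pos {y : Fin q → ℝ} (hy : y ∈ corner q) : 0 < (chartGram g v y).det := by
  refine Matrix.PosDef.det_pos (Matrix.PosDef.of_dotProduct_mulVec_pos ?_ fun u hu => ?_)
  · ext i j
    simp only [chartGram, Matrix.conjTranspose_apply, Matrix.of_apply, star_trivial]
    exact g.symm _ (strictMono_and_mem_faces hv).2 _ (chart_mem_closedSimplex hy) _ (edge_mem_tangent j) _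
      (edge_mem_tangent i)
  · have := chartForm_pos g hv hy hu
    rw [chartForm_eq_sum] at this
    refine this.trans_eq ?_
    simp only [dotProduct, Matrix.mulVec, star_trivial, Finset.mul_sum]
    exact Finset.sum_congr rfl fun i _ => Finset.sum_congr rfl fun j _ => by ring

/-- Uniform bounds and equicontinuity, up to a factor `2`, of the metric on a closed simplex. -/
lemma exists_metric_bounds : ∃ κ > 0, ∃ Λ > 0, ∃ δ > 0,
    (∀ y ∈ corner q, ∀ u, κ * ‖u‖ ^ 2 ≤ chartForm g v y u) ∧
    (∀ y ∈ corner q, ∀ u, chartForm g v y u ≤ Λ ^ 2 * ‖u‖ ^ 2) ∧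
    (∀ y ∈ corner q, √(chartGram g v y).det ≤ Λ) ∧
    (∀ y ∈ corner q, ∀ y' ∈ corner q, dist y y' < δ →
      (∀ u, chartForm g v y u ≤ 2 * chartForm g v y' u) ∧
      √(chartGram g v y).det ≤ 2 * √(chartGram g v y').det) := by
  set S : Set ((Fin q → ℝ) × (Fin q → ℝ)) := corner q ×ˢ Metric.sphere 0 1 with hS
  have hScomp : IsCompact S := (isCompact_corner q).prod (isCompact_sphere 0 1)
  have hQ : ContinuousOn (fun p : (Fin q → ℝ) × (Fin q → ℝ) => chartForm g v p.1 p.2) S := by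
    simp only [chartForm_eq_sum]
    refine continuousOn_finsetSum _ fun i _ => continuousOn_finsetSum _ fun j _ => ?_
    refine ContinuousOn.mul (by fun_prop) ?_
    exact (continuousOn_chartGram g hv i j).comp continuousOn_fst fun p hp => hp.1
  have hdet : ContinuousOn (fun y => √(chartGram g v y).det) (corner q) := by
    refine Real.continuous_sqrt.comp_continuousOn ?_
    rw [continuousOn_iff_continuous_domRestrict]
    refine Continuous.matrix_det (continuous_matrix fun i j => ?_)
    exact continuousOn_iff_continuous_domRestrict.1 (continuousOn_chartGram g hv i j)
  -- lower bound of the form on the unit sphere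
  obtain ⟨κ, hκ, hκQ⟩ : ∃ κ > 0, ∀ p ∈ S, κ ≤ chartForm g v p.1 p.2 := by
    refine hScomp.exists_forall_le' hQ (a := 0) fun p hp => chartForm_pos g hv hp.1 ?_
    exact norm_ne_zero_iff.1 (by rw [mem_sphere_zero_iff_norm.1 hp.2]; norm_num)
  obtain ⟨d0, hd0, hd0Q⟩ : ∃ κ > 0, ∀ y ∈ corner q, κ ≤ √(chartGram g v y).det :=
    (isCompact_corner q).exists_forall_le' hdet (a := 0) fun y hy =>
      Real.sqrt_pos.2 (chartGram_det_pos g hv hy)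
  obtain ⟨Λ1, hΛ1⟩ := hScomp.bddAbove_image hQ
  obtain ⟨Λ2, hΛ2⟩ := (isCompact_corner q).bddAbove_image hdet
  have huQ := hScomp.uniformContinuousOn_of_continuous hQ
  have hud := (isCompact_corner q).uniformContinuousOn_of_continuous hdet
  obtain ⟨δ1, hδ1, h1⟩ := Metric.uniformContinuousOn_iff.1 huQ κ hκ
  obtain ⟨δ2, hδ2, h2⟩ := Metric.uniformContinuousOn_iff.1 hud d0 hd0
  -- the form is quadratic, so bounds on the unit sphere suffice
  have hhom : ∀ u : Fin q → ℝ, u ≠ 0 → ‖u‖⁻¹ • u ∈ Metric.sphere (0 : Fin q → ℝ) 1 ∧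
      ∀ y, chartForm g v y u = ‖u‖ ^ 2 * chartForm g v y (‖u‖⁻¹ • u) := by
    intro u hu
    have hn : ‖u‖ ≠ 0 := norm_ne_zero_iff.2 hu
    refine ⟨by simp [norm_smul, hn], fun y => ?_⟩
    rw [← chartForm_smul, smul_smul, mul_inv_cancel₀ hn, one_smul]
  have hzero : ∀ y, chartForm g v y 0 = 0 := fun y => by simp [chartForm]
  refine ⟨κ, hκ, 1 + |Λ1| + |Λ2|, by positivity, min δ1 δ2, lt_min hδ1 hδ2, ?_, ?_, ?_, ?_⟩
  · intro y hy u
    rcases eq_or_ne u 0 with rfl | hu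
    · simp [hzero]
    · rw [(hhom u hu).2, mul_comm]
      gcongr
      exact hκQ ⟨y, _⟩ ⟨hy, (hhom u hu).1⟩
  · intro y hy u
    rcases eq_or_ne u 0 with rfl | hu
    · simp [hzero]
    · rw [(hhom u hu).2, mul_comm]
      gcongr
      have := hΛ1 (mem_image_of_mem _ (show ((y, ‖u‖⁻¹ • u) : _ × _) ∈ S from ⟨hy, (hhom u hu).1⟩))
      nlinarith [le_abs_self Λ1, abs_nonneg Λ1, abs_nonneg Λ2, mul_nonneg (abs_nonneg Λ1) (abs_nonneg Λ2)]
  · intro y hy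
    have := hΛ2 (mem_image_of_mem _ hy)
    linarith [le_abs_self Λ2, abs_nonneg Λ1]
  · intro y hy y' hy' hd
    constructor
    · intro u
      rcases eq_or_ne u 0 with rfl | hu
      · simp [hzero]
      · rw [(hhom u hu).2, (hhom u hu).2 y', mul_left_comm]
        gcongr
        have a1 := h1 (y, ‖u‖⁻¹ • u) ⟨hy, (hhom u hu).1⟩ (y', ‖u‖⁻¹ • u) ⟨hy', (hhom u hu).1⟩
          (by rw [Prod.dist_eq, dist_self, max_eq_left dist_nonneg]; exact hd.trans_le (min_le_left _ _))
        have a2 := hκQ (y', ‖u‖⁻¹ • u) ⟨hy', (hhom u hu).1⟩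
        rw [Real.dist_eq] at a1
        have a3 := (abs_lt.1 a1).2
        linarith
    · have a1 := h2 y hy y' hy' (hd.trans_le (min_le_right _ _))
      rw [Real.dist_eq] at a1
      have a3 := (abs_lt.1 a1).2
      have a2 := hd0Q y' hy'
      linarith

end Bounds

/-! ### The volume measure in charts -/

section Measure

variable {U : Type*} [Fintype U] [LinearOrder U] {K : PreAbstractSimplicialComplex U}
  (g : RiemannianMetric K) {q : ℕ}

/-- The Riemannian volume in the chart of the simplex `v`. -/
def chartVol (v : Fin (q + 1) → U) : Measure (Fin q → ℝ) :=
  (volume.restrict (corner q)).withDensity (g.density v)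

lemma vol_apply (A : Set (U → ℝ)) :
    g.vol q A = ∑ v ∈ simplices K q, chartVol g v (chart v ⁻¹' A) := by
  rw [RiemannianMetric.vol, Measure.finsetSum_apply]
  exact Finset.sum_congr rfl fun v hv =>
    (measurableEmbedding_chart (strictMono_and_mem_faces hv).1.injective).map_apply _ _

lemma lintegral_vol (f : (U → ℝ) → ℝ≥0∞) :
    ∫⁻ x, f x ∂(g.vol q) = ∑ v ∈ simplices K q, ∫⁻ y, f (chart v y) ∂(chartVol g v) := by
  rw [RiemannianMetric.vol, lintegral_finsetSum_measure]
  exact Finset.sum_congr rfl fun v hv =>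
    (measurableEmbedding_chart (strictMono_and_mem_faces hv).1.injective).lintegral_map _

lemma chartVol_absolutelyContinuous (v : Fin (q + 1) → U) :
    chartVol g v ≪ volume.restrict (corner q) := withDensity_absolutelyContinuous _ _

lemma chartVol_apply (v : Fin (q + 1) → U) {A : Set (Fin q → ℝ)} (hA : MeasurableSet A)
    (hsub : A ⊆ corner q) : chartVol g v A = ∫⁻ y in A, g.density v y := by
  rw [chartVol, withDensity_apply _ hA, Measure.restrict_restrict hA, inter_eq_left.2 hsub]

lemma chartVol_univ_lt_top {v : Fin (q + 1) → U} (hv : v ∈ simplices K q) :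
    chartVol g v univ < ⊤ := by
  obtain ⟨κ, -, Λ, -, δ, -, -, -, h, -⟩ := exists_metric_bounds g hv
  rw [chartVol, withDensity_apply _ MeasurableSet.univ, Measure.restrict_univ]
  calc _ ≤ ∫⁻ _ in corner q, ENNReal.ofReal Λ :=
        setLIntegral_mono' (measurableSet_corner q) fun y hy => ENNReal.ofReal_le_ofReal (h y hy)
    _ < ⊤ := by
        rw [lintegral_const, Measure.restrict_apply MeasurableSet.univ, univ_inter]
        exact ENNReal.mul_lt_top ENNReal.ofReal_lt_top
          ((volume_corner_le_one q).trans_lt ENNReal.one_lt_top)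

lemma isFiniteMeasure_chartVol {v : Fin (q + 1) → U} (hv : v ∈ simplices K q) :
    IsFiniteMeasure (chartVol g v) := ⟨chartVol_univ_lt_top g hv⟩

lemma vol_univ_lt_top : g.vol q univ < ⊤ := by
  rw [vol_apply]
  exact ENNReal.sum_lt_top.2 fun v hv => by simpa using chartVol_univ_lt_top g hv

end Measure

/-! ### Determinants of affine simplices -/

section Det

variable {U : Type*} [Fintype U] {q : ℕ}

/-- The determinant of the barycentric coordinates with respect to `v`. -/
def baryDet (v : Fin (q + 1) → U) : (U → ℝ) [⋀^Fin (q + 1)]→ₗ[ℝ] ℝ :=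
  (Matrix.detRowAlternating (n := Fin (q + 1)) (R := ℝ)).compLinearMap (LinearMap.funLeft ℝ ℝ v)

lemma baryDet_apply (v : Fin (q + 1) → U) (σ : Fin (q + 1) → U → ℝ) :
    baryDet v σ = Matrix.det (Matrix.of fun i j => σ i (v j)) := rfl

/-- Chart coordinates, preceded by the sum of all barycentric coordinates. -/
def homogCoord (v : Fin (q + 1) → U) : (U → ℝ) →ₗ[ℝ] (Fin (q + 1) → ℝ) :=
  LinearMap.pi (Fin.cons (∑ u, LinearMap.proj u) fun i => LinearMap.proj (v i.succ))

lemma homogCoord_apply (v : Fin (q + 1) → U) (x : U → ℝ) :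
    homogCoord v x = Fin.cons (∑ u, x u) (unchart v x) := by
  ext i
  refine Fin.cases ?_ (fun i => ?_) i <;> simp [homogCoord]

/-- The determinant of the homogeneous chart coordinates. -/
def homogDet (v : Fin (q + 1) → U) : (U → ℝ) [⋀^Fin (q + 1)]→ₗ[ℝ] ℝ :=
  (Matrix.detRowAlternating (n := Fin (q + 1)) (R := ℝ)).compLinearMap (homogCoord v)

lemma homogDet_apply (v : Fin (q + 1) → U) (σ : Fin (q + 1) → U → ℝ) :
    homogDet v σ = Matrix.det (Matrix.of fun i => homogCoord v (σ i)) := rfl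

/-- In an affine simplex, the homogeneous determinant is the determinant of the edge vectors. -/
lemma homogDet_eq_det_edges (v : Fin (q + 1) → U) (σ : Fin (q + 1) → U → ℝ)
    (hσ : ∀ i, ∑ u, σ i u = 1) :
    homogDet v σ = Matrix.det (Matrix.of fun i : Fin q => unchart v (σ i.succ - σ 0)) := by
  let B : Matrix (Fin (q + 1)) (Fin (q + 1)) ℝ := Matrix.of
    (Fin.cons (homogCoord v (σ 0)) fun i => homogCoord v (σ i.succ - σ 0))
  have h1 : homogDet v σ = B.det := by
    rw [homogDet_apply]
    refine Matrix.det_eq_of_forall_row_eq_smul_add_const (Fin.cons 0 fun _ => 1) 0 (by simp) ?_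
    intro i j
    refine Fin.cases ?_ (fun i => ?_) i
    · simp [B]
    · simp [B]
  rw [h1, Matrix.det_succ_column_zero, Fin.sum_univ_succ, Finset.sum_eq_zero]
  · simp only [B, homogCoord_apply]
    simp only [Matrix.of_apply, Fin.cons_zero, Fin.val_zero, pow_zero, one_mul, hσ, add_zero]
    rfl
  · intro i _
    simp [B, homogCoord_apply, hσ]

lemma baryDet_standard [DecidableEq U] {v : Fin (q + 1) → U} (hv : Function.Injective v) :
    baryDet v (fun i => (Pi.single (v i) 1 : U → ℝ)) = 1 := by
  rw [baryDet_apply, ← Matrix.det_one (n := Fin (q + 1)) (R := ℝ)]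
  congr 1
  ext i j
  simp [Matrix.one_apply, Pi.single_apply, hv.eq_iff, eq_comm]

lemma homogDet_standard [DecidableEq U] {v : Fin (q + 1) → U} (hv : Function.Injective v) :
    homogDet v (fun i => (Pi.single (v i) 1 : U → ℝ)) = 1 := by
  rw [homogDet_eq_det_edges v _ fun i => by simp, ← Matrix.det_one (n := Fin q) (R := ℝ)]
  congr 1
  ext i j
  simp [Matrix.one_apply, Pi.single_apply, hv.eq_iff, Fin.succ_ne_zero, eq_comm]

/-- A matrix with nonnegative entries and row sums `1` has determinant at most `1` in absolute
value. -/
lemma abs_det_le_one_of_stochastic {r : ℕ} (T : Matrix (Fin r) (Fin r) ℝ) (h0 : ∀ i j, 0 ≤ T i j)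
    (h1 : ∀ i, ∑ j, T i j = 1) : |T.det| ≤ 1 := by
  rw [← Matrix.det_transpose, Matrix.det_apply]
  calc _ ≤ ∑ π : Equiv.Perm (Fin r), |Equiv.Perm.sign π • ∏ i, T.transpose (π i) i| :=
        Finset.abs_sum_le_sum_abs _ _
    _ = ∑ π : Equiv.Perm (Fin r), ∏ i, T i (π i) := by
        refine Finset.sum_congr rfl fun π _ => ?_
        have hn : 0 ≤ ∏ i, T.transpose (π i) i := Finset.prod_nonneg fun i _ => h0 _ _
        rcases Int.units_eq_one_or (Equiv.Perm.sign π) with h | h <;> rw [h] <;>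
          simp only [one_smul, Units.neg_smul, abs_neg, abs_of_nonneg hn] <;> rfl
    _ = ∑ f ∈ Finset.univ.map ⟨fun π : Equiv.Perm (Fin r) => (π : Fin r → Fin r),
          DFunLike.coe_injective⟩, ∏ i, T i (f i) := by
        rw [Finset.sum_map]; rfl
    _ ≤ ∑ f : Fin r → Fin r, ∏ i, T i (f i) :=
        Finset.sum_le_sum_of_subset_of_nonneg (Finset.subset_univ _)
          fun f _ _ => Finset.prod_nonneg fun i _ => h0 _ _
    _ = 1 := by
        have h2 := Finset.prod_univ_sum (fun _ : Fin r => (Finset.univ : Finset (Fin r)))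
          fun i j => T i j
        rw [Fintype.piFinset_univ] at h2
        rw [← h2]
        simp [h1]

/-- The determinant of a simplex contained in the simplex `σ` is at most the one of `σ`. -/
lemma abs_homogDet_le (v : Fin (q + 1) → U) (σ τ : Fin (q + 1) → U → ℝ)
    (hτ : ∀ i, τ i ∈ convexHull ℝ (range σ)) : |homogDet v τ| ≤ |homogDet v σ| := by
  choose w hw hwτ using fun i => mem_convexHull_range_iff.1 (hτ i)
  have : (Matrix.of fun i => homogCoord v (τ i)) =
      (Matrix.of w) * (Matrix.of fun i => homogCoord v (σ i)) := by
    ext i j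
    rw [Matrix.mul_apply, Matrix.of_apply, ← hwτ i, map_sum, Finset.sum_apply]
    simp
  rw [homogDet_apply, homogDet_apply, this, Matrix.det_mul, abs_mul]
  exact mul_le_of_le_one_left (abs_nonneg _)
    (abs_det_le_one_of_stochastic _ (fun i j => (hw i).1 j) fun i => (hw i).2)

end Det

/-! ### Tilings of a simplex by its iterated subdivisions -/

section Tiling

variable {U : Type*} [Fintype U] [LinearOrder U] {q : ℕ} {v : Fin (q + 1) → U}

/-- The vertices of the simplex `v` of the complex, as points of its realization. -/
def vertexSimplex (v : Fin (q + 1) → U) : Fin (q + 1) → U → ℝ := fun i => Pi.single (v i) 1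

lemma convexHull_vertexSimplex (hv : Function.Injective v) :
    convexHull ℝ (range (vertexSimplex v)) = closedSimplex (Finset.univ.image v) := by
  refine Subset.antisymm (convexHull_min ?_ (convex_closedSimplex _)) fun x hx => ?_
  · rintro _ ⟨i, rfl⟩
    exact single_mem_closedSimplex (Finset.mem_image_of_mem _ (Finset.mem_univ _))
  · refine mem_convexHull_range_iff.2 ⟨fun i => x (v i), ⟨fun i => hx.1 _, ?_⟩, ?_⟩
    · rw [Fin.sum_univ_succ, ← sum_image_eq hv x hx.2.2, hx.2.1]
    · have := chart_unchart hv hx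
      rw [chart] at this
      rw [Fin.sum_univ_succ]
      have h1 := sum_image_eq hv x hx.2.2
      rw [hx.2.1] at h1
      have h2 : 1 - ∑ i, unchart v x i = x (v 0) := by simp only [unchart_apply]; linarith
      rw [h2] at this
      exact this

lemma iterSimplex_mem_closedSimplex (hv : Function.Injective v) {k : ℕ}
    (β : Fin k → Fin q → Bool) (i : Fin (q + 1)) :
    iterSimplex k (vertexSimplex v) β i ∈ closedSimplex (Finset.univ.image v) := by
  rw [← convexHull_vertexSimplex hv]
  exact iterSimplex_mem _ _ _

lemma abs_homogDet_iterSimplex (hv : Function.Injective v) {k : ℕ} (β : Fin k → Fin q → Bool) :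
    |homogDet v (iterSimplex k (vertexSimplex v) β)| = ((2⁻¹ : ℝ) ^ q) ^ k := by
  have := iterSign_mul_alternating (homogDet v) (vertexSimplex v) β
  rw [show homogDet v (vertexSimplex v) = 1 from homogDet_standard hv, mul_one] at this
  rw [← abs_of_nonneg (show (0 : ℝ) ≤ ((2⁻¹ : ℝ) ^ q) ^ k by positivity), ← this, abs_mul]
  rcases iterSign_eq β with h | h <;> simp [h]

/-- The part of the chart of `v` that is covered by the affine simplex `σ`. -/
def tile (v : Fin (q + 1) → U) (σ : Fin (q + 1) → U → ℝ) : Set (Fin q → ℝ) :=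
  chart v ⁻¹' convexHull ℝ (range σ)

lemma tile_subset_corner (hv : Function.Injective v) {σ : Fin (q + 1) → U → ℝ}
    (hσ : ∀ i, σ i ∈ closedSimplex (Finset.univ.image v)) : tile v σ ⊆ corner q := by
  intro y hy
  rw [← chart_mem_closedSimplex_iff hv]
  exact convexHull_min (range_subset_iff.2 hσ) (convex_closedSimplex _) hy

lemma measurableSet_tile (σ : Fin (q + 1) → U → ℝ) : MeasurableSet (tile v σ) :=
  ((finite_range σ).isClosed_convexHull ℝ |>.preimage (continuous_chart v)).measurableSet

lemma mem_tile_iff (hv : Function.Injective v) {σ : Fin (q + 1) → U → ℝ}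
    (hσ : ∀ i, σ i ∈ closedSimplex (Finset.univ.image v)) (y : Fin q → ℝ) :
    y ∈ tile v σ ↔ ∃ w ∈ stdSimplex ℝ (Fin (q + 1)), ∑ i, w i • unchart v (σ i) = y := by
  rw [tile, mem_preimage, mem_convexHull_range_iff]
  refine exists_congr fun w => and_congr_right fun hw => ?_
  have : ∑ i, w i • σ i = chart v (∑ i, w i • unchart v (σ i)) := by
    rw [chart_sum v _ _ hw.2]
    exact Finset.sum_congr rfl fun i _ => by rw [chart_unchart hv (hσ i)]
  rw [this]
  exact ⟨fun h => by simpa [unchart_chart hv] using congrArg (unchart v) h, fun h => by rw [h]⟩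

lemma volume_tile (hv : Function.Injective v) {σ : Fin (q + 1) → U → ℝ}
    (hσ : ∀ i, σ i ∈ closedSimplex (Finset.univ.image v)) :
    volume (tile v σ) = ENNReal.ofReal |homogDet v σ| * volume (corner q) := by
  set M : Matrix (Fin q) (Fin q) ℝ := Matrix.of fun i : Fin q => unchart v (σ i.succ - σ 0) with hM
  have himg : tile v σ = (fun z => unchart v (σ 0) + z) '' (M.transpose.toLin' '' corner q) := by
    ext y
    rw [mem_tile_iff hv hσ, image_image]
    have key : ∀ z : Fin q → ℝ, unchart v (σ 0) + M.transpose.toLin' z =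
        (1 - ∑ i, z i) • unchart v (σ 0) + ∑ i, z i • unchart v (σ i.succ) := by
      intro z
      ext j
      simp only [hM, Matrix.toLin'_apply, Pi.add_apply, Matrix.mulVec, dotProduct,
        Matrix.transpose_apply, Matrix.of_apply, map_sub, Pi.sub_apply, Pi.smul_apply,
        Finset.sum_apply, smul_eq_mul, sub_mul, Finset.sum_sub_distrib, one_mul]
      rw [add_sub_assoc', sub_add_eq_add_sub, Finset.sum_mul]
      simp only [mul_comm (z _)]
    constructor
    · rintro ⟨w, hw, rfl⟩
      have hs := hw.2
      rw [Fin.sum_univ_succ] at hs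
      refine ⟨fun i => w i.succ, ⟨fun i => hw.1 _, by have := hw.1 0; linarith⟩, ?_⟩
      simp only [key]
      rw [Fin.sum_univ_succ]
      congr 2
      linarith
    · rintro ⟨z, hz, rfl⟩
      refine ⟨Fin.cons (1 - ∑ i, z i) z, ⟨fun i => ?_, ?_⟩, ?_⟩
      · refine Fin.cases ?_ (fun i => ?_) i
        · simpa using hz.2
        · simpa using hz.1 i
      · simp [Fin.sum_univ_succ]
      · simp only [key]
        simp [Fin.sum_univ_succ]
  rw [himg, image_add_left, measure_preimage_add, Measure.addHaar_image_linearMap,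
    LinearMap.det_toLin', Matrix.det_transpose, hM, homogDet_eq_det_edges v σ fun i => (hσ i).2.1]

lemma exists_mem_tile (hv : Function.Injective v) (k : ℕ) {y : Fin q → ℝ} (hy : y ∈ corner q) :
    ∃ β : Fin k → Fin q → Bool, y ∈ tile v (iterSimplex k (vertexSimplex v) β) := by
  refine exists_mem_iterSimplex k (vertexSimplex v) ?_
  rw [convexHull_vertexSimplex hv]
  exact chart_mem_closedSimplex hy

/-- Almost every point lies in exactly one simplex of the subdivision: the simplices cover, and
their volumes add up to the whole volume. -/
lemma ae_sum_indicator_tile (hv : Function.Injective v) (k : ℕ) :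
    ∀ᵐ y ∂(volume.restrict (corner q)), ∑ β : Fin k → Fin q → Bool,
      (tile v (iterSimplex k (vertexSimplex v) β)).indicator (1 : (Fin q → ℝ) → ℝ≥0∞) y = 1 := by
  have hmeas : ∀ β : Fin k → Fin q → Bool, Measurable
      ((tile v (iterSimplex k (vertexSimplex v) β)).indicator (1 : (Fin q → ℝ) → ℝ≥0∞)) :=
    fun β => measurable_one.indicator (measurableSet_tile _)
  have h := ae_eq_of_ae_le_of_lintegral_le (μ := volume.restrict (corner q)) (f := 1)
    (g := fun y => ∑ β : Fin k → Fin q → Bool,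
      (tile v (iterSimplex k (vertexSimplex v) β)).indicator (1 : (Fin q → ℝ) → ℝ≥0∞) y) ?_ ?_ ?_ ?_
  · filter_upwards [h] with y hy using hy.symm
  · filter_upwards [ae_restrict_mem (measurableSet_corner q)] with y hy
    obtain ⟨β, hβ⟩ := exists_mem_tile hv k hy
    refine le_trans ?_ (Finset.single_le_sum (fun _ _ => zero_le) (Finset.mem_univ β))
    rw [indicator_of_mem hβ]
  · simp only [Pi.one_apply, lintegral_one, Measure.restrict_apply_univ]
    exact ((volume_corner_le_one q).trans_lt ENNReal.one_lt_top).ne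
  · exact (Finset.measurable_sum _ fun β _ => hmeas β).aemeasurable
  · rw [lintegral_finsetSum _ fun β _ => hmeas β]
    simp only [lintegral_indicator_one (measurableSet_tile _), Pi.one_apply, lintegral_one,
      Measure.restrict_apply_univ, Measure.restrict_apply (measurableSet_tile _)]
    have h1 : ∀ β : Fin k → Fin q → Bool,
        volume (tile v (iterSimplex k (vertexSimplex v) β) ∩ corner q) =
          ENNReal.ofReal (((2⁻¹ : ℝ) ^ q) ^ k) * volume (corner q) := by
      intro β
      rw [inter_eq_left.2 (tile_subset_corner hv (iterSimplex_mem_closedSimplex hv β)),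
        volume_tile hv (iterSimplex_mem_closedSimplex hv β), abs_homogDet_iterSimplex hv]
    simp only [h1, Finset.sum_const, Finset.card_univ, Fintype.card_fun, Fintype.card_fin,
      Fintype.card_bool, nsmul_eq_mul]
    rw [← mul_assoc]
    refine mul_le_of_le_one_left' (le_of_eq ?_)
    rw [← ENNReal.ofReal_natCast, ← ENNReal.ofReal_mul (by positivity), ENNReal.ofReal_eq_one]
    push_cast
    rw [← mul_pow, ← mul_pow]
    norm_num

lemma sum_indicator_eq_one {ι α : Type*} [Fintype ι] {s : ι → Set α} {y : α}
    (h : ∑ i, (s i).indicator (1 : α → ℝ≥0∞) y = 1) :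
    ∃ i, y ∈ s i ∧ ∀ i', y ∈ s i' → i' = i := by
  classical
  have h1 : ∑ i, (s i).indicator (1 : α → ℝ≥0∞) y =
      ((Finset.univ.filter fun i => y ∈ s i).card : ℝ≥0∞) := by
    rw [Finset.card_filter]
    push_cast
    exact Finset.sum_congr rfl fun i _ => by simp [indicator_apply]
  rw [h1] at h
  obtain ⟨i, hi⟩ := Finset.card_eq_one.1 (by exact_mod_cast h)
  have hmem : ∀ i', y ∈ s i' ↔ i' = i := fun i' => by
    rw [← Finset.mem_singleton, ← hi]; simp
  exact ⟨i, (hmem i).2 rfl, fun i' h' => (hmem i').1 h'⟩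

/-- Almost every point of a simplex lies in its interior. -/
lemma ae_pos_coord (hv : Function.Injective v) :
    ∀ᵐ y ∂(volume.restrict (corner q)), ∀ j, 0 < chart v y (v j) := by
  have h1 : ∀ᵐ y ∂(volume : Measure (Fin q → ℝ)), y ∉ frontier (corner q) :=
    measure_eq_zero_iff_ae_notMem.1 ((convex_corner q).addHaar_frontier volume)
  filter_upwards [ae_restrict_of_ae h1, ae_restrict_mem (measurableSet_corner q)] with y hy hyc
  have hint : y ∈ interior (corner q) := by
    rw [← self_sdiff_frontier]; exact ⟨hyc, hy⟩
  obtain ⟨ε, hε, hball⟩ := Metric.isOpen_iff.1 isOpen_interior y hint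
  have hmove : ∀ (i : Fin q) (a : ℝ), |a| < ε → y + Pi.single i a ∈ corner q := by
    intro i a ha
    refine interior_subset (hball ?_)
    rw [Metric.mem_ball, dist_eq_norm, add_sub_cancel_left]
    refine lt_of_le_of_lt ?_ ha
    rw [Pi.norm_single, Real.norm_eq_abs]
  intro j
  refine Fin.cases ?_ (fun i => ?_) j
  · have h0 : chart v y (v 0) = 1 - ∑ i, y i := by
      simp [chart, hv.eq_iff, (Fin.succ_ne_zero _).symm, Finset.sum_apply]
    rw [h0]
    rcases q.eq_zero_or_pos with rfl | hq
    · simp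
    · have := (hmove ⟨0, hq⟩ (ε / 2) (by rw [abs_of_pos (by positivity)]; linarith)).2
      simp only [Pi.add_apply, Finset.sum_add_distrib, Finset.sum_pi_single', Finset.mem_univ,
        if_true] at this
      linarith
  · have h0 : chart v y (v i.succ) = y i := congrFun (unchart_chart hv y) i
    rw [h0]
    have := (hmove i (-(ε / 2)) (by rw [abs_neg, abs_of_pos (by positivity)]; linarith)).1 i
    simp at this
    linarith

end Tiling

/-! ### The subdivided fundamental cycle and its multiplicities -/

section Fundamental

variable {n : ℕ} {U : Type*} [Fintype U] [LinearOrder U] {X : Type*} [TopologicalSpace X]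

/-- The `k`-fold edgewise subdivision of the fundamental cycle. -/
def GeometricCycle.fundChain (Z : GeometricCycle n U X) (k : ℕ) : VertexChain (U → ℝ) (n + 1) :=
  ∑ v ∈ simplices Z.V n, ∑ β : Fin k → Fin n → Bool,
    (Z.o v * iterSign k β) • Finsupp.single (iterSimplex k (vertexSimplex v) β) (1 : ℤ)

lemma bd_fundChain {q : ℕ} (Z : GeometricCycle (q + 1) U X) (k : ℕ) :
    bd (q + 1) (Z.fundChain k) = 0 := by
  have h1 : Z.fundChain k = ∑ v ∈ simplices Z.V (q + 1),
      Z.o v • (subdivide (q + 1))^[k] (Finsupp.single (vertexSimplex v) 1) := by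
    refine Finset.sum_congr rfl fun v _ => ?_
    rw [iterate_subdivide_single, Finset.smul_sum]
    exact Finset.sum_congr rfl fun β _ => mul_smul _ _ _
  have h2 : ∑ v ∈ simplices Z.V (q + 1),
      Z.o v • bd (q + 1) (Finsupp.single (vertexSimplex v) 1) = 0 := by
    have hcyc : ∑ v ∈ simplices Z.V (q + 1), ∑ i : Fin (q + 2),
        Finsupp.single (v ∘ i.succAbove) ((-1 : ℤ) ^ (i : ℕ) * Z.o v) = 0 := by
      ext r
      have := Z.orientation.cycle r
      simp only [Finsupp.finsetSum_apply, Finsupp.single_apply, Finsupp.coe_zero, Pi.zero_apply]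
      exact this
    have := congrArg (Finsupp.lmapDomain ℤ ℤ
      (fun (r : Fin (q + 1) → U) j => (Pi.single (r j) 1 : U → ℝ))) hcyc
    rw [map_zero, map_sum] at this
    rw [← this]
    refine Finset.sum_congr rfl fun v _ => ?_
    rw [map_sum, bd_single, Finset.smul_sum]
    refine Finset.sum_congr rfl fun i _ => ?_
    rw [Finsupp.lmapDomain_apply, Finsupp.mapDomain_single, smul_smul, Finsupp.smul_single,
      smul_eq_mul, mul_one, mul_comm]
    rfl
  rw [h1, map_sum]
  have h3 : ∀ v ∈ simplices Z.V (q + 1), bd (q + 1)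
      (Z.o v • (subdivide (q + 1))^[k] (Finsupp.single (vertexSimplex v) 1)) =
      ((subdivide q) ^ k : Module.End ℤ _)
        (Z.o v • bd (q + 1) (Finsupp.single (vertexSimplex v) 1)) := by
    intro v _
    rw [map_smul, bd_iterate_subdivide, map_smul, Module.End.pow_apply]
  rw [Finset.sum_congr rfl h3, ← map_sum, h2, map_zero]

open Classical in
/-- The multiplicity at `x` of the affine simplex `a`. -/
def GeometricCycle.simplexMult (Z : GeometricCycle n U X) (x : U → ℝ)
    (a : Fin (n + 1) → U → ℝ) : ℤ :=
  if x ∈ convexHull ℝ (range a) then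
    ∑ v ∈ simplices Z.V n, (if ∀ i, a i ∈ closedSimplex (Finset.univ.image v) then
        Z.o v * SignType.sign (Matrix.det (Matrix.of fun i j => a i (v j))) else 0)
  else 0

lemma multiplicity_eq (Z : GeometricCycle n U X) (p : AffineChain U n) (x : U → ℝ) :
    Z.multiplicity p x = Finsupp.linearCombination ℤ (Z.simplexMult x) p := by
  rw [Finsupp.linearCombination_apply, GeometricCycle.multiplicity]
  refine Finsupp.sum_congr fun a _ => ?_
  rw [GeometricCycle.simplexMult]
  split_ifs <;> simp

lemma natAbs_linearCombination_le {α : Type*} (f : α → ℤ) (x : α →₀ ℤ) :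
    ((Finsupp.linearCombination ℤ f x).natAbs : ℝ≥0∞) ≤
      weight (fun a => ((f a).natAbs : ℝ≥0∞)) x := by
  rw [Finsupp.linearCombination_apply, Finsupp.sum, weight]
  have := Int.natAbs_sum_le x.support fun a => x a • f a
  simp only [smul_eq_mul, Int.natAbs_mul] at this
  exact_mod_cast this

lemma natAbs_simplexMult_le (Z : GeometricCycle n U X) (x : U → ℝ) (a : Fin (n + 1) → U → ℝ) :
    (Z.simplexMult x a).natAbs ≤ (simplices Z.V n).card := by
  classical
  rw [GeometricCycle.simplexMult]
  split_ifs
  · refine (Int.natAbs_sum_le _ _).trans ?_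
    rw [Finset.card_eq_sum_ones]
    refine Finset.sum_le_sum fun v hv => ?_
    split_ifs
    · rw [Int.natAbs_mul]
      have h1 : (Z.o v).natAbs = 1 := by
        rcases Z.orientation.sign v hv with h | h <;> simp [h]
      rw [h1, one_mul]
      rcases SignType.sign (Matrix.det (Matrix.of fun i j => a i (v j))) <;> simp
    · simp
  · simp

/-- The chain `cut r t (n + 1) σ` is supported in `σ`. -/
lemma simplexMult_cut_eq_zero (Z : GeometricCycle n U X) (r : (U → ℝ) → ℝ) (t : ℝ) {x : U → ℝ}
    {σ : Fin (n + 1) → U → ℝ} (hx : x ∉ convexHull ℝ (range σ)) :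
    Finsupp.linearCombination ℤ (Z.simplexMult x) (cut r t (n + 1) σ) = 0 := by
  have h1 := natAbs_linearCombination_le (Z.simplexMult x) (cut r t (n + 1) σ)
  have h2 := weight_cut_le r t σ (fun a => ((Z.simplexMult x a).natAbs : ℝ≥0∞)) 0
    fun τ hτ => by
      have : x ∉ convexHull ℝ (range τ) := fun h =>
        hx (convexHull_min (range_subset_iff.2 hτ) (convex_convexHull ℝ _) h)
      simp [GeometricCycle.simplexMult, this]
  rw [mul_zero] at h2
  have := le_antisymm (h1.trans h2) bot_le
  simpa using this

lemma natAbs_simplexMult_cut_le (Z : GeometricCycle n U X) (r : (U → ℝ) → ℝ) (t : ℝ) (x : U → ℝ)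
    (σ : Fin (n + 1) → U → ℝ) :
    (Finsupp.linearCombination ℤ (Z.simplexMult x) (cut r t (n + 1) σ)).natAbs ≤
      cutCount (n + 1) * (simplices Z.V n).card := by
  have h1 := natAbs_linearCombination_le (Z.simplexMult x) (cut r t (n + 1) σ)
  have h2 := weight_cut_le r t σ (fun a => ((Z.simplexMult x a).natAbs : ℝ≥0∞))
    ((simplices Z.V n).card) fun τ _ => by exact_mod_cast natAbs_simplexMult_le Z x τ
  exact_mod_cast h1.trans h2

/-- The simplices of the subdivision have multiplicity `1`, with their signs. -/
lemma simplexMult_iterSimplex (Z : GeometricCycle n U X) {v : Fin (n + 1) → U}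
    (hv : v ∈ simplices Z.V n) {k : ℕ} (β : Fin k → Fin n → Bool) {x : U → ℝ}
    (hx : x ∈ convexHull ℝ (range (iterSimplex k (vertexSimplex v) β))) :
    Z.o v * iterSign k β * Z.simplexMult x (iterSimplex k (vertexSimplex v) β) = 1 := by
  classical
  have hinj := (strictMono_and_mem_faces hv).1.injective
  set e := iterSimplex k (vertexSimplex v) β with he
  have hdet : ∀ v' : Fin (n + 1) → U, (iterSign k β : ℝ) * baryDet v' e =
      ((2⁻¹ : ℝ) ^ n) ^ k * baryDet v' (vertexSimplex v) := fun v' =>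
    iterSign_mul_alternating (baryDet v') (vertexSimplex v) β
  have hdetv : (iterSign k β : ℝ) * baryDet v e = ((2⁻¹ : ℝ) ^ n) ^ k := by
    rw [hdet v, show baryDet v (vertexSimplex v) = 1 from baryDet_standard hinj, mul_one]
  have hcard : ∀ v' ∈ simplices Z.V n, (Finset.univ.image v').card = n + 1 := fun v' hv' => by
    rw [Finset.card_image_of_injective _ (strictMono_and_mem_faces hv').1.injective, Finset.card_univ,
      Fintype.card_fin]
  -- a nondegenerate simplex lies in only one `n`-simplex of the complex
  have huniq : ∀ v' ∈ simplices Z.V n, (∀ i, e i ∈ closedSimplex (Finset.univ.image v')) →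
      v' = v := by
    intro v' hv' h
    have hsub : Finset.univ.image v ⊆ Finset.univ.image v' := by
      intro u hu
      by_contra hu'
      obtain ⟨j, -, rfl⟩ := Finset.mem_image.1 hu
      have hz : baryDet v e = 0 := by
        rw [baryDet_apply]
        exact Matrix.det_eq_zero_of_column_eq_zero j fun i => (h i).2.2 _ hu'
      rw [hz, mul_zero] at hdetv
      exact absurd hdetv.symm (by positivity)
    have heq := Finset.eq_of_subset_of_card_le hsub (by rw [hcard v hv, hcard v' hv'])
    refine ((strictMono_and_mem_faces hv').1.range_inj (strictMono_and_mem_faces hv).1).1 ?_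
    have := congrArg (fun s : Finset U => (s : Set U)) heq
    simpa using this.symm
  rw [GeometricCycle.simplexMult, if_pos hx, Finset.sum_eq_single v]
  · rw [if_pos (iterSimplex_mem_closedSimplex hinj β)]
    have ho : Z.o v * Z.o v = 1 := by
      rcases Z.orientation.sign v hv with h | h <;> simp [h]
    have hs : iterSign k β * (SignType.sign (Matrix.det (Matrix.of fun i j => e i (v j))) : ℤ) = 1 := by
      rw [← baryDet_apply]
      have hpos : (0 : ℝ) < ((2⁻¹ : ℝ) ^ n) ^ k := by positivity
      rw [← hdetv] at hpos
      rcases iterSign_eq β with h | h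
      · rw [h] at hpos ⊢
        rw [sign_pos (by simpa using hpos)]; rfl
      · rw [h] at hpos ⊢
        rw [sign_neg (by simpa using hpos)]; rfl
    linear_combination (iterSign k β *
      (SignType.sign (Matrix.det (Matrix.of fun i j => e i (v j))) : ℤ)) * ho + hs
  · intro v' hv' hne
    rw [if_neg fun h => hne (huniq v' hv' h)]
  · exact fun h => absurd hv h

/-- The chain `{r ≤ t}` obtained from the `k`-fold subdivision. -/
def GeometricCycle.cutChain (Z : GeometricCycle n U X) (r : (U → ℝ) → ℝ) (t : ℝ) (k : ℕ) :
    AffineChain U n := cutMap r t (n + 1) (Z.fundChain k)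

/-- Away from a null set, the multiplicity of the chain `{r ≤ t}` at a point is determined by the
simplex of the subdivision that contains the point. If this simplex crosses the level, only a bound
is needed. -/
lemma ae_multiplicity_cutChain (Z : GeometricCycle n U X) (r : (U → ℝ) → ℝ) (t : ℝ) (k : ℕ)
    {v : Fin (n + 1) → U} (hv : v ∈ simplices Z.V n) :
    ∀ᵐ y ∂(chartVol Z.g v), ∃ β : Fin k → Fin n → Bool,
      y ∈ tile v (iterSimplex k (vertexSimplex v) β) ∧
      ((∀ i, r (iterSimplex k (vertexSimplex v) β i) ≤ t) →
        Z.multiplicity (Z.cutChain r t k) (chart v y) = 1) ∧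
      ((∀ i, t < r (iterSimplex k (vertexSimplex v) β i)) →
        Z.multiplicity (Z.cutChain r t k) (chart v y) = 0) ∧
      (Z.multiplicity (Z.cutChain r t k) (chart v y)).natAbs ≤
        cutCount (n + 1) * (simplices Z.V n).card := by
  have hinj := (strictMono_and_mem_faces hv).1.injective
  refine (chartVol_absolutelyContinuous Z.g v).ae_le ?_
  filter_upwards [ae_sum_indicator_tile hinj k, ae_pos_coord hinj] with y hy hpos
  obtain ⟨β, hβ, hβu⟩ := sum_indicator_eq_one hy
  set x := chart v y with hx
  have hcard : ∀ v' ∈ simplices Z.V n, (Finset.univ.image v').card = n + 1 := fun v' hv' => by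
    rw [Finset.card_image_of_injective _ (strictMono_and_mem_faces hv').1.injective, Finset.card_univ,
      Fintype.card_fin]
  have huniq : ∀ v' ∈ simplices Z.V n, x ∈ closedSimplex (Finset.univ.image v') → v' = v := by
    intro v' hv' h
    have hsub : Finset.univ.image v ⊆ Finset.univ.image v' := by
      intro u hu
      by_contra hu'
      obtain ⟨j, -, rfl⟩ := Finset.mem_image.1 hu
      exact absurd (h.2.2 _ hu') (hpos j).ne'
    have heq := Finset.eq_of_subset_of_card_le hsub (by rw [hcard v hv, hcard v' hv'])
    refine ((strictMono_and_mem_faces hv').1.range_inj (strictMono_and_mem_faces hv).1).1 ?_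
    have := congrArg (fun s : Finset U => (s : Set U)) heq
    simpa using this.symm
  have hzero : ∀ v' ∈ simplices Z.V n, ∀ β' : Fin k → Fin n → Bool, (v' ≠ v ∨ β' ≠ β) →
      Finsupp.linearCombination ℤ (Z.simplexMult x)
        (cut r t (n + 1) (iterSimplex k (vertexSimplex v') β')) = 0 := by
    intro v' hv' β' hne
    refine simplexMult_cut_eq_zero Z r t fun hmem => ?_
    have hv'v : v' = v := by
      refine huniq v' hv' (convexHull_min (range_subset_iff.2 fun i => ?_)
        (convex_closedSimplex _) hmem)
      exact iterSimplex_mem_closedSimplex (strictMono_and_mem_faces hv').1.injective β' i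
    subst hv'v
    exact hne.elim (fun h => h rfl) fun h => h (hβu β' hmem)
  have hmult : Z.multiplicity (Z.cutChain r t k) x = Z.o v * iterSign k β *
      Finsupp.linearCombination ℤ (Z.simplexMult x)
        (cut r t (n + 1) (iterSimplex k (vertexSimplex v) β)) := by
    rw [multiplicity_eq, GeometricCycle.cutChain, GeometricCycle.fundChain]
    simp only [map_sum, map_smul, cutMap_single, smul_eq_mul]
    rw [Finset.sum_eq_single v, Finset.sum_eq_single β]
    · intro β' _ hne
      rw [hzero v hv β' (Or.inr hne), mul_zero]
    · exact fun h => absurd (Finset.mem_univ _) h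
    · intro v' hv' hne
      refine Finset.sum_eq_zero fun β' _ => ?_
      rw [hzero v' hv' β' (Or.inl hne), mul_zero]
    · exact fun h => absurd hv h
  refine ⟨β, hβ, fun hle => ?_, fun hlt => ?_, ?_⟩
  · rw [hmult, cut_of_le hle, Finsupp.linearCombination_single, one_smul]
    exact simplexMult_iterSimplex Z hv β hβ
  · rw [hmult, cut_of_lt hlt, map_zero, mul_zero]
  · rw [hmult, Int.natAbs_mul]
    have h1 : (Z.o v * iterSign k β).natAbs = 1 := by
      rcases Z.orientation.sign v hv with h | h <;> rcases iterSign_eq β with h' | h' <;>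
        simp [h, h']
    rw [h1, one_mul]
    exact natAbs_simplexMult_cut_le Z r t x _

lemma weight_fundChain_le (Z : GeometricCycle n U X) (k : ℕ) (w : (Fin (n + 1) → U → ℝ) → ℝ≥0∞) :
    weight w (Z.fundChain k) ≤ ∑ v ∈ simplices Z.V n, ∑ β : Fin k → Fin n → Bool,
      w (iterSimplex k (vertexSimplex v) β) := by
  refine (weight_sum_le _ _ _).trans (Finset.sum_le_sum fun v hv => ?_)
  refine (weight_sum_le _ _ _).trans (Finset.sum_le_sum fun β _ => ?_)
  rw [weight_smul, weight_single]
  have h1 : (Z.o v * iterSign k β).natAbs = 1 := by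
    rcases Z.orientation.sign v hv with h | h <;> rcases iterSign_eq β with h' | h' <;>
      simp [h, h']
  simp [h1]

lemma isAffineChainIn_cutChain (Z : GeometricCycle n U X) (r : (U → ℝ) → ℝ) (t : ℝ) (k : ℕ) :
    IsAffineChainIn Z.V (Z.cutChain r t k) := by
  classical
  -- the simplices that are not contained in an `n`-simplex of `V` have total mass zero
  let w : (Fin (n + 1) → U → ℝ) → ℝ≥0∞ := fun a =>
    if ∃ v ∈ simplices Z.V n, ∀ i, a i ∈ closedSimplex (Finset.univ.image v) then 0 else 1
  have h0 : weight w (Z.cutChain r t k) = 0 := by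
    refine le_antisymm ?_ bot_le
    refine (weight_linearCombination_le w _ _).trans ((weight_fundChain_le Z k _).trans ?_)
    refine le_of_eq (Finset.sum_eq_zero fun v hv => Finset.sum_eq_zero fun β _ => ?_)
    refine le_antisymm ((weight_cut_le r t _ w 0 fun τ hτ => ?_).trans (by simp)) bot_le
    have hinj := (strictMono_and_mem_faces hv).1.injective
    have : ∃ v ∈ simplices Z.V n, ∀ i, τ i ∈ closedSimplex (Finset.univ.image v) :=
      ⟨v, hv, fun i => convexHull_min (range_subset_iff.2 (iterSimplex_mem_closedSimplex hinj β))
        (convex_closedSimplex _) (hτ i)⟩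
    simp only [w, if_pos this, le_refl]
  intro a ha
  have := weight_eq_zero h0 a ha
  by_contra hne
  simp [w, if_neg hne] at this

variable {W : Type*} [Fintype W] {K : PreAbstractSimplicialComplex W} {h : RiemannianMetric K}

lemma weight_pushChain_le {P : Type*} [AddCommGroup P] [Module ℝ P] (φ : P → W → ℝ) {q : ℕ}
    (w : (stdSimplex ℝ (Fin (q + 1)) → (W → ℝ)) → ℝ≥0∞) (x : VertexChain P (q + 1)) :
    weight w (pushChain φ q x) ≤ weight (fun a => w (singularSimplex φ a)) x := by
  have : pushChain φ q = Finsupp.linearCombination ℤ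
      (fun a => Finsupp.single (singularSimplex φ a) (1 : ℤ)) := by
    refine Finsupp.lhom_ext' fun σ => LinearMap.ext_ring ?_
    simp [pushChain]
  rw [this]
  refine (weight_linearCombination_le _ _ _).trans (weight_mono fun a _ => ?_)
  rw [weight_single]; simp

lemma boundary_push_cutChain {q : ℕ} {Z : GeometricCycle (q + 1) U X} (j : Z.Inclusion h)
    (r : (U → ℝ) → ℝ) (t : ℝ) (k : ℕ) :
    boundary (q + 1) (j.push (Z.cutChain r t k)) =
      pushChain j.toFun q (sliceMap r t (q + 1) (Z.fundChain k)) := by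
  have : j.push (Z.cutChain r t k) = pushChain j.toFun (q + 1) (Z.cutChain r t k) := rfl
  rw [this, boundary_pushChain, GeometricCycle.cutChain, bd_cutMap, bd_fundChain, map_zero, zero_add]

/-- The isoperimetric inequality bounds the filling volume of `∂B` by the volume of the slice. -/
lemma fillVolBoundary_le {m : ℕ} {Z : GeometricCycle (m + 2) U X} (j : Z.Inclusion h) {c : ℝ}
    (hiso : h.IsoperimetricInequality (m + 1) c) (r : (U → ℝ) → ℝ) (t : ℝ) (k : ℕ)
    (hlip : h.IsLipschitzChain (pushChain j.toFun (m + 1) (sliceMap r t (m + 2) (Z.fundChain k))))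
    (B : Set (U → ℝ)) :
    j.fillVolBoundary B ≤ ENNReal.ofReal c * (h.chainVol (pushChain j.toFun (m + 1)
        (sliceMap r t (m + 2) (Z.fundChain k)))) ^ (((m + 1 : ℕ) + 1 : ℝ) / (m + 1 : ℕ)) +
      ∫⁻ x, ENNReal.ofReal |B.indicator (1 : (U → ℝ) → ℝ) x -
        (Z.multiplicity (Z.cutChain r t k) x : ℝ)| ∂(Z.g.vol (m + 2)) := by
  set z := pushChain j.toFun (m + 1) (sliceMap r t (m + 2) (Z.fundChain k)) with hz
  have hbz : boundary (m + 1) z = 0 := by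
    rw [hz, boundary_pushChain]
    have : sliceMap r t (m + 2) (Z.fundChain k) = bd (m + 2) (cutMap r t (m + 3) (Z.fundChain k)) := by
      rw [bd_cutMap, bd_fundChain, map_zero, zero_add]
    rw [this, bd_bd, map_zero]
  refine le_trans ?_ (add_le_add_left (hiso z hlip hbz) _)
  rw [RiemannianMetric.fillVol, ENNReal.iInf_add]
  refine le_iInf fun c' => ?_
  rw [ENNReal.iInf_add]
  refine le_iInf fun ⟨hc1, hc2⟩ => ?_
  refine iInf_le_of_le (Z.cutChain r t k) (iInf_le_of_le c' (iInf_le_of_le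
    ⟨isAffineChainIn_cutChain Z r t k, hc1, ?_⟩ le_rfl))
  rw [boundary_push_cutChain]
  exact hc2

end Fundamental

/-! ### Volume of slices -/

section Gram

/-- Volume is base times height: if the linear form `ℓ` vanishes on `e 1, …, e q` and has norm at
most `Λ`, then the height of `e 0` over their span is at least `|ℓ (e 0)| / Λ`. The proof applies
the bound to the combination whose coefficients are a column of the adjugate Gram matrix. -/
lemma gram_det_mul_sq_le {E : Type*} [AddCommGroup E] [Module ℝ E] (B : LinearMap.BilinForm ℝ E)
    {q : ℕ} (e : Fin (q + 1) → E) (ℓ : E →ₗ[ℝ] ℝ) (h0 : ∀ i : Fin q, ℓ (e i.succ) = 0) {Λ : ℝ}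
    (hΛ : ∀ c : Fin (q + 1) → ℝ,
      ℓ (∑ i, c i • e i) ^ 2 ≤ Λ ^ 2 * B (∑ i, c i • e i) (∑ i, c i • e i))
    (hpos : 0 < Matrix.det (Matrix.of fun i j : Fin q => B (e i.succ) (e j.succ))) :
    Matrix.det (Matrix.of fun i j : Fin q => B (e i.succ) (e j.succ)) * ℓ (e 0) ^ 2 ≤
      Λ ^ 2 * Matrix.det (Matrix.of fun i j : Fin (q + 1) => B (e i) (e j)) := by
  set M : Matrix (Fin (q + 1)) (Fin (q + 1)) ℝ := Matrix.of fun i j => B (e i) (e j) with hM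
  set D := Matrix.det (Matrix.of fun i j : Fin q => B (e i.succ) (e j.succ)) with hD
  set c : Fin (q + 1) → ℝ := fun i => M.adjugate i 0 with hc
  have hc0 : c 0 = D := by
    rw [hc]
    simp only
    rw [Matrix.adjugate_fin_succ_eq_det_submatrix]
    simp only [Fin.val_zero, add_zero, pow_zero, one_mul]
    rfl
  have hℓ : ℓ (∑ i, c i • e i) = D * ℓ (e 0) := by
    rw [Fin.sum_univ_succ, map_add, map_sum, map_smul, Finset.sum_eq_zero, hc0, smul_eq_mul,
      add_zero]
    intro i _
    rw [map_smul, h0, smul_zero]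
  have hB : B (∑ i, c i • e i) (∑ i, c i • e i) = D * M.det := by
    rw [bilin_sum_sum]
    have h1 : ∀ i, ∑ j, c i * c j * B (e i) (e j) = c i * (M * M.adjugate) i 0 := by
      intro i
      rw [Matrix.mul_apply, Finset.mul_sum]
      exact Finset.sum_congr rfl fun j _ => by simp only [hc, hM, Matrix.of_apply]; ring
    rw [Finset.sum_congr rfl fun i _ => h1 i, Matrix.mul_adjugate, Fin.sum_univ_succ,
      Finset.sum_eq_zero, hc0]
    · simp
    · intro i _
      simp
  have := hΛ c
  rw [hℓ, hB] at this
  have h2 : D * (D * ℓ (e 0) ^ 2) ≤ D * (Λ ^ 2 * M.det) := by nlinarith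
  exact le_of_mul_le_mul_left h2 hpos

variable {U : Type*} [Fintype U] [LinearOrder U] {K : PreAbstractSimplicialComplex U}
  (g : RiemannianMetric K) {q : ℕ} {v : Fin (q + 2) → U} (hv : v ∈ simplices K (q + 1))

include hv

/-- An affine simplex `τ` in a hyperplane section `{ℓ = t}` of the simplex `σ`: its Gram determinant
is controlled by the volume of `σ` and the distance of a vertex of `σ` to the hyperplane. -/
lemma sqrt_gram_mul_abs_le {y : Fin (q + 1) → ℝ} (hy : y ∈ corner (q + 1))
    {σ : Fin (q + 2) → U → ℝ} (hσ : ∀ i, σ i ∈ closedSimplex (Finset.univ.image v))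
    {τ : Fin (q + 1) → U → ℝ} (hτ : ∀ i, τ i ∈ convexHull ℝ (range σ))
    (ℓ : (U → ℝ) →ₗ[ℝ] ℝ) {t : ℝ} (hτt : ∀ i, ℓ (τ i) = t) {Λ : ℝ} (hΛ0 : 0 ≤ Λ)
    (hΛ : ∀ u, |ℓ (chartLift v u)| ≤ Λ * √(chartForm g v y u)) (a : Fin (q + 2)) :
    √(Matrix.det (Matrix.of fun i j : Fin q =>
      g.form (Finset.univ.image v) (chart v y) (τ i.succ - τ 0) (τ j.succ - τ 0))) * |ℓ (σ a) - t| ≤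
      Λ * |homogDet v σ| * √(chartGram g v y).det := by
  set s := Finset.univ.image v with hs
  set B := g.form s (chart v y) with hB
  set D := Matrix.det (Matrix.of fun i j : Fin q => B (τ i.succ - τ 0) (τ j.succ - τ 0)) with hD
  have hinj := (strictMono_and_mem_faces hv).1.injective
  rcases le_or_gt D 0 with hD0 | hD0
  · rw [Real.sqrt_eq_zero_of_nonpos hD0, zero_mul]; positivity
  have hτs : ∀ i, τ i ∈ closedSimplex s := fun i =>
    convexHull_min (range_subset_iff.2 hσ) (convex_closedSimplex _) (hτ i)
  -- the cone from the vertex `σ a` over `τ`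
  let F : Fin (q + 2) → U → ℝ := Fin.cons (τ 0) (Fin.cons (σ a) (Fin.tail τ))
  let e : Fin (q + 1) → U → ℝ := fun i => F i.succ - F 0
  have hFs : ∀ i, F i ∈ closedSimplex s := by
    intro i
    refine Fin.cases (hτs 0) (fun i => ?_) i
    exact Fin.cases (hσ a) (fun i => hτs _) i
  have hFσ : ∀ i, F i ∈ convexHull ℝ (range σ) := by
    intro i
    refine Fin.cases (hτ 0) (fun i => ?_) i
    exact Fin.cases (subset_convexHull ℝ _ (mem_range_self a)) (fun i => hτ _) i
  have het : ∀ i, e i ∈ tangent s := fun i => sub_mem_tangent (hFs _) (hFs _)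
  have hesucc : ∀ i : Fin q, e i.succ = τ i.succ - τ 0 := fun i => rfl
  have he0 : e 0 = σ a - τ 0 := rfl
  have hlift : ∀ i, chartLift v (unchart v (e i)) = e i := fun i => chartLift_unchart hinj (het i)
  have key := gram_det_mul_sq_le B e ℓ (Λ := Λ) (fun i => by rw [hesucc, map_sub, hτt, hτt, sub_self])
    (fun c => by
      set u := ∑ i, c i • unchart v (e i) with hu
      have hcu : ∑ i, c i • e i = chartLift v u := by
        rw [hu, map_sum]
        exact Finset.sum_congr rfl fun i _ => by rw [map_smul, hlift]
      have hQ : 0 ≤ chartForm g v y u := by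
        rcases eq_or_ne u 0 with h | h
        · simp [h, chartForm]
        · exact (chartForm_pos g hv hy h).le
      have h1 := hΛ u
      rw [hcu]
      calc ℓ (chartLift v u) ^ 2 = |ℓ (chartLift v u)| ^ 2 := (sq_abs _).symm
        _ ≤ (Λ * √(chartForm g v y u)) ^ 2 := by gcongr
        _ = Λ ^ 2 * B (chartLift v u) (chartLift v u) := by
            rw [mul_pow, Real.sq_sqrt hQ]; rfl)
    (by simpa only [hesucc] using hD0)
  have hDe : Matrix.det (Matrix.of fun i j : Fin q => B (e i.succ) (e j.succ)) = D := by
    simp only [hesucc]; rfl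
  have hdet : Matrix.det (Matrix.of fun i j : Fin (q + 1) => B (e i) (e j)) =
      homogDet v F ^ 2 * (chartGram g v y).det := by
    set X : Matrix (Fin (q + 1)) (Fin (q + 1)) ℝ := Matrix.of fun i => unchart v (e i) with hX
    have hprod : (Matrix.of fun i j : Fin (q + 1) => B (e i) (e j)) =
        X * chartGram g v y * X.transpose := by
      ext i j
      rw [Matrix.of_apply, ← hlift i, ← hlift j, chartLift_apply, chartLift_apply, bilin_sum_sum,
        Matrix.mul_apply, Finset.sum_comm]
      refine Finset.sum_congr rfl fun l _ => ?_
      rw [Matrix.mul_apply, Finset.sum_mul]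
      refine Finset.sum_congr rfl fun k _ => ?_
      rw [Matrix.transpose_apply]
      simp only [hX, hB, chartGram, Matrix.of_apply]
      ring
    rw [hprod, Matrix.det_mul, Matrix.det_mul, Matrix.det_transpose,
      homogDet_eq_det_edges v F fun i => (hFs i).2.1]
    ring
  rw [hDe, he0, map_sub, hτt, hdet] at key
  have hFle := abs_homogDet_le v σ F hFσ
  have hG := (chartGram_det_pos g hv hy).le
  have h2 : D * (ℓ (σ a) - t) ^ 2 ≤ (Λ * |homogDet v σ|) ^ 2 * (chartGram g v y).det := by
    refine key.trans ?_
    rw [mul_pow, mul_assoc]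
    exact mul_le_mul_of_nonneg_left (mul_le_mul_of_nonneg_right
      (sq_le_sq' (by linarith [neg_abs_le (homogDet v F)]) ((le_abs_self _).trans hFle)) hG)
      (sq_nonneg Λ)
  calc √D * |ℓ (σ a) - t| = √(D * (ℓ (σ a) - t) ^ 2) := by
        rw [Real.sqrt_mul hD0.le, Real.sqrt_sq_eq_abs]
    _ ≤ √((Λ * |homogDet v σ|) ^ 2 * (chartGram g v y).det) := Real.sqrt_le_sqrt h2
    _ = _ := by rw [Real.sqrt_mul (sq_nonneg _), Real.sqrt_sq (by positivity)]

end Gram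

section SliceVolume

/-- Minimum of the vertex values. -/
def vertexMin {P : Type*} (r : P → ℝ) {q : ℕ} (σ : Fin (q + 1) → P) : ℝ :=
  Finset.univ.inf' Finset.univ_nonempty fun i => r (σ i)

/-- Maximum of the vertex values. -/
def vertexMax {P : Type*} (r : P → ℝ) {q : ℕ} (σ : Fin (q + 1) → P) : ℝ :=
  Finset.univ.sup' Finset.univ_nonempty fun i => r (σ i)

lemma crosses_iff {P : Type*} (r : P → ℝ) (t : ℝ) {q : ℕ} (σ : Fin (q + 1) → P) :
    Crosses r t σ ↔ t ∈ Ico (vertexMin r σ) (vertexMax r σ) := by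
  have h1 : vertexMin r σ ≤ t ↔ ∃ i, r (σ i) ≤ t :=
    (Finset.inf'_le_iff _).trans (by simp)
  have h2 : t < vertexMax r σ ↔ ∃ i, t < r (σ i) :=
    (Finset.lt_sup'_iff _).trans (by simp)
  rw [Crosses, mem_Ico, h1, h2]

lemma exists_vertex_far {P : Type*} (r : P → ℝ) (t : ℝ) {q : ℕ} (σ : Fin (q + 1) → P) :
    ∃ a, (vertexMax r σ - vertexMin r σ) / 2 ≤ |r (σ a) - t| := by
  obtain ⟨i, -, hi⟩ := Finset.exists_mem_eq_inf' Finset.univ_nonempty fun i => r (σ i)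
  obtain ⟨j, -, hj⟩ := Finset.exists_mem_eq_sup' Finset.univ_nonempty fun i => r (σ i)
  rw [vertexMin, vertexMax, hi, hj]
  rcases le_total t ((r (σ i) + r (σ j)) / 2) with h | h
  · exact ⟨j, le_trans (by linarith) (le_abs_self _)⟩
  · exact ⟨i, le_trans (by linarith) (neg_abs_le _ |> neg_le.1 |> fun h => h)⟩

variable {q : ℕ} {U : Type*} [Fintype U] [LinearOrder U] {X : Type*}
  [TopologicalSpace X] {Z : GeometricCycle (q + 1) U X} {W : Type*} [Fintype W]
  {K : PreAbstractSimplicialComplex W} {h : RiemannianMetric K}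

/-- The metric and its volume density vary by at most a factor `2` on the part `S` of the chart. -/
def NearlyConstantOn {K : PreAbstractSimplicialComplex U} (g : RiemannianMetric K) {n : ℕ}
    (v : Fin (n + 1) → U) (S : Set (Fin n → ℝ)) : Prop :=
  ∀ y ∈ S, ∀ y' ∈ S, (∀ u, chartForm g v y u ≤ 2 * chartForm g v y' u) ∧
    √(chartGram g v y).det ≤ 2 * √(chartGram g v y').det

/-- The constant in the bound for the volume of a slice. -/
def sliceConst (q : ℕ) : ℝ≥0∞ :=
  (q + 2).factorial * (ENNReal.ofReal (4 * √(2 ^ q)) / volume (corner (q + 1)))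

lemma sliceConst_ne_top (q : ℕ) : sliceConst q ≠ ⊤ :=
  ENNReal.mul_ne_top (ENNReal.natCast_ne_top _)
    (ENNReal.div_ne_top ENNReal.ofReal_ne_top (volume_corner_pos _).ne')

lemma le_chartVol_tile (g : RiemannianMetric Z.V) {v : Fin (q + 2) → U}
    (hv : v ∈ simplices Z.V (q + 1)) {σ : Fin (q + 2) → U → ℝ}
    (hσ : ∀ i, σ i ∈ closedSimplex (Finset.univ.image v)) (hnc : NearlyConstantOn g v (tile v σ))
    {y : Fin (q + 1) → ℝ} (hy : y ∈ tile v σ) :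
    ENNReal.ofReal (√(chartGram g v y).det / 2 * |homogDet v σ|) * volume (corner (q + 1)) ≤
      chartVol g v (tile v σ) := by
  have hinj := (strictMono_and_mem_faces hv).1.injective
  rw [chartVol_apply g v (measurableSet_tile σ) (tile_subset_corner hinj hσ),
    ENNReal.ofReal_mul (by positivity), mul_assoc, ← volume_tile hinj hσ, ← setLIntegral_const]
  refine setLIntegral_mono' (measurableSet_tile σ) fun y' hy' => ?_
  rw [density_eq]
  refine ENNReal.ofReal_le_ofReal ?_
  have := (hnc y hy y' hy').2
  linarith

/-- A simplex contained in the slice of `σ` is Lipschitz, and its volume is at most a constant times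
`Λ vol σ / osc σ`, where `Λ` bounds the slope of the interpolation `ℓ`. -/
lemma simplexVol_level_le (j : Z.Inclusion h) {v : Fin (q + 2) → U}
    (hv : v ∈ simplices Z.V (q + 1)) {σ : Fin (q + 2) → U → ℝ}
    (hσ : ∀ i, σ i ∈ closedSimplex (Finset.univ.image v)) (hnc : NearlyConstantOn Z.g v (tile v σ))
    (r : (U → ℝ) → ℝ) (ℓ : (U → ℝ) →ₗ[ℝ] ℝ) (hℓ : ∀ i, ℓ (σ i) = r (σ i)) {Λ : ℝ} (hΛ0 : 0 ≤ Λ)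
    {y : Fin (q + 1) → ℝ} (hy : y ∈ tile v σ)
    (hΛ : ∀ u, |ℓ (chartLift v u)| ≤ Λ * √(chartForm Z.g v y u)) {t : ℝ}
    (ht : t ∈ Ico (vertexMin r σ) (vertexMax r σ))
    {τ : Fin (q + 1) → U → ℝ} (hτ : ∀ i, τ i ∈ levelSet r t σ) :
    h.IsLipschitzSimplex (singularSimplex j.toFun τ) ∧
    h.simplexVol (singularSimplex j.toFun τ) ≤
      ENNReal.ofReal (4 * √(2 ^ q)) / volume (corner (q + 1)) *
        (ENNReal.ofReal Λ * chartVol Z.g v (tile v σ) /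
          ENNReal.ofReal (vertexMax r σ - vertexMin r σ)) := by
  have hinj := (strictMono_and_mem_faces hv).1.injective
  have hface := (strictMono_and_mem_faces hv).2
  have hyc := tile_subset_corner hinj hσ hy
  have hτσ : ∀ i, τ i ∈ convexHull ℝ (range σ) := fun i =>
    levelSet_subset_convexHull r t σ (hτ i)
  have hτs : ∀ i, τ i ∈ closedSimplex (Finset.univ.image v) := fun i =>
    convexHull_min (range_subset_iff.2 hσ) (convex_closedSimplex _) (hτσ i)
  have hτt : ∀ i, ℓ (τ i) = t := by
    intro i
    obtain ⟨w, hw, h1, h2⟩ := hτ i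
    rw [← h2, map_sum, ← h1]
    exact Finset.sum_congr rfl fun k _ => by rw [map_smul, hℓ, smul_eq_mul]
  have hcmp : ∀ x ∈ convexHull ℝ (range τ), ∀ u ∈ tangent (Finset.univ.image v),
      Z.g.form (Finset.univ.image v) x u u ≤
        2 * Z.g.form (Finset.univ.image v) (chart v y) u u := by
    intro x hx u hu
    have hxσ : x ∈ convexHull ℝ (range σ) :=
      convexHull_min (range_subset_iff.2 hτσ) (convex_convexHull ℝ _) hx
    have hxs : x ∈ closedSimplex (Finset.univ.image v) :=
      convexHull_min (range_subset_iff.2 hσ) (convex_closedSimplex _) hxσ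
    have hxt : unchart v x ∈ tile v σ := by
      rw [tile, mem_preimage, chart_unchart hinj hxs]; exact hxσ
    have := (hnc _ hxt _ hy).1 (unchart v u)
    simpa only [chartForm, chart_unchart hinj hxs, chartLift_unchart hinj hu] using this
  refine ⟨isLipschitzSimplex_singularSimplex j hface hτs hcmp, ?_⟩
  have hvol := simplexVol_singularSimplex_le j hface hτs
    (B := Z.g.form (Finset.univ.image v) (chart v y))
    (fun u hu w hw => Z.g.symm _ hface _ (chart_mem_closedSimplex hyc) u hu w hw)
    (fun u hu => by
      rcases eq_or_ne u 0 with h | h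
      · simp [h]
      · exact (Z.g.pos _ hface _ (chart_mem_closedSimplex hyc) u hu h).le) hcmp
  refine hvol.trans ?_
  obtain ⟨a, ha⟩ := exists_vertex_far r t σ
  have hkey := sqrt_gram_mul_abs_le Z.g hv hyc hσ hτσ ℓ hτt hΛ0 hΛ a
  rw [hℓ] at hkey
  set osc := vertexMax r σ - vertexMin r σ with hosc
  have hosc0 : 0 < osc := sub_pos.2 (ht.1.trans_lt ht.2)
  set d := Matrix.det (Matrix.of fun i j : Fin q =>
      Z.g.form (Finset.univ.image v) (chart v y) (τ i.succ - τ 0) (τ j.succ - τ 0)) with hd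
  have h3 : √(2 ^ q * d) ≤ 4 * √(2 ^ q) *
      (Λ * (√(chartGram Z.g v y).det / 2 * |homogDet v σ|) / osc) := by
    rw [Real.sqrt_mul (by positivity), mul_comm 4, mul_assoc]
    gcongr
    rw [← mul_div_assoc, le_div_iff₀ hosc0]
    have h4 : √d * (osc / 2) ≤ √d * |r (σ a) - t| := by gcongr
    nlinarith
  have hκ0 := (volume_corner_pos (q + 1)).ne'
  have hκt : volume (corner (q + 1)) ≠ ⊤ :=
    ((volume_corner_le_one (q + 1)).trans_lt ENNReal.one_lt_top).ne
  refine (ENNReal.ofReal_le_ofReal h3).trans ?_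
  rw [ENNReal.ofReal_mul (by positivity), ENNReal.ofReal_div_of_pos hosc0,
    ENNReal.ofReal_mul hΛ0]
  have h5 := le_chartVol_tile Z.g hv hσ hnc hy
  have h6 : ENNReal.ofReal (√(chartGram Z.g v y).det / 2 * |homogDet v σ|) ≤
      chartVol Z.g v (tile v σ) / volume (corner (q + 1)) := by
    rwa [ENNReal.le_div_iff_mul_le (Or.inl hκ0) (Or.inl hκt)]
  calc _ ≤ ENNReal.ofReal (4 * √(2 ^ q)) * (ENNReal.ofReal Λ *
        (chartVol Z.g v (tile v σ) / volume (corner (q + 1))) / ENNReal.ofReal osc) := by gcongr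
    _ = _ := by simp only [div_eq_mul_inv]; ring

/-- The upper bound, up to the factor `sliceConst`, for the volume of the slice of `σ`, as a function
of the level; it vanishes at the levels that `σ` does not cross. -/
def sliceBound {n : ℕ} {K : PreAbstractSimplicialComplex U} (g : RiemannianMetric K)
    (r : (U → ℝ) → ℝ) (v : Fin (n + 1) → U) (σ : Fin (n + 1) → U → ℝ) (Λ : ℝ) : ℝ → ℝ≥0∞ :=
  (Ico (vertexMin r σ) (vertexMax r σ)).indicator fun _ =>
    ENNReal.ofReal Λ * chartVol g v (tile v σ) / ENNReal.ofReal (vertexMax r σ - vertexMin r σ)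

lemma measurable_sliceBound {n : ℕ} {K : PreAbstractSimplicialComplex U} (g : RiemannianMetric K)
    (r : (U → ℝ) → ℝ) (v : Fin (n + 1) → U) (σ : Fin (n + 1) → U → ℝ) (Λ : ℝ) :
    Measurable (sliceBound g r v σ Λ) := measurable_const.indicator measurableSet_Ico

/-- Coarea inequality for one simplex. -/
lemma lintegral_sliceBound_le {n : ℕ} {K : PreAbstractSimplicialComplex U}
    (g : RiemannianMetric K) (r : (U → ℝ) → ℝ) (v : Fin (n + 1) → U) (σ : Fin (n + 1) → U → ℝ)
    (Λ : ℝ) : ∫⁻ t, sliceBound g r v σ Λ t ≤ ENNReal.ofReal Λ * chartVol g v (tile v σ) := by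
  rw [sliceBound, lintegral_indicator measurableSet_Ico, setLIntegral_const, Real.volume_Ico]
  rw [mul_comm]
  exact ENNReal.mul_div_le

lemma weight_slice_le_sliceBound (j : Z.Inclusion h) {v : Fin (q + 2) → U}
    (hv : v ∈ simplices Z.V (q + 1)) {σ : Fin (q + 2) → U → ℝ}
    (hσ : ∀ i, σ i ∈ closedSimplex (Finset.univ.image v)) (hnc : NearlyConstantOn Z.g v (tile v σ))
    (r : (U → ℝ) → ℝ) (ℓ : (U → ℝ) →ₗ[ℝ] ℝ) (hℓ : ∀ i, ℓ (σ i) = r (σ i)) {Λ : ℝ} (hΛ0 : 0 ≤ Λ)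
    {y : Fin (q + 1) → ℝ} (hy : y ∈ tile v σ)
    (hΛ : ∀ u, |ℓ (chartLift v u)| ≤ Λ * √(chartForm Z.g v y u)) (t : ℝ) :
    weight (fun τ => h.simplexVol (singularSimplex j.toFun τ)) (slice r t (q + 1) σ) ≤
      sliceConst q * sliceBound Z.g r v σ Λ t := by
  by_cases ht : t ∈ Ico (vertexMin r σ) (vertexMax r σ)
  · rw [sliceBound, indicator_of_mem ht, sliceConst, mul_assoc]
    exact weight_slice_le r t σ _ _ fun τ hτ =>
      (simplexVol_level_le j hv hσ hnc r ℓ hℓ hΛ0 hy hΛ ht hτ).2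
  · rw [← crosses_iff] at ht
    rw [slice_eq_zero_of_not_crosses ht]
    simp

end SliceVolume

/-! ### The truncated distance function -/

section TruncDist

variable {U : Type*} [Fintype U] [LinearOrder U] {K : PreAbstractSimplicialComplex U}
  (g : RiemannianMetric K)

/-- The distance to `x₀`, truncated at `M` so that it is finite everywhere. -/
def truncDist (x₀ : U → ℝ) (M : ℝ) (x : U → ℝ) : ℝ :=
  (min (g.dist x₀ x) (ENNReal.ofReal M)).toReal

lemma truncDist_le_iff (x₀ x : U → ℝ) {M t : ℝ} (ht0 : 0 ≤ t) (ht : t < M) :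
    truncDist g x₀ M x ≤ t ↔ g.dist x₀ x ≤ ENNReal.ofReal t := by
  rw [truncDist, ← ENNReal.le_ofReal_iff_toReal_le
    (ne_top_of_le_ne_top ENNReal.ofReal_ne_top (min_le_right _ _)) ht0, min_le_iff]
  have : ¬ ENNReal.ofReal M ≤ ENNReal.ofReal t := by
    rw [ENNReal.ofReal_le_ofReal_iff ht0]; exact not_le.2 ht
  simp [this]

lemma truncDist_le_add (x₀ : U → ℝ) (M : ℝ) {x y : U → ℝ} {b : ℝ} (hb : 0 ≤ b)
    (h : g.simplexDist x y ≤ ENNReal.ofReal b) :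
    truncDist g x₀ M y ≤ truncDist g x₀ M x + b := by
  have h0 : 0 ≤ truncDist g x₀ M x := ENNReal.toReal_nonneg
  refine ENNReal.toReal_le_of_le_ofReal (by positivity) ?_
  rw [ENNReal.ofReal_add h0 hb, truncDist, ENNReal.ofReal_toReal
    (ne_top_of_le_ne_top ENNReal.ofReal_ne_top (min_le_right _ _))]
  rcases le_total (g.dist x₀ x) (ENNReal.ofReal M) with h1 | h1
  · rw [min_eq_left h1]
    exact (min_le_left _ _).trans ((g.dist_le_dist_add x₀ x y).trans (by gcongr))
  · rw [min_eq_right h1]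
    exact (min_le_right _ _).trans le_self_add

variable {q : ℕ} {v : Fin (q + 1) → U} (hv : v ∈ simplices K q)

include hv

lemma abs_truncDist_chart_sub_le (x₀ : U → ℝ) (M : ℝ) {y y' : Fin q → ℝ} (hy : y ∈ corner q)
    (hy' : y' ∈ corner q) {b : ℝ} (hb : 0 ≤ b)
    (h : ∀ z ∈ segment ℝ y y', chartForm g v z (y' - y) ≤ b ^ 2) :
    |truncDist g x₀ M (chart v y') - truncDist g x₀ M (chart v y)| ≤ b := by
  have hinj := (strictMono_and_mem_faces hv).1.injective
  have key : ∀ y ∈ corner q, ∀ y' ∈ corner q,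
      (∀ z ∈ segment ℝ y y', chartForm g v z (y' - y) ≤ b ^ 2) →
      truncDist g x₀ M (chart v y') ≤ truncDist g x₀ M (chart v y) + b := by
    intro y hy y' hy' h
    refine truncDist_le_add g x₀ M hb (g.simplexDist_le (strictMono_and_mem_faces hv).2
      (chart_mem_closedSimplex hy) (chart_mem_closedSimplex hy') hb fun z hz => ?_)
    have hzs := (convex_closedSimplex _).segment_subset (chart_mem_closedSimplex hy)
      (chart_mem_closedSimplex hy') hz
    have hz' : unchart v z ∈ segment ℝ y y' := by
      obtain ⟨a, b, ha, hb, hab, rfl⟩ := hz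
      exact ⟨a, b, ha, hb, hab, by simp only [map_add, map_smul, unchart_chart hinj]⟩
    have := h _ hz'
    rwa [chartForm, chart_unchart hinj hzs, ← chart_sub] at this
  rw [abs_sub_le_iff]
  constructor
  · linarith [key y hy y' hy' h]
  · have := key y' hy' y hy fun z hz => by
      rw [segment_symm] at hz
      rw [show y - y' = (-1 : ℝ) • (y' - y) by simp, chartForm_smul]
      simpa using h z hz
    linarith

lemma exists_truncDist_lipschitz (x₀ : U → ℝ) (M : ℝ) : ∃ Λ > 0, ∀ y ∈ corner q, ∀ y' ∈ corner q,
    |truncDist g x₀ M (chart v y') - truncDist g x₀ M (chart v y)| ≤ Λ * ‖y' - y‖ := by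
  obtain ⟨-, -, Λ, hΛ, -, -, -, h, -⟩ := exists_metric_bounds g hv
  refine ⟨Λ, hΛ, fun y hy y' hy' => ?_⟩
  refine abs_truncDist_chart_sub_le g hv x₀ M hy hy' (by positivity) fun z hz => ?_
  rw [mul_pow]
  exact h z ((convex_corner q).segment_subset hy hy' hz) _

/-- Where the distance function is differentiable, its slope with respect to the metric is bounded.
(The optimal bound is `1`.) -/
lemma abs_fderiv_truncDist_le (x₀ : U → ℝ) (M : ℝ) {y : Fin q → ℝ} (hy : y ∈ interior (corner q))
    {L : (Fin q → ℝ) →L[ℝ] ℝ} (hL : HasFDerivAt (fun y => truncDist g x₀ M (chart v y)) L y)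
    (u : Fin q → ℝ) : |L u| ≤ 2 * √(chartForm g v y u) := by
  obtain ⟨-, -, -, -, δ, hδ, -, -, -, hnc⟩ := exists_metric_bounds g hv
  have hyc := interior_subset hy
  have hQ : 0 ≤ chartForm g v y u := by
    rcases eq_or_ne u 0 with h | h
    · simp [h, chartForm]
    · exact (chartForm_pos g hv hyc h).le
  have hcont : Continuous fun s : ℝ => y + s • u := by fun_prop
  have hball : ∀ᶠ s : ℝ in nhds 0, y + s • u ∈ interior (corner q) ∩ Metric.ball y δ := by
    refine hcont.continuousAt.eventually_mem ?_
    simpa using Filter.inter_mem (isOpen_interior.mem_nhds hy) (Metric.ball_mem_nhds y hδ)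
  have hline : HasDerivAt (fun s : ℝ => truncDist g x₀ M (chart v (y + s • u))) (L u) 0 := by
    have h1 : HasDerivAt (fun s : ℝ => y + s • u) u 0 := by
      simpa using ((hasDerivAt_id (0 : ℝ)).smul_const u).const_add y
    have h2 : HasFDerivAt (fun y => truncDist g x₀ M (chart v y)) L (y + (0 : ℝ) • u) := by
      simpa using hL
    exact h2.comp_hasDerivAt 0 h1
  refine hline.le_of_lip' (by positivity) ?_
  filter_upwards [hball] with s hs
  have hb : 0 ≤ 2 * √(chartForm g v y u) * ‖s - 0‖ := by positivity
  simp only [zero_smul, add_zero]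
  refine abs_truncDist_chart_sub_le g hv x₀ M hyc (interior_subset hs.1) hb fun z hz => ?_
  have hz1 := (convex_corner q).segment_subset hyc (interior_subset hs.1) hz
  have hz2 := (convex_ball y δ).segment_subset (Metric.mem_ball_self hδ) hs.2 hz
  have h3 := (hnc z hz1 y hyc hz2).1 (y + s • u - y)
  rw [add_sub_cancel_left, chartForm_smul, chartForm_smul] at h3
  rw [add_sub_cancel_left, chartForm_smul, mul_pow, mul_pow, Real.sq_sqrt hQ, sub_zero,
    Real.norm_eq_abs, sq_abs]
  nlinarith [mul_nonneg (sq_nonneg s) hQ]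

end TruncDist

/-! ### Slopes of the piecewise linear interpolations -/

section Slopes

variable {U : Type*} [Fintype U] [LinearOrder U] {q : ℕ} {v : Fin (q + 1) → U}

lemma norm_sub_le_of_steps {E : Type*} [SeminormedAddCommGroup E] (f : Fin (q + 1) → E) {d : ℝ}
    (h : ∀ j : Fin q, ‖f j.succ - f j.castSucc‖ ≤ d) (i : Fin (q + 1)) :
    ‖f i - f 0‖ ≤ (i : ℕ) * d := by
  induction i using Fin.induction with
  | zero => simp
  | succ j ih =>
    calc ‖f j.succ - f 0‖ = ‖(f j.succ - f j.castSucc) + (f j.castSucc - f 0)‖ := by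
          rw [sub_add_sub_cancel]
      _ ≤ d + (j : ℕ) * d := (norm_add_le _ _).trans (add_le_add (h j) ih)
      _ = _ := by push_cast [Fin.val_succ]; ring

lemma norm_unchart_step_le {k : ℕ} (β : Fin k → Fin q → Bool) (j : Fin q) :
    ‖unchart v (iterSimplex k (vertexSimplex v) β j.succ) -
      unchart v (iterSimplex k (vertexSimplex v) β j.castSucc)‖ ≤ (2⁻¹ : ℝ) ^ k := by
  rw [← map_sub]
  obtain ⟨i, hi⟩ := (stepsScaled_iterSimplex (vertexSimplex v) β).2 j
  have h1 : ‖unchart v (vertexSimplex v i.succ - vertexSimplex v i.castSucc)‖ ≤ 1 := by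
    refine (pi_norm_le_iff_of_nonneg zero_le_one).2 fun m => ?_
    simp only [unchart_apply, Pi.sub_apply, vertexSimplex, Pi.single_apply]
    split_ifs <;> norm_num
  have h2 : ‖unchart v ((2⁻¹ : ℝ) ^ k • (vertexSimplex v i.succ - vertexSimplex v i.castSucc))‖ ≤
      (2⁻¹ : ℝ) ^ k := by
    rw [map_smul, norm_smul, Real.norm_of_nonneg (by positivity)]
    exact mul_le_of_le_one_right (by positivity) h1
  rcases hi with hi | hi
  · rwa [hi]
  · rwa [hi, map_neg, norm_neg]

/-- The simplices of the `k`-fold subdivision have diameter `O(2⁻ᵏ)` in the charts. -/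
lemma dist_le_of_mem_tile (hv : Function.Injective v) {k : ℕ} (β : Fin k → Fin q → Bool)
    {y y' : Fin q → ℝ} (hy : y ∈ tile v (iterSimplex k (vertexSimplex v) β))
    (hy' : y' ∈ tile v (iterSimplex k (vertexSimplex v) β)) :
    dist y y' ≤ 2 * q * (2⁻¹ : ℝ) ^ k := by
  set e := iterSimplex k (vertexSimplex v) β with he
  have hvert : ∀ i, dist (unchart v (e i)) (unchart v (e 0)) ≤ q * (2⁻¹ : ℝ) ^ k := fun i => by
    rw [dist_eq_norm]
    refine (norm_sub_le_of_steps (fun i => unchart v (e i)) (norm_unchart_step_le β) i).trans ?_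
    gcongr
    exact Fin.is_le i
  have hmem : ∀ y ∈ tile v e, y ∈ convexHull ℝ (range fun i => unchart v (e i)) := fun y hy =>
    mem_convexHull_range_iff.2 ((mem_tile_iff hv (iterSimplex_mem_closedSimplex hv β) y).1 hy)
  obtain ⟨_, ⟨i, rfl⟩, _, ⟨j, rfl⟩, h⟩ := convexHull_exists_dist_ge2 (hmem y hy) (hmem y' hy')
  refine h.trans ((dist_triangle_right _ _ (unchart v (e 0))).trans ?_)
  linarith [hvert i, hvert j]

lemma unchart_iterSimplex_mem_tile (hv : Function.Injective v) {k : ℕ} (β : Fin k → Fin q → Bool)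
    (i : Fin (q + 1)) : unchart v (iterSimplex k (vertexSimplex v) β i) ∈
      tile v (iterSimplex k (vertexSimplex v) β) := by
  rw [tile, mem_preimage, chart_unchart hv (iterSimplex_mem_closedSimplex hv β i)]
  exact subset_convexHull ℝ _ (mem_range_self i)

lemma exists_linear_interpolation (hv : Function.Injective v) {k : ℕ} (β : Fin k → Fin q → Bool)
    (r : (U → ℝ) → ℝ) : ∃ ℓ : (U → ℝ) →ₗ[ℝ] ℝ, ∀ i,
      ℓ (iterSimplex k (vertexSimplex v) β i) = r (iterSimplex k (vertexSimplex v) β i) := by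
  set e := iterSimplex k (vertexSimplex v) β with he
  have hli : LinearIndependent ℝ e := by
    by_contra h
    have h1 := abs_homogDet_iterSimplex hv β
    rw [← he, AlternatingMap.map_linearDependent _ _ h, abs_zero] at h1
    exact absurd h1 (by positivity)
  obtain ⟨p, hp⟩ := (Fintype.linearCombination ℝ e).exists_leftInverse_of_injective
    (LinearMap.ker_eq_bot.2 (linearIndependent_iff_injective_fintypeLinearCombination.1 hli))
  refine ⟨(Fintype.linearCombination ℝ fun i => r (e i)).comp p, fun i => ?_⟩
  have h2 : Fintype.linearCombination ℝ e (Pi.single i 1) = e i := by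
    rw [Fintype.linearCombination_apply_single, one_smul]
  have h3 := LinearMap.congr_fun hp (Pi.single i 1)
  rw [LinearMap.comp_apply, h2, LinearMap.id_apply] at h3
  rw [LinearMap.comp_apply, h3, Fintype.linearCombination_apply_single, one_smul]

/-- Every edge direction of the standard simplex occurs, scaled by `2⁻ᵏ`, among the edges of a
simplex of the subdivision. So two linear forms that are close on the latter edges are close. -/
lemma abs_sub_le_of_edges (hv : Function.Injective v) {k : ℕ} (β : Fin k → Fin q → Bool)
    (ℓ : (U → ℝ) →ₗ[ℝ] ℝ) (L : (Fin q → ℝ) →ₗ[ℝ] ℝ) {η : ℝ}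
    (h : ∀ j : Fin q, |ℓ (iterSimplex k (vertexSimplex v) β j.succ -
        iterSimplex k (vertexSimplex v) β j.castSucc) -
      L (unchart v (iterSimplex k (vertexSimplex v) β j.succ -
        iterSimplex k (vertexSimplex v) β j.castSucc))| ≤ η * (2⁻¹ : ℝ) ^ k)
    (u : Fin q → ℝ) : |ℓ (chartLift v u) - L u| ≤ q * (q * η) * ‖u‖ := by
  set Φ : (U → ℝ) →ₗ[ℝ] ℝ := ℓ - L.comp (unchart v) with hΦ
  have hpow : (0 : ℝ) < 2⁻¹ ^ k := by positivity
  have hstep : ∀ i : Fin q, ‖Φ (vertexSimplex v i.succ) - Φ (vertexSimplex v i.castSucc)‖ ≤ η := by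
    intro i
    rw [← map_sub, Real.norm_eq_abs]
    obtain ⟨j, hj⟩ := (stepsScaled_iterSimplex (vertexSimplex v) β).1 i
    have h1 : |Φ ((2⁻¹ : ℝ) ^ k • (vertexSimplex v i.succ - vertexSimplex v i.castSucc))| ≤
        η * (2⁻¹ : ℝ) ^ k := by
      have h2 := h j
      rcases hj with hj | hj
      · rw [hj] at h2; exact h2
      · rw [hj] at h2
        rw [← abs_neg, ← map_neg]; exact h2
    rw [map_smul, smul_eq_mul, abs_mul, abs_of_pos hpow, mul_comm] at h1
    exact le_of_mul_le_mul_right h1 hpow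
  have hedge : ∀ i : Fin q, |Φ (edge v i)| ≤ q * η := by
    intro i
    have h1 := norm_sub_le_of_steps (fun i => Φ (vertexSimplex v i)) hstep i.succ
    have hη : 0 ≤ η := (norm_nonneg _).trans (hstep i)
    rw [← map_sub, Real.norm_eq_abs] at h1
    refine h1.trans (mul_le_mul_of_nonneg_right ?_ hη)
    exact_mod_cast Fin.is_le i.succ
  have h3 : ℓ (chartLift v u) - L u = ∑ i, u i * Φ (edge v i) := by
    have : Φ (chartLift v u) = ℓ (chartLift v u) - L u := by
      rw [hΦ, LinearMap.sub_apply, LinearMap.comp_apply, unchart_chartLift hv]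
    rw [← this, chartLift_apply, map_sum]
    exact Finset.sum_congr rfl fun i _ => by rw [map_smul, smul_eq_mul]
  rw [h3]
  calc |∑ i, u i * Φ (edge v i)| ≤ ∑ i, |u i * Φ (edge v i)| := Finset.abs_sum_le_sum_abs _ _
    _ ≤ ∑ _i : Fin q, ‖u‖ * (q * η) := by
        refine Finset.sum_le_sum fun i _ => ?_
        rw [abs_mul]
        exact mul_le_mul (norm_le_pi_norm u i) (hedge i) (abs_nonneg _) (norm_nonneg _)
    _ = _ := by rw [Finset.sum_const, Finset.card_univ, Fintype.card_fin, nsmul_eq_mul]; ring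

variable {K : PreAbstractSimplicialComplex U} (g : RiemannianMetric K)

/-- The linear function on the simplex `σ` that agrees with `r` at the vertices has slope at most
`Λ` with respect to the metric at some point of `σ`. -/
def SlopeLE (r : (U → ℝ) → ℝ) (v : Fin (q + 1) → U) (σ : Fin (q + 1) → U → ℝ) (Λ : ℝ) : Prop :=
  ∃ y ∈ tile v σ, ∃ ℓ : (U → ℝ) →ₗ[ℝ] ℝ, (∀ i, ℓ (σ i) = r (σ i)) ∧
    ∀ u, |ℓ (chartLift v u)| ≤ Λ * √(chartForm g v y u)

variable (hv : v ∈ simplices K q)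

include hv

/-- The interpolations of a Lipschitz function on the subdivisions are uniformly Lipschitz. -/
lemma exists_forall_slopeLE {r : (U → ℝ) → ℝ} {A : ℝ} (hA : 0 < A)
    (hr : ∀ y ∈ corner q, ∀ y' ∈ corner q, |r (chart v y') - r (chart v y)| ≤ A * ‖y' - y‖) :
    ∃ Λ ≥ 0, ∀ (k : ℕ) (β : Fin k → Fin q → Bool),
      SlopeLE g r v (iterSimplex k (vertexSimplex v) β) Λ := by
  have hinj := (strictMono_and_mem_faces hv).1.injective
  obtain ⟨κ, hκ, -, -, -, -, hκle, -⟩ := exists_metric_bounds g hv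
  refine ⟨q * (q * A) / √κ, by positivity, fun k β => ?_⟩
  obtain ⟨ℓ, hℓ⟩ := exists_linear_interpolation hinj β r
  have hmem := unchart_iterSimplex_mem_tile hinj β
  have hcor : ∀ i, unchart v (iterSimplex k (vertexSimplex v) β i) ∈ corner q := fun i =>
    tile_subset_corner hinj (iterSimplex_mem_closedSimplex hinj β) (hmem i)
  refine ⟨_, hmem 0, ℓ, hℓ, fun u => ?_⟩
  have h1 := abs_sub_le_of_edges hinj β ℓ 0 (η := A) (fun j => by
    rw [LinearMap.zero_apply, sub_zero, map_sub, hℓ, hℓ]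
    have := hr _ (hcor j.castSucc) _ (hcor j.succ)
    rw [chart_unchart hinj (iterSimplex_mem_closedSimplex hinj β _),
      chart_unchart hinj (iterSimplex_mem_closedSimplex hinj β _)] at this
    exact this.trans (by gcongr; exact norm_unchart_step_le β j)) u
  rw [LinearMap.zero_apply, sub_zero] at h1
  refine h1.trans ?_
  rw [div_mul_eq_mul_div, mul_div_assoc]
  gcongr
  rw [le_div_iff₀ (Real.sqrt_pos.2 hκ)]
  refine Real.le_sqrt_of_sq_le ?_
  rw [mul_pow, Real.sq_sqrt hκ.le, mul_comm]
  exact hκle _ (hcor 0) u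

/-- Near a point of differentiability of the distance function, the interpolations of this function
have slope at most `3`, as soon as the subdivision is fine enough. -/
lemma ae_eventually_slopeLE (x₀ : U → ℝ) (M : ℝ) : ∀ᵐ y ∂(volume.restrict (corner q)),
    ∀ᶠ k : ℕ in Filter.atTop, ∀ β : Fin k → Fin q → Bool,
      y ∈ tile v (iterSimplex k (vertexSimplex v) β) →
      SlopeLE g (truncDist g x₀ M) v (iterSimplex k (vertexSimplex v) β) 3 := by
  have hinj := (strictMono_and_mem_faces hv).1.injective
  obtain ⟨κ, hκ, -, -, -, -, hκle, -⟩ := exists_metric_bounds g hv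
  obtain ⟨A, hA, hlip⟩ := exists_truncDist_lipschitz g hv x₀ M
  set ρ : (Fin q → ℝ) → ℝ := fun y => truncDist g x₀ M (chart v y) with hρ
  have hLip : LipschitzOnWith (Real.toNNReal A) ρ (corner q) :=
    LipschitzOnWith.of_dist_le_mul fun y hy y' hy' => by
      rw [Real.coe_toNNReal _ hA.le, Real.dist_eq, dist_eq_norm]
      exact hlip y' hy' y hy
  have hfr : ∀ᵐ y ∂(volume : Measure (Fin q → ℝ)), y ∉ frontier (corner q) :=
    measure_eq_zero_iff_ae_notMem.1 ((convex_corner q).addHaar_frontier volume)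
  filter_upwards [hLip.ae_differentiableWithinAt (μ := volume) (measurableSet_corner q),
    ae_restrict_of_ae hfr, ae_restrict_mem (measurableSet_corner q)] with y hd hyf hyc
  have hyi : y ∈ interior (corner q) := by
    by_contra h
    exact hyf ⟨subset_closure hyc, h⟩
  have hD := (hd.differentiableAt (mem_interior_iff_mem_nhds.1 hyi)).hasFDerivAt
  set L := fderiv ℝ ρ y with hL
  have hslope := abs_fderiv_truncDist_le g hv x₀ M hyi hD
  -- the error allowed in the first order expansion at `y`
  set η : ℝ := √κ / (4 * q * (q * q) + 1) with hη
  have hη0 : 0 < η := div_pos (Real.sqrt_pos.2 hκ) (by positivity)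
  have hexp := hD.isLittleO.def hη0
  obtain ⟨ε, hε, hball⟩ := Metric.eventually_nhds_iff.1 hexp
  have hsmall : ∀ᶠ k : ℕ in Filter.atTop, 2 * q * (2⁻¹ : ℝ) ^ k < ε := by
    have : Filter.Tendsto (fun k : ℕ => 2 * (q : ℝ) * (2⁻¹ : ℝ) ^ k) Filter.atTop (nhds 0) := by
      simpa using (tendsto_pow_atTop_nhds_zero_of_lt_one (by norm_num : (0 : ℝ) ≤ 2⁻¹)
        (by norm_num)).const_mul (2 * (q : ℝ))
    exact this.eventually_lt_const hε
  filter_upwards [hsmall] with k hk β hyβ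
  obtain ⟨ℓ, hℓ⟩ := exists_linear_interpolation hinj β (truncDist g x₀ M)
  refine ⟨y, hyβ, ℓ, hℓ, fun u => ?_⟩
  set e := iterSimplex k (vertexSimplex v) β with he
  have hvert : ∀ i, |truncDist g x₀ M (e i) - ρ y - L (unchart v (e i) - y)| ≤
      η * (2 * q * (2⁻¹ : ℝ) ^ k) := by
    intro i
    have hdist := dist_le_of_mem_tile hinj β (unchart_iterSimplex_mem_tile hinj β i) hyβ
    have h1 := hball (hdist.trans_lt hk)
    simp only [hρ, chart_unchart hinj (iterSimplex_mem_closedSimplex hinj β i)] at h1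
    rw [Real.norm_eq_abs, ← dist_eq_norm] at h1
    exact h1.trans (by gcongr)
  have h1 := abs_sub_le_of_edges hinj β ℓ L.toLinearMap (η := 4 * q * η) (fun j => by
    have ha := abs_le.1 (hvert j.succ)
    have hb := abs_le.1 (hvert j.castSucc)
    rw [map_sub, hℓ, hℓ, ContinuousLinearMap.coe_coe, map_sub, map_sub]
    rw [map_sub] at ha hb
    rw [abs_le]
    constructor <;> linarith) u
  rw [ContinuousLinearMap.coe_coe] at h1
  have h2 : q * (q * (4 * q * η)) * ‖u‖ ≤ √(chartForm g v y u) := by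
    have h3 : q * (q * (4 * q * η)) ≤ √κ := by
      rw [hη, ← mul_div_assoc, ← mul_div_assoc, ← mul_div_assoc, div_le_iff₀ (by positivity)]
      nlinarith [Real.sqrt_nonneg κ]
    refine (mul_le_mul_of_nonneg_right h3 (norm_nonneg u)).trans (Real.le_sqrt_of_sq_le ?_)
    rw [mul_pow, Real.sq_sqrt hκ.le]
    exact hκle y hyc u
  have h4 := abs_le.1 (hslope u)
  have h5 := abs_le.1 (h1.trans h2)
  rw [abs_le]
  constructor <;> linarith

end Slopes

/-! ### Distance spheres and their piecewise linear approximations -/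

section Approximation

open Filter Topology

variable {U : Type*} [Fintype U] [LinearOrder U] {K : PreAbstractSimplicialComplex U}
  (g : RiemannianMetric K) {n : ℕ} {v : Fin (n + 1) → U}

lemma ae_mem_corner : ∀ᵐ y ∂(chartVol g v), y ∈ corner n :=
  (chartVol_absolutelyContinuous g v).ae_le (ae_restrict_mem (measurableSet_corner n))

/-- The simplices of the subdivision do not overlap. -/
lemma sum_chartVol_tile_inter (hv : Function.Injective v) (k : ℕ) {S : Set (Fin n → ℝ)} :
    ∑ β : Fin k → Fin n → Bool, chartVol g v (tile v (iterSimplex k (vertexSimplex v) β) ∩ S) =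
      chartVol g v S := by
  have h1 : ∀ β : Fin k → Fin n → Bool,
      chartVol g v (tile v (iterSimplex k (vertexSimplex v) β) ∩ S) =
      ∫⁻ y in S, (tile v (iterSimplex k (vertexSimplex v) β)).indicator 1 y ∂(chartVol g v) :=
    fun β => by
      rw [lintegral_indicator_one (measurableSet_tile _),
        Measure.restrict_apply (measurableSet_tile _)]
  rw [Finset.sum_congr rfl fun β _ => h1 β, ← lintegral_finsetSum _ fun β _ =>
    measurable_one.indicator (measurableSet_tile _), ← setLIntegral_one]
  refine lintegral_congr_ae (ae_restrict_of_ae ?_)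
  exact (chartVol_absolutelyContinuous g v).ae_le (ae_sum_indicator_tile hv k)

lemma eventually_nearlyConstantOn (hv : v ∈ simplices K n) : ∀ᶠ k : ℕ in atTop,
    ∀ β : Fin k → Fin n → Bool, NearlyConstantOn g v (tile v (iterSimplex k (vertexSimplex v) β)) := by
  have hinj := (strictMono_and_mem_faces hv).1.injective
  obtain ⟨-, -, -, -, δ, hδ, -, -, -, hnc⟩ := exists_metric_bounds g hv
  have h0 : Tendsto (fun k : ℕ => 2 * (n : ℝ) * (2⁻¹ : ℝ) ^ k) atTop (𝓝 0) := by
    simpa using (tendsto_pow_atTop_nhds_zero_of_lt_one (by norm_num : (0 : ℝ) ≤ 2⁻¹)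
      (by norm_num)).const_mul (2 * (n : ℝ))
  filter_upwards [h0.eventually_lt_const hδ] with k hk β y hy y' hy'
  have hsub := tile_subset_corner hinj (iterSimplex_mem_closedSimplex hinj β)
  exact hnc y (hsub hy) y' (hsub hy') ((dist_le_of_mem_tile hinj β hy hy').trans_lt hk)

section Lipschitz

variable {r : (U → ℝ) → ℝ} {A : ℝ}
  (hr : ∀ y ∈ corner n, ∀ y' ∈ corner n, |r (chart v y') - r (chart v y)| ≤ A * ‖y' - y‖)

include hr

lemma continuousOn_of_chart_lipschitz : ContinuousOn (fun y => r (chart v y)) (corner n) := by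
  refine (LipschitzOnWith.of_dist_le_mul (K := Real.toNNReal A) fun y hy y' hy' => ?_).continuousOn
  rw [Real.dist_eq, dist_eq_norm]
  exact (hr y' hy' y hy).trans (by gcongr; exact Real.le_coe_toNNReal A)

lemma measurableSet_chart_preimage {S : Set ℝ} (hS : IsClosed S) :
    MeasurableSet {y | y ∈ corner n ∧ r (chart v y) ∈ S} :=
  ((continuousOn_of_chart_lipschitz hr).preimage_isClosed_of_isClosed
    (isCompact_corner n).isClosed hS).measurableSet

lemma abs_vertex_sub_le (hA : 0 ≤ A) (hv : Function.Injective v) {k : ℕ}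
    (β : Fin k → Fin n → Bool) {y : Fin n → ℝ}
    (hy : y ∈ tile v (iterSimplex k (vertexSimplex v) β)) (i : Fin (n + 1)) :
    |r (iterSimplex k (vertexSimplex v) β i) - r (chart v y)| ≤ A * (2 * n * (2⁻¹ : ℝ) ^ k) := by
  have hsub := tile_subset_corner hv (iterSimplex_mem_closedSimplex hv β)
  have hi := unchart_iterSimplex_mem_tile hv β i
  have := hr y (hsub hy) _ (hsub hi)
  rw [chart_unchart hv (iterSimplex_mem_closedSimplex hv β i), ← dist_eq_norm] at this
  exact this.trans (by gcongr; exact dist_le_of_mem_tile hv β hi hy)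

/-- If the conditions `S k` on the values of `r` converge pointwise to the condition `T`, so do the
volumes of the sets that they define. -/
lemma tendsto_chartVol_thickening (hv : v ∈ simplices K n) {S : ℕ → Set ℝ} (hS : ∀ k, IsClosed (S k))
    {T : Set ℝ} (hT : IsClosed T) (hlim : ∀ s, ∀ᶠ k in atTop, s ∈ S k ↔ s ∈ T) :
    Tendsto (fun k => chartVol g v {y | y ∈ corner n ∧ r (chart v y) ∈ S k}) atTop
      (𝓝 (chartVol g v {y | y ∈ corner n ∧ r (chart v y) ∈ T})) := by
  have := isFiniteMeasure_chartVol g hv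
  refine tendsto_measure_of_ae_tendsto_indicator_of_isFiniteMeasure atTop
    (measurableSet_chart_preimage hr hT) (fun k => measurableSet_chart_preimage hr (hS k))
    (ae_of_all _ fun y => ?_)
  filter_upwards [hlim (r (chart v y))] with k hk
  simp only [hk]

/-- Only countably many levels of `r` have positive volume. -/
lemma ae_chartVol_level_eq_zero (hv : v ∈ simplices K n) :
    ∀ᵐ t : ℝ, chartVol g v {y | y ∈ corner n ∧ r (chart v y) ∈ ({t} : Set ℝ)} = 0 := by
  have := isFiniteMeasure_chartVol g hv
  have hmeas : NullMeasurable (fun y => r (chart v y)) (chartVol g v) :=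
    (((continuousOn_of_chart_lipschitz hr).aemeasurable (measurableSet_corner n)).mono_ac
      (chartVol_absolutelyContinuous g v)).nullMeasurable
  have hc := Measure.countable_meas_level_set_pos₀ hmeas
  filter_upwards [hc.ae_notMem volume] with t ht
  refine measure_mono_null (fun y hy => ?_) (not_not.1 (mt pos_iff_ne_zero.2 ht))
  exact hy.2

end Lipschitz

open Classical in
/-- The slope bound used for the simplex `σ`: `3` if it is admissible, and `Λ` otherwise. -/
def slopeBound (r : (U → ℝ) → ℝ) (v : Fin (n + 1) → U) (σ : Fin (n + 1) → U → ℝ) (Λ : ℝ) : ℝ :=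
  if SlopeLE g r v σ 3 then 3 else Λ

lemma slopeLE_slopeBound {r : (U → ℝ) → ℝ} {σ : Fin (n + 1) → U → ℝ} {Λ : ℝ}
    (h : SlopeLE g r v σ Λ) : SlopeLE g r v σ (slopeBound g r v σ Λ) := by
  rw [slopeBound]
  split_ifs with h3
  exacts [h3, h]

/-- The union of the simplices of the `k`-fold subdivision on which the slope of the interpolation
of `r` exceeds `3`. -/
def steepSet (r : (U → ℝ) → ℝ) (v : Fin (n + 1) → U) (k : ℕ) : Set (Fin n → ℝ) :=
  ⋃ (β : Fin k → Fin n → Bool) (_ : ¬ SlopeLE g r v (iterSimplex k (vertexSimplex v) β) 3),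
    tile v (iterSimplex k (vertexSimplex v) β)

lemma measurableSet_steepSet (r : (U → ℝ) → ℝ) (k : ℕ) : MeasurableSet (steepSet g r v k) :=
  MeasurableSet.iUnion fun _ => MeasurableSet.iUnion fun _ => measurableSet_tile _

lemma tendsto_chartVol_steepSet (hv : v ∈ simplices K n) (x₀ : U → ℝ) (M : ℝ) :
    Tendsto (fun k => chartVol g v (steepSet g (truncDist g x₀ M) v k)) atTop (𝓝 0) := by
  have := isFiniteMeasure_chartVol g hv
  rw [← measure_empty (μ := chartVol g v)]
  refine tendsto_measure_of_ae_tendsto_indicator_of_isFiniteMeasure atTop MeasurableSet.empty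
    (measurableSet_steepSet g _) ?_
  filter_upwards [(chartVol_absolutelyContinuous g v).ae_le (ae_eventually_slopeLE g hv x₀ M)]
    with y hy
  filter_upwards [hy] with k hk
  simp only [steepSet, mem_iUnion, mem_empty_iff_false, iff_false, not_exists]
  exact fun β hβ hyβ => hβ (hk β hyβ)

/-- Coarea inequality for the interpolation of `r`, on a chart. -/
lemma sum_lintegral_sliceBound_le (hv : v ∈ simplices K n) {r : (U → ℝ) → ℝ} {A : ℝ} (hA : 0 ≤ A)
    (hr : ∀ y ∈ corner n, ∀ y' ∈ corner n, |r (chart v y') - r (chart v y)| ≤ A * ‖y' - y‖)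
    {Λ : ℝ} (k : ℕ) (R : ℝ) :
    ∑ β : Fin k → Fin n → Bool, ∫⁻ t in Iic R, sliceBound g r v (iterSimplex k (vertexSimplex v) β)
        (slopeBound g r v (iterSimplex k (vertexSimplex v) β) Λ) t ≤
      3 * chartVol g v {y | y ∈ corner n ∧ r (chart v y) ∈ Iic (R + A * (2 * n * (2⁻¹ : ℝ) ^ k))} +
        ENNReal.ofReal Λ * chartVol g v (steepSet g r v k) := by
  have hinj := (strictMono_and_mem_faces hv).1.injective
  set S := {y | y ∈ corner n ∧ r (chart v y) ∈ Iic (R + A * (2 * n * (2⁻¹ : ℝ) ^ k))} with hS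
  rw [← sum_chartVol_tile_inter g hinj k (S := S),
    ← sum_chartVol_tile_inter g hinj k (S := steepSet g r v k), Finset.mul_sum,
    Finset.mul_sum, ← Finset.sum_add_distrib]
  refine Finset.sum_le_sum fun β _ => ?_
  set σ := iterSimplex k (vertexSimplex v) β with hσ
  rcases le_or_gt (vertexMin r σ) R with hmin | hmin
  · refine (setLIntegral_le_lintegral _ _).trans ((lintegral_sliceBound_le g r v σ _).trans ?_)
    by_cases h3 : SlopeLE g r v σ 3
    · have hsub : tile v σ ⊆ S := by
        intro y hy
        refine ⟨tile_subset_corner hinj (iterSimplex_mem_closedSimplex hinj β) hy, ?_⟩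
        obtain ⟨i, -, hi⟩ := Finset.exists_mem_eq_inf' Finset.univ_nonempty fun i => r (σ i)
        rw [vertexMin, hi] at hmin
        have := abs_le.1 (abs_vertex_sub_le hr hA hinj β hy i)
        rw [mem_Iic]
        linarith
      rw [slopeBound, if_pos h3, inter_eq_left.2 hsub]
      refine le_trans (le_of_eq ?_) le_self_add
      norm_num
    · have hsub : tile v σ ⊆ steepSet g r v k := fun y hy =>
        mem_iUnion.2 ⟨β, mem_iUnion.2 ⟨h3, hy⟩⟩
      rw [slopeBound, if_neg h3, inter_eq_left.2 hsub]
      exact le_add_self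
  · -- the simplex lies beyond the level `R`
    have : ∫⁻ t in Iic R, sliceBound g r v σ (slopeBound g r v σ Λ) t = 0 := by
      rw [setLIntegral_congr_fun (g := fun _ => 0) measurableSet_Iic fun t ht => ?_]
      · simp
      · exact indicator_of_notMem (fun h => absurd (h.1.trans ht) (not_le.2 hmin)) _
    rw [this]
    exact zero_le

section Cycle

variable {X : Type*} [TopologicalSpace X]

lemma vol_ball_eq (Z : GeometricCycle n U X) (x₀ : U → ℝ) {M t : ℝ} (ht0 : 0 ≤ t) (ht : t < M) :
    Z.g.vol n (Z.ball x₀ t) = ∑ v ∈ simplices Z.V n,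
      chartVol Z.g v {y | y ∈ corner n ∧ truncDist Z.g x₀ M (chart v y) ∈ Iic t} := by
  rw [vol_apply]
  refine Finset.sum_congr rfl fun v hv => measure_congr ?_
  filter_upwards [ae_mem_corner Z.g (v := v)] with y hy
  refine propext ?_
  have hs : chart v y ∈ space Z.V := ⟨_, (strictMono_and_mem_faces hv).2, chart_mem_closedSimplex hy⟩
  change chart v y ∈ Z.ball x₀ t ↔ y ∈ corner n ∧ truncDist Z.g x₀ M (chart v y) ≤ t
  rw [truncDist_le_iff Z.g x₀ _ ht0 ht]
  exact ⟨fun h => ⟨hy, h.2⟩, fun h => ⟨hs, h.2⟩⟩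

/-- The ball of radius `t` differs from the chain cut out of the subdivision only near the
sphere. -/
lemma lintegral_sub_multiplicity_le (Z : GeometricCycle n U X) (x₀ : U → ℝ) {M t : ℝ} (ht0 : 0 ≤ t)
    (ht : t < M) {A : (Fin (n + 1) → U) → ℝ} (hA : ∀ v ∈ simplices Z.V n, 0 ≤ A v)
    (hr : ∀ v ∈ simplices Z.V n, ∀ y ∈ corner n, ∀ y' ∈ corner n,
      |truncDist Z.g x₀ M (chart v y') - truncDist Z.g x₀ M (chart v y)| ≤ A v * ‖y' - y‖) (k : ℕ) :
    ∫⁻ x, ENNReal.ofReal |(Z.ball x₀ t).indicator (1 : (U → ℝ) → ℝ) x -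
        (Z.multiplicity (Z.cutChain (truncDist Z.g x₀ M) t k) x : ℝ)| ∂(Z.g.vol n) ≤
      ∑ v ∈ simplices Z.V n, (1 + (cutCount (n + 1) * (simplices Z.V n).card : ℕ)) *
        chartVol Z.g v {y | y ∈ corner n ∧ truncDist Z.g x₀ M (chart v y) ∈
          Metric.closedBall t (A v * (2 * n * (2⁻¹ : ℝ) ^ k))} := by
  classical
  set r := truncDist Z.g x₀ M with hrdef
  rw [lintegral_vol]
  refine Finset.sum_le_sum fun v hv => ?_
  have hinj := (strictMono_and_mem_faces hv).1.injective
  set d := A v * (2 * n * (2⁻¹ : ℝ) ^ k) with hd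
  have hSm : MeasurableSet {y | y ∈ corner n ∧ r (chart v y) ∈ Metric.closedBall t d} :=
    measurableSet_chart_preimage (hr v hv) Metric.isClosed_closedBall
  rw [← lintegral_indicator_const hSm]
  refine lintegral_mono_ae ?_
  filter_upwards [ae_mem_corner Z.g (v := v), ae_multiplicity_cutChain Z r t k hv]
    with y hyc ⟨β, hyβ, h1, h0, hb⟩
  have hs : chart v y ∈ space Z.V := ⟨_, (strictMono_and_mem_faces hv).2, chart_mem_closedSimplex hyc⟩
  have hball : chart v y ∈ Z.ball x₀ t ↔ r (chart v y) ≤ t := by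
    rw [hrdef, truncDist_le_iff Z.g x₀ _ ht0 ht]
    exact ⟨fun h => h.2, fun h => ⟨hs, h⟩⟩
  have hvert := fun i => abs_le.1 (abs_vertex_sub_le (hr v hv) (hA v hv) hinj β hyβ i)
  by_cases hnear : r (chart v y) ∈ Metric.closedBall t d
  · rw [indicator_of_mem (show y ∈ {y | y ∈ corner n ∧ r (chart v y) ∈ Metric.closedBall t d} from
      ⟨hyc, hnear⟩)]
    have h2 : |(Z.ball x₀ t).indicator (1 : (U → ℝ) → ℝ) (chart v y)| ≤ 1 := by
      rw [indicator_apply]; split_ifs <;> simp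
    have h3 : |(Z.multiplicity (Z.cutChain r t k) (chart v y) : ℝ)| ≤
        (cutCount (n + 1) * (simplices Z.V n).card : ℕ) := by
      rw [← Int.cast_abs, Int.abs_eq_natAbs]
      exact_mod_cast hb
    calc _ ≤ ENNReal.ofReal (1 + (cutCount (n + 1) * (simplices Z.V n).card : ℕ)) :=
          ENNReal.ofReal_le_ofReal ((abs_sub _ _).trans (add_le_add h2 h3))
      _ = _ := by
          rw [ENNReal.ofReal_add zero_le_one (Nat.cast_nonneg _), ENNReal.ofReal_one,
            ENNReal.ofReal_natCast]
  · refine le_trans (le_of_eq ?_) zero_le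
    rw [Metric.mem_closedBall, Real.dist_eq, abs_le, not_and_or, not_le, not_le] at hnear
    rcases hnear with hlt | hgt
    · rw [h1 fun i => by have := (hvert i).2; linarith,
        indicator_of_mem (hball.2 (by have := hvert 0; linarith))]
      simp
    · rw [h0 fun i => by have := (hvert i).1; linarith,
        indicator_of_notMem (fun h => by have := hvert 0; have := hball.1 h; linarith)]
      simp

end Cycle

section Slices

variable {q : ℕ} {X : Type*} [TopologicalSpace X] {Z : GeometricCycle (q + 1) U X} {W : Type*}
  [Fintype W] {L : PreAbstractSimplicialComplex W} {h : RiemannianMetric L}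

/-- The upper bound for the volume of the slice of the `k`-fold subdivision at the level `t`. -/
def areaBound (Z : GeometricCycle (q + 1) U X) (r : (U → ℝ) → ℝ) (Λ : (Fin (q + 2) → U) → ℝ) (k : ℕ)
    (t : ℝ) : ℝ≥0∞ :=
  ∑ v ∈ simplices Z.V (q + 1), ∑ β : Fin k → Fin (q + 1) → Bool,
    sliceConst q * sliceBound Z.g r v (iterSimplex k (vertexSimplex v) β)
      (slopeBound Z.g r v (iterSimplex k (vertexSimplex v) β) (Λ v)) t

lemma measurable_areaBound (r : (U → ℝ) → ℝ) (Λ : (Fin (q + 2) → U) → ℝ) (k : ℕ) :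
    Measurable (areaBound Z r Λ k) :=
  Finset.measurable_sum _ fun _ _ => Finset.measurable_sum _ fun _ _ =>
    (measurable_sliceBound _ _ _ _ _).const_mul _

lemma weight_slice_fundChain_le (j : Z.Inclusion h) (r : (U → ℝ) → ℝ) (t : ℝ) (k : ℕ)
    (w : (stdSimplex ℝ (Fin (q + 1)) → (W → ℝ)) → ℝ≥0∞) :
    weight w (pushChain j.toFun q (sliceMap r t (q + 1) (Z.fundChain k))) ≤
      ∑ v ∈ simplices Z.V (q + 1), ∑ β : Fin k → Fin (q + 1) → Bool,
        weight (fun τ => w (singularSimplex j.toFun τ))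
          (slice r t (q + 1) (iterSimplex k (vertexSimplex v) β)) :=
  (weight_pushChain_le _ _ _).trans
    ((weight_linearCombination_le _ _ _).trans (weight_fundChain_le Z k _))

/-- The image of the slice in the ambient polyhedron is a Lipschitz chain of controlled volume. -/
lemma slice_fundChain_bounds (j : Z.Inclusion h) (r : (U → ℝ) → ℝ) (t : ℝ) (k : ℕ)
    {Λ : (Fin (q + 2) → U) → ℝ} (hΛ0 : ∀ v ∈ simplices Z.V (q + 1), 0 ≤ Λ v)
    (hΛ : ∀ v ∈ simplices Z.V (q + 1), ∀ β : Fin k → Fin (q + 1) → Bool,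
      SlopeLE Z.g r v (iterSimplex k (vertexSimplex v) β) (Λ v))
    (hnc : ∀ v ∈ simplices Z.V (q + 1), ∀ β : Fin k → Fin (q + 1) → Bool,
      NearlyConstantOn Z.g v (tile v (iterSimplex k (vertexSimplex v) β))) :
    h.IsLipschitzChain (pushChain j.toFun q (sliceMap r t (q + 1) (Z.fundChain k))) ∧
    h.chainVol (pushChain j.toFun q (sliceMap r t (q + 1) (Z.fundChain k))) ≤
      areaBound Z r Λ k t := by
  classical
  constructor
  · -- the simplices that are not Lipschitz have total mass zero
    let w : (stdSimplex ℝ (Fin (q + 1)) → (W → ℝ)) → ℝ≥0∞ := fun τ =>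
      if h.IsLipschitzSimplex τ then 0 else 1
    have h0 : weight w (pushChain j.toFun q (sliceMap r t (q + 1) (Z.fundChain k))) = 0 := by
      refine le_antisymm ((weight_slice_fundChain_le j r t k w).trans ?_) bot_le
      refine le_of_eq (Finset.sum_eq_zero fun v hv => Finset.sum_eq_zero fun β _ => ?_)
      have hinj := (strictMono_and_mem_faces hv).1.injective
      obtain ⟨y, hy, ℓ, hℓ, hslope⟩ := hΛ v hv β
      by_cases ht : Crosses r t (iterSimplex k (vertexSimplex v) β)
      · refine le_antisymm ((weight_slice_le r t _ _ 0 fun τ hτ => ?_).trans (by simp)) bot_le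
        have := (simplexVol_level_le j hv (iterSimplex_mem_closedSimplex hinj β) (hnc v hv β) r ℓ hℓ
          (hΛ0 v hv) hy hslope ((crosses_iff _ _ _).1 ht) hτ).1
        simp only [w, if_pos this, le_refl]
      · rw [slice_eq_zero_of_not_crosses ht, weight_zero]
    intro τ hτ
    have := weight_eq_zero h0 τ hτ
    by_contra hne
    simp [w, if_neg hne] at this
  · refine (weight_slice_fundChain_le j r t k h.simplexVol).trans ?_
    refine Finset.sum_le_sum fun v hv => Finset.sum_le_sum fun β _ => ?_
    obtain ⟨y, hy, ℓ, hℓ, hslope⟩ := slopeLE_slopeBound Z.g (hΛ v hv β)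
    have hpos : 0 ≤ slopeBound Z.g r v (iterSimplex k (vertexSimplex v) β) (Λ v) := by
      rw [slopeBound]
      split_ifs
      exacts [by norm_num, hΛ0 v hv]
    exact weight_slice_le_sliceBound j hv (iterSimplex_mem_closedSimplex
      (strictMono_and_mem_faces hv).1.injective β) (hnc v hv β) r ℓ hℓ hpos hy hslope t

lemma lintegral_areaBound_le (r : (U → ℝ) → ℝ) {A : (Fin (q + 2) → U) → ℝ}
    (hA : ∀ v ∈ simplices Z.V (q + 1), 0 ≤ A v)
    (hr : ∀ v ∈ simplices Z.V (q + 1), ∀ y ∈ corner (q + 1), ∀ y' ∈ corner (q + 1),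
      |r (chart v y') - r (chart v y)| ≤ A v * ‖y' - y‖) (Λ : (Fin (q + 2) → U) → ℝ) (k : ℕ)
    (R : ℝ) : ∫⁻ t in Iic R, areaBound Z r Λ k t ≤ sliceConst q * ∑ v ∈ simplices Z.V (q + 1),
      (3 * chartVol Z.g v {y | y ∈ corner (q + 1) ∧
          r (chart v y) ∈ Iic (R + A v * (2 * (q + 1 : ℕ) * (2⁻¹ : ℝ) ^ k))} +
        ENNReal.ofReal (Λ v) * chartVol Z.g v (steepSet Z.g r v k)) := by
  simp only [areaBound]
  rw [lintegral_finsetSum _ fun v _ => Finset.measurable_sum _ fun β _ =>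
    (measurable_sliceBound _ _ _ _ _).const_mul _, Finset.mul_sum]
  refine Finset.sum_le_sum fun v hv => ?_
  rw [lintegral_finsetSum _ fun β _ => (measurable_sliceBound _ _ _ _ _).const_mul _]
  simp only [lintegral_const_mul _ (measurable_sliceBound _ _ _ _ _)]
  rw [← Finset.mul_sum]
  gcongr
  exact sum_lintegral_sliceBound_le Z.g hv (hA v hv) (hr v hv) k R

end Slices

end Approximation

/-! ### The differential inequality -/

section Profile

open Filter Topology

variable {m : ℕ} {U : Type*} [Fintype U] [LinearOrder U] {X : Type*} [TopologicalSpace X]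
  {Z : GeometricCycle (m + 2) U X} {W : Type*} [Fintype W] {L : PreAbstractSimplicialComplex W}
  {h : RiemannianMetric L}

/-- The integrated differential inequality for the volume of balls: there is a function `a`, playing
the role of the area of the distance spheres, that bounds the volume of the balls by the
isoperimetric inequality and whose integral is bounded by the volume of the balls by the coarea
inequality. It is the lower limit of the areas of the approximating spheres. -/
lemma exists_area_profile (j : Z.Inclusion h) {c : ℝ}
    (hiso : h.IsoperimetricInequality (m + 1) c) {ε : ℝ} (hreg : j.IsFillingRegular ε)
    {x₀ : U → ℝ} (hx₀ : x₀ ∈ space Z.V) {R : ℝ} (hεR : ε ≤ R) (hR : ENNReal.ofReal R < Z.sys / 2) :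
    ∃ a : ℝ → ℝ≥0∞, (∀ᵐ t : ℝ, t ∈ Icc ε R → Z.g.vol (m + 2) (Z.ball x₀ t) ≤
        ENNReal.ofReal (1 + ε) *
          (ENNReal.ofReal c * a t ^ (((m + 1 : ℕ) + 1 : ℝ) / (m + 1 : ℕ)))) ∧
      ∫⁻ t in Icc ε R, a t ≤ sliceConst (m + 1) * (3 * Z.g.vol (m + 2) (Z.ball x₀ R)) := by
  set r := truncDist Z.g x₀ (R + 1) with hrdef
  set p : ℝ := ((m + 1 : ℕ) + 1 : ℝ) / (m + 1 : ℕ) with hp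
  have hε := hreg.pos
  have hA' : ∀ v ∈ simplices Z.V (m + 2), ∃ A > 0, ∀ y ∈ corner (m + 2), ∀ y' ∈ corner (m + 2),
      |r (chart v y') - r (chart v y)| ≤ A * ‖y' - y‖ := fun v hv =>
    exists_truncDist_lipschitz Z.g hv x₀ (R + 1)
  choose! A hA0 hA using hA'
  have hΛ' : ∀ v ∈ simplices Z.V (m + 2), ∃ Λ ≥ 0, ∀ (k : ℕ) (β : Fin k → Fin (m + 2) → Bool),
      SlopeLE Z.g r v (iterSimplex k (vertexSimplex v) β) Λ := fun v hv =>
    exists_forall_slopeLE Z.g hv (hA0 v hv) (hA v hv)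
  choose! Λ hΛ0 hΛ using hΛ'
  have hnc : ∀ᶠ k : ℕ in atTop, ∀ v ∈ simplices Z.V (m + 2), ∀ β : Fin k → Fin (m + 2) → Bool,
      NearlyConstantOn Z.g v (tile v (iterSimplex k (vertexSimplex v) β)) :=
    (Finset.eventually_all _).2 fun v hv => eventually_nearlyConstantOn Z.g hv
  -- the mesh of the subdivisions, measured by `r`
  have hmesh : ∀ v, Tendsto (fun k : ℕ => A v * (2 * (m + 2 : ℕ) * (2⁻¹ : ℝ) ^ k)) atTop (𝓝 0) :=
    fun v => by
      simpa using ((tendsto_pow_atTop_nhds_zero_of_lt_one (by norm_num : (0 : ℝ) ≤ 2⁻¹)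
        (by norm_num)).const_mul (2 * ((m + 2 : ℕ) : ℝ))).const_mul (A v)
  have hmesh0 : ∀ v ∈ simplices Z.V (m + 2), ∀ k : ℕ,
      0 ≤ A v * (2 * (m + 2 : ℕ) * (2⁻¹ : ℝ) ^ k) := fun v hv k => by
    have := (hA0 v hv).le
    positivity
  set E : ℕ → ℝ → ℝ≥0∞ := fun k t =>
    ∑ v ∈ simplices Z.V (m + 2), (1 + (cutCount (m + 2 + 1) * (simplices Z.V (m + 2)).card : ℕ)) *
        chartVol Z.g v {y | y ∈ corner (m + 2) ∧ r (chart v y) ∈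
          Metric.closedBall t (A v * (2 * (m + 2 : ℕ) * (2⁻¹ : ℝ) ^ k))} with hE
  have hElim : ∀ᵐ t : ℝ, Tendsto (fun k => E k t) atTop (𝓝 0) := by
    have hlev : ∀ᵐ t : ℝ, ∀ v ∈ simplices Z.V (m + 2),
        chartVol Z.g v {y | y ∈ corner (m + 2) ∧ r (chart v y) ∈ ({t} : Set ℝ)} = 0 :=
      (ae_ball_iff (Finset.countable_toSet _)).2 fun v hv =>
        ae_chartVol_level_eq_zero Z.g (hA v hv) hv
    filter_upwards [hlev] with t ht
    rw [show (0 : ℝ≥0∞) = ∑ v ∈ simplices Z.V (m + 2),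
      (1 + (cutCount (m + 2 + 1) * (simplices Z.V (m + 2)).card : ℕ) : ℝ≥0∞) * 0 by simp]
    refine tendsto_finsetSum _ fun v hv => ENNReal.Tendsto.const_mul ?_
      
      (Or.inr (ENNReal.add_ne_top.2 ⟨ENNReal.one_ne_top, ENNReal.natCast_ne_top _⟩))
    rw [← ht v hv]
    refine tendsto_chartVol_thickening Z.g (hA v hv) hv (fun k => Metric.isClosed_closedBall)
      isClosed_singleton fun s => ?_
    rcases eq_or_ne s t with rfl | hst
    · filter_upwards with k
      exact iff_of_true (Metric.mem_closedBall_self (hmesh0 v hv k)) rfl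
    · filter_upwards [(hmesh v).eventually_lt_const (dist_pos.2 hst)] with k hk
      simp only [Metric.mem_closedBall, not_le.2 hk, mem_singleton_iff, hst]
  refine ⟨fun t => liminf (fun k => areaBound Z r Λ k t) atTop, ?_, ?_⟩
  · filter_upwards [hElim] with t ht hmem
    have htR : ENNReal.ofReal t < Z.sys / 2 := (ENNReal.ofReal_le_ofReal hmem.2).trans_lt hR
    have hmain : ∀ᶠ k : ℕ in atTop, Z.g.vol (m + 2) (Z.ball x₀ t) ≤
        ENNReal.ofReal (1 + ε) * (ENNReal.ofReal c * areaBound Z r Λ k t ^ p) +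
          ENNReal.ofReal (1 + ε) * E k t := by
      filter_upwards [hnc] with k hk
      obtain ⟨hlip, hvol⟩ := slice_fundChain_bounds j r t k hΛ0 (fun v hv β => hΛ v hv k β) hk
      rw [← mul_add]
      refine (hreg.vol_ball_le x₀ hx₀ t hmem.1 htR).trans (mul_le_mul_right ?_ _)
      refine (fillVolBoundary_le j hiso r t k hlip _).trans (add_le_add ?_ ?_)
      · gcongr
      · exact lintegral_sub_multiplicity_le Z x₀ (hε.le.trans hmem.1) (by linarith [hmem.2])
          (fun v hv => (hA0 v hv).le) hA k
    have hE0 : Tendsto (fun k => ENNReal.ofReal (1 + ε) * E k t) atTop (𝓝 0) := by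
      simpa using ENNReal.Tendsto.const_mul ht (Or.inr ENNReal.ofReal_ne_top)
    refine (le_liminf_of_le (by isBoundedDefault) hmain).trans (le_of_eq ?_)
    refine (ENNReal.liminf_add_of_right_tendsto_zero hE0 _).trans ?_
    have hmono : Monotone fun x : ℝ≥0∞ =>
        ENNReal.ofReal (1 + ε) * (ENNReal.ofReal c * x ^ p) := fun x y hxy => by
      dsimp only; gcongr
    have hcont : Continuous fun x : ℝ≥0∞ =>
        ENNReal.ofReal (1 + ε) * (ENNReal.ofReal c * x ^ p) :=
      (ENNReal.continuous_const_mul ENNReal.ofReal_ne_top).comp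
        ((ENNReal.continuous_const_mul ENNReal.ofReal_ne_top).comp ENNReal.continuous_rpow_const)
    exact (hmono.map_liminf_of_continuousAt (fun k => areaBound Z r Λ k t)
      hcont.continuousAt).symm
  · have hbound : ∀ k, ∫⁻ t in Icc ε R, areaBound Z r Λ k t ≤
        sliceConst (m + 1) * ∑ v ∈ simplices Z.V (m + 2),
          (3 * chartVol Z.g v {y | y ∈ corner (m + 2) ∧
              r (chart v y) ∈ Iic (R + A v * (2 * (m + 2 : ℕ) * (2⁻¹ : ℝ) ^ k))} +
            ENNReal.ofReal (Λ v) * chartVol Z.g v (steepSet Z.g r v k)) := fun k =>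
      (lintegral_mono_set Icc_subset_Iic_self).trans
        (lintegral_areaBound_le r (fun v hv => (hA0 v hv).le) hA Λ k R)
    have hlim : Tendsto (fun k => sliceConst (m + 1) * ∑ v ∈ simplices Z.V (m + 2),
          (3 * chartVol Z.g v {y | y ∈ corner (m + 2) ∧
              r (chart v y) ∈ Iic (R + A v * (2 * (m + 2 : ℕ) * (2⁻¹ : ℝ) ^ k))} +
            ENNReal.ofReal (Λ v) * chartVol Z.g v (steepSet Z.g r v k))) atTop
        (𝓝 (sliceConst (m + 1) * ∑ v ∈ simplices Z.V (m + 2),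
          (3 * chartVol Z.g v {y | y ∈ corner (m + 2) ∧ r (chart v y) ∈ Iic R} +
            ENNReal.ofReal (Λ v) * 0))) := by
      refine ENNReal.Tendsto.const_mul (tendsto_finsetSum _ fun v hv => ?_)
        (Or.inr (sliceConst_ne_top _))
      refine Tendsto.add (ENNReal.Tendsto.const_mul ?_ (Or.inr (by norm_num)))
        (ENNReal.Tendsto.const_mul (tendsto_chartVol_steepSet Z.g hv x₀ (R + 1))
          (Or.inr ENNReal.ofReal_ne_top))
      refine tendsto_chartVol_thickening Z.g (hA v hv) hv (fun k => isClosed_Iic) isClosed_Iic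
        fun s => ?_
      rcases le_or_gt s R with hs | hs
      · filter_upwards with k
        have := hmesh0 v hv k
        simp only [mem_Iic, hs, iff_true]
        linarith
      · filter_upwards [(hmesh v).eventually_lt_const (sub_pos.2 hs)] with k hk
        simp only [mem_Iic, not_le.2 hs, iff_false, not_le]
        linarith
    calc ∫⁻ t in Icc ε R, liminf (fun k => areaBound Z r Λ k t) atTop
        ≤ liminf (fun k => ∫⁻ t in Icc ε R, areaBound Z r Λ k t) atTop :=
          lintegral_liminf_le fun k => measurable_areaBound r Λ k
      _ ≤ _ := liminf_le_liminf (Eventually.of_forall hbound)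
      _ = _ := hlim.liminf_eq
      _ = _ := by
          rw [vol_ball_eq Z x₀ (hε.le.trans hεR) (lt_add_one R)]
          simp only [mul_zero, add_zero, ← Finset.mul_sum]
          rfl

/-- Balls of positive radius have positive volume. -/
lemma vol_ball_pos {n : ℕ} (Z : GeometricCycle n U X) {x₀ : U → ℝ} (hx₀ : x₀ ∈ space Z.V) {t : ℝ}
    (ht : 0 < t) : 0 < Z.g.vol n (Z.ball x₀ t) := by
  obtain ⟨s, hs, hxs⟩ := hx₀
  obtain ⟨T, hT, hsT, hcard⟩ := Z.pseudomanifold.pure s hs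
  set v : Fin (n + 1) → U := fun i => T.orderEmbOfFin hcard i with hvdef
  have himg : Finset.univ.image v = T := by
    ext u
    simp only [hvdef, Finset.mem_image, Finset.mem_univ, true_and]
    rw [← Set.mem_range, Finset.range_orderEmbOfFin, Finset.mem_coe]
  have hv : v ∈ simplices Z.V n := by
    classical
    exact Finset.mem_filter.2 ⟨Finset.mem_univ _, (T.orderEmbOfFin hcard).strictMono, by
      rw [himg]; exact hT⟩
  have hinj := (strictMono_and_mem_faces hv).1.injective
  have hxT : x₀ ∈ closedSimplex (Finset.univ.image v) := by
    rw [himg]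
    exact ⟨hxs.1, hxs.2.1, fun u hu => hxs.2.2 u fun h => hu (hsT h)⟩
  set y₀ := unchart v x₀ with hy₀
  have hchart : chart v y₀ = x₀ := chart_unchart hinj hxT
  have hyc : y₀ ∈ corner n := unchart_mem_corner hinj hxT
  obtain ⟨A, hA, hr⟩ := exists_truncDist_lipschitz Z.g hv x₀ (t + 1)
  obtain ⟨-, -, -, -, δ, hδ, -, -, -, hnc⟩ := exists_metric_bounds Z.g hv
  set O := interior (corner n) ∩ Metric.ball y₀ (min δ (t / A)) with hO
  have hrad : 0 < min δ (t / A) := lt_min hδ (div_pos ht hA)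
  have hOopen : IsOpen O := isOpen_interior.inter Metric.isOpen_ball
  have hint : (interior (corner n)).Nonempty := by
    by_contra h
    rw [not_nonempty_iff_eq_empty] at h
    have h1 := (convex_corner n).addHaar_frontier volume
    rw [frontier, h, sdiff_empty] at h1
    exact (volume_corner_pos n).ne' (measure_mono_null subset_closure h1)
  have hOne : O.Nonempty := by
    have h1 : y₀ ∈ closure (interior (corner n)) := by
      rw [(convex_corner n).closure_interior_eq_closure_of_nonempty_interior hint]
      exact subset_closure hyc
    obtain ⟨z, hz1, hz2⟩ := mem_closure_iff.1 h1 _ Metric.isOpen_ball (Metric.mem_ball_self hrad)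
    exact ⟨z, hz2, hz1⟩
  have hOc : O ⊆ corner n := inter_subset_left.trans interior_subset
  have hsub : O ⊆ {y | y ∈ corner n ∧ truncDist Z.g x₀ (t + 1) (chart v y) ∈ Iic t} := by
    intro y hy
    refine ⟨hOc hy, ?_⟩
    have h0 : truncDist Z.g x₀ (t + 1) (chart v y₀) = 0 := by
      rw [hchart, truncDist, RiemannianMetric.dist_self]; simp
    have h1 := hr y₀ hyc y (hOc hy)
    rw [h0, sub_zero, ← dist_eq_norm] at h1
    have h2 : dist y y₀ < t / A := (Metric.mem_ball.1 hy.2).trans_le (min_le_right _ _)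
    rw [lt_div_iff₀ hA] at h2
    exact (le_abs_self _).trans (h1.trans (by linarith))
  have hpos : 0 < chartVol Z.g v O := by
    have hd := Real.sqrt_pos.2 (chartGram_det_pos Z.g hv hyc)
    rw [chartVol_apply Z.g v hOopen.measurableSet hOc]
    calc 0 < ENNReal.ofReal (√(chartGram Z.g v y₀).det / 2) * volume O :=
          ENNReal.mul_pos (ENNReal.ofReal_pos.2 (by positivity)).ne'
            (hOopen.measure_pos volume hOne).ne'
      _ = ∫⁻ _ in O, ENNReal.ofReal (√(chartGram Z.g v y₀).det / 2) := (setLIntegral_const _ _).symm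
      _ ≤ _ := by
          refine setLIntegral_mono' hOopen.measurableSet fun y hy => ?_
          rw [density_eq]
          refine ENNReal.ofReal_le_ofReal ?_
          have h2 : dist y₀ y < δ := by
            rw [dist_comm]; exact (Metric.mem_ball.1 hy.2).trans_le (min_le_left _ _)
          linarith [(hnc y₀ hyc y (hOc hy) h2).2]
  rw [vol_ball_eq Z x₀ ht.le (lt_add_one t)]
  exact (hpos.trans_le (measure_mono hsub)).trans_le
    (Finset.single_le_sum (f := fun v => chartVol Z.g v {y | y ∈ corner n ∧
      truncDist Z.g x₀ (t + 1) (chart v y) ∈ Iic t}) (fun _ _ => zero_le) hv)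

end Profile

/-! ### Growth of functions with an integrated differential inequality -/

section Growth

lemma le_of_mul_rpow_le {m : ℕ} {D x : ℝ} (hD : 0 < D) (hx : 0 ≤ x) {a : ℝ≥0∞}
    (h : ENNReal.ofReal (D * x ^ (m + 2)) ≤
      ENNReal.ofReal D * a ^ (((m + 1 : ℕ) + 1 : ℝ) / (m + 1 : ℕ))) :
    ENNReal.ofReal (x ^ (m + 1)) ≤ a := by
  have hm : (0 : ℝ) < (m + 1 : ℕ) := by positivity
  have hp : (0 : ℝ) < ((m + 1 : ℕ) + 1 : ℝ) / (m + 1 : ℕ) := by positivity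
  have hpow : x ^ (m + 2) = (x ^ (m + 1)) ^ (((m + 1 : ℕ) + 1 : ℝ) / (m + 1 : ℕ)) := by
    rw [← Real.rpow_natCast x (m + 1), ← Real.rpow_mul hx, mul_div_cancel₀ _ hm.ne',
      ← Real.rpow_natCast x (m + 2)]
    congr 1
    push_cast; ring
  rw [ENNReal.ofReal_mul hD.le, ENNReal.mul_le_mul_iff_right (ENNReal.ofReal_pos.2 hD).ne'
    ENNReal.ofReal_ne_top, hpow, ← ENNReal.ofReal_rpow_of_nonneg (by positivity) hp.le,
    ENNReal.rpow_le_rpow_iff hp] at h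
  exact h

lemma lintegral_pow_sub (k : ℕ) {ε R s : ℝ} (hεR : ε ≤ R) (hs : 0 ≤ s) :
    ∫⁻ t in Icc ε R, ENNReal.ofReal ((s * (t - ε)) ^ k) =
      ENNReal.ofReal (s ^ k * (R - ε) ^ (k + 1) / (k + 1)) := by
  have hcont : Continuous fun t : ℝ => (s * (t - ε)) ^ k := by fun_prop
  rw [← ofReal_integral_eq_lintegral_ofReal hcont.continuousOn.integrableOn_Icc ?_]
  · congr 1
    rw [integral_Icc_eq_integral_Ioc, ← intervalIntegral.integral_of_le hεR]
    simp only [mul_pow, intervalIntegral.integral_const_mul]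
    rw [intervalIntegral.integral_comp_sub_right (fun t => t ^ k), integral_pow, sub_self]
    simp [mul_div_assoc]
  · filter_upwards [ae_restrict_mem measurableSet_Icc] with t ht
    have := sub_nonneg.2 ht.1
    simp only [Pi.zero_apply]
    positivity

/-- A function `F` with `F ≤ D a ^ (n / (n - 1))` and `∫ a ≤ C F` grows at least like the `n`-th
power. The largest `s` with `F t ≥ D (s (t - ε)) ^ n` cannot be improved by integrating this
inequality, which forces `s ≥ 1 / (n C D)`. -/
lemma pow_le_of_integral_inequality {m : ℕ} {F : ℝ → ℝ≥0∞} {ε R C D : ℝ} (hεR : ε < R) (hC : 0 < C)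
    (hD : 0 < D) (hmono : Monotone F) (hpos : 0 < F ε) (htop : ∀ t, F t ≠ ⊤)
    (h : ∀ R' ∈ Icc ε R, ∃ a : ℝ → ℝ≥0∞, (∀ᵐ t : ℝ, t ∈ Icc ε R' → F t ≤
        ENNReal.ofReal D * a t ^ (((m + 1 : ℕ) + 1 : ℝ) / (m + 1 : ℕ))) ∧
      ∫⁻ t in Icc ε R', a t ≤ ENNReal.ofReal C * F R') :
    ENNReal.ofReal (D * (1 / ((m + 2) * C * D) * (R - ε)) ^ (m + 2)) ≤ F R := by
  have hRε := sub_pos.2 hεR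
  set S : Set ℝ := {s | 0 ≤ s ∧ ∀ t ∈ Icc ε R, D * (s * (t - ε)) ^ (m + 2) ≤ (F t).toReal} with hS
  have hmonoR : ∀ t ∈ Icc ε R, (F ε).toReal ≤ (F t).toReal := fun t ht =>
    ENNReal.toReal_mono (htop t) (hmono ht.1)
  have hεpos : 0 < (F ε).toReal := ENNReal.toReal_pos hpos.ne' (htop ε)
  have hclosed : IsClosed S := by
    have : S = Ici 0 ∩ ⋂ t ∈ Icc ε R, {s | D * (s * (t - ε)) ^ (m + 2) ≤ (F t).toReal} := by
      ext s; simp [hS]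
    rw [this]
    refine isClosed_Ici.inter (isClosed_biInter fun t _ => isClosed_le (by fun_prop) (by fun_prop))
  have hbdd : S ⊆ Icc 0 (max 1 ((F R).toReal / (D * (R - ε) ^ (m + 2)))) := by
    intro s hs
    refine ⟨hs.1, ?_⟩
    rcases le_total s 1 with h1 | h1
    · exact h1.trans (le_max_left _ _)
    · refine le_trans ?_ (le_max_right _ _)
      rw [le_div_iff₀ (by positivity)]
      have h2 := hs.2 R ⟨hεR.le, le_rfl⟩
      have h3 : s ≤ s ^ (m + 2) := le_self_pow₀ h1 (by omega)
      calc s * (D * (R - ε) ^ (m + 2)) ≤ s ^ (m + 2) * (D * (R - ε) ^ (m + 2)) := by gcongr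
        _ = D * (s * (R - ε)) ^ (m + 2) := by rw [mul_pow]; ring
        _ ≤ _ := h2
  obtain ⟨s₁, hs₁, hs₁S⟩ : ∃ s₁ > 0, s₁ ∈ S := by
    have hlim : Filter.Tendsto (fun s : ℝ => D * (s * (R - ε)) ^ (m + 2)) (nhdsWithin 0 (Ioi 0))
        (nhds 0) := by
      have : Continuous fun s : ℝ => D * (s * (R - ε)) ^ (m + 2) := by fun_prop
      simpa using this.continuousAt.mono_left (nhdsWithin_le_nhds (a := (0 : ℝ)) (s := Ioi 0))
    obtain ⟨s, hs, hs0⟩ := ((hlim.eventually_lt_const hεpos).and self_mem_nhdsWithin).exists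
    have hs0' : 0 < s := hs0
    refine ⟨s, hs0', hs0'.le, fun t ht => le_trans ?_ (hs.le.trans (hmonoR t ht))⟩
    have := sub_nonneg.2 ht.1
    gcongr
    exact ht.2
  obtain ⟨s, hsS, hsmax⟩ := (isCompact_Icc.of_isClosed_subset hclosed hbdd).exists_isGreatest
    ⟨s₁, hs₁S⟩
  have hs0 : 0 < s := hs₁.trans_le (hsmax hs₁S)
  -- integration of the inequality for `s` gives the inequality for `s'`
  set s' : ℝ := (s ^ (m + 1) / ((m + 2) * C * D)) ^ ((1 : ℝ) / (m + 2 : ℕ)) with hs'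
  have hs'0 : 0 ≤ s' := by positivity
  have hs'pow : s' ^ (m + 2) = s ^ (m + 1) / ((m + 2) * C * D) := by
    rw [hs', ← Real.rpow_natCast, ← Real.rpow_mul (by positivity), one_div_mul_cancel (by positivity),
      Real.rpow_one]
  have hs'S : s' ∈ S := by
    refine ⟨hs'0, fun t ht => ?_⟩
    obtain ⟨a, ha, hint⟩ := h t ht
    have h1 : ENNReal.ofReal (s ^ (m + 1) * (t - ε) ^ (m + 1 + 1) / ((m + 1 : ℕ) + 1)) ≤
        ENNReal.ofReal C * F t := by
      rw [← lintegral_pow_sub (m + 1) ht.1 hs0.le]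
      refine (lintegral_mono_ae ?_).trans hint
      refine (ae_restrict_iff' measurableSet_Icc).2 ?_
      filter_upwards [ha] with u hu hmem
      refine le_of_mul_rpow_le hD (mul_nonneg hs0.le (sub_nonneg.2 hmem.1)) (le_trans ?_ (hu hmem))
      exact ENNReal.ofReal_le_of_le_toReal (hsS.2 u ⟨hmem.1, hmem.2.trans ht.2⟩)
    rw [← ENNReal.ofReal_toReal (htop t), ← ENNReal.ofReal_mul hC.le,
      ENNReal.ofReal_le_ofReal_iff (by positivity)] at h1
    rw [mul_pow, hs'pow]
    have h2 : D * (s ^ (m + 1) / ((m + 2) * C * D) * (t - ε) ^ (m + 2)) =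
        s ^ (m + 1) * (t - ε) ^ (m + 1 + 1) / ((m + 1 : ℕ) + 1) / C := by
      push_cast
      field_simp
      ring
    rw [h2, div_le_iff₀ hC, mul_comm _ C]
    exact h1
  have hs'le : s' ≤ s := hsmax hs'S
  have hslow : 1 / ((m + 2) * C * D) ≤ s := by
    have h1 : s' ^ (m + 2) ≤ s ^ (m + 2) := by gcongr
    rw [hs'pow, pow_succ s (m + 1), div_eq_mul_one_div] at h1
    exact le_of_mul_le_mul_left h1 (by positivity)
  refine ENNReal.ofReal_le_of_le_toReal (le_trans ?_ (hsS.2 R ⟨hεR.le, le_rfl⟩))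
  gcongr

end Growth

end FillingRegular

end

theorem mainTheorem7 (n : ℕ) (hn : 2 ≤ n) (c : ℝ) (hc : 0 < c) :
    ∃ C : ℝ, 0 < C ∧
      ∀ (W : Type*) [Fintype W] (L : PreAbstractSimplicialComplex W)
        (h : FillingRegular.RiemannianMetric L), h.IsoperimetricInequality (n - 1) c →
      ∀ (X : Type*) [TopologicalSpace X] (U : Type*) [Fintype U] [LinearOrder U]
        (Z : FillingRegular.GeometricCycle n U X) (j : Z.Inclusion h) (ε : ℝ),
        j.IsFillingRegular ε →
      ∀ v ∈ FillingRegular.space Z.V, ∀ R : ℝ, ε ≤ R → ENNReal.ofReal R < Z.sys / 2 →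
        ENNReal.ofReal (C / (1 + ε) ^ (n - 1) * (R - ε) ^ n) ≤ Z.g.vol n (Z.ball v R) ∧
        (ε ≤ 1 → ENNReal.ofReal (C * (R - ε) ^ n) ≤ Z.g.vol n (Z.ball v R)) := by
  obtain ⟨m, rfl⟩ : ∃ m, n = m + 2 := ⟨n - 2, by omega⟩
  -- the constant of the coarea inequality; the summand `1` only serves to make it positive
  set C₁ : ℝ := (FillingRegular.sliceConst (m + 1) * 3).toReal + 1 with hC₁
  have hC₁pos : 0 < C₁ := by positivity
  have hC₁le : FillingRegular.sliceConst (m + 1) * 3 ≤ ENNReal.ofReal C₁ := by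
    rw [ENNReal.le_ofReal_iff_toReal_le (ENNReal.mul_ne_top
      (FillingRegular.sliceConst_ne_top _) (by norm_num)) hC₁pos.le]
    linarith
  set P : ℝ := ((m + 2) * C₁) ^ (m + 2) * c ^ (m + 1) with hP
  have hPpos : 0 < P := by positivity
  -- the factor `2 ^ (n - 1)` bounds `(1 + ε) ^ (n - 1)` for `ε ≤ 1`
  refine ⟨1 / (P * 2 ^ (m + 1)), by positivity, ?_⟩
  intro W _ L h hiso X _ U _ _ Z j ε hreg v hv R hεR hR
  have hε := hreg.pos
  have hgrowth : ENNReal.ofReal (1 / (P * (1 + ε) ^ (m + 1)) * (R - ε) ^ (m + 2)) ≤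
      Z.g.vol (m + 2) (Z.ball v R) := by
    rcases hεR.eq_or_lt with rfl | hlt
    · simp
    have hD : 0 < (1 + ε) * c := by positivity
    have key := FillingRegular.pow_le_of_integral_inequality (m := m)
      (F := fun t => Z.g.vol (m + 2) (Z.ball v t)) hlt hC₁pos hD
      (fun t t' htt' => MeasureTheory.measure_mono fun x hx =>
        ⟨hx.1, hx.2.trans (ENNReal.ofReal_le_ofReal htt')⟩)
      (FillingRegular.vol_ball_pos Z hv hε)
      (fun t => ((MeasureTheory.measure_mono (Set.subset_univ _)).trans_lt
        (FillingRegular.vol_univ_lt_top Z.g)).ne)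
      (fun R' hR' => by
        obtain ⟨a, ha, hint⟩ := FillingRegular.exists_area_profile j hiso hreg hv hR'.1
          ((ENNReal.ofReal_le_ofReal hR'.2).trans_lt hR)
        refine ⟨a, ?_, hint.trans ?_⟩
        · filter_upwards [ha] with t ht hmem
          rw [ENNReal.ofReal_mul (by positivity), mul_assoc]
          exact ht hmem
        · rw [← mul_assoc]
          gcongr)
    refine le_trans (ENNReal.ofReal_le_ofReal (le_of_eq ?_)) key
    rw [hP]
    simp only [mul_pow, div_pow, one_pow]
    field_simp
    ring
  have hRε : 0 ≤ R - ε := sub_nonneg.2 hεR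
  refine ⟨le_trans (ENNReal.ofReal_le_ofReal ?_) hgrowth,
    fun hε1 => le_trans (ENNReal.ofReal_le_ofReal ?_) hgrowth⟩
  · have h2 : (1 : ℝ) ≤ 2 ^ (m + 1) := one_le_pow₀ (by norm_num)
    rw [div_div, show m + 2 - 1 = m + 1 from rfl]
    gcongr
    exact le_mul_of_one_le_right hPpos.le h2
  · gcongr
    linarith
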